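/- **Notation.** For a quaternion $q=t+xi+yj+zk$ let $\tilde q=t+xi-yj+zk$ (reversion). For $A\in M_n(\mathbb H)$ let $\tilde A^{\mathsf T}$ be the transpose of the entrywise reversion, and let $\phi:M_n(\mathbb H)\to M_{2n}(\mathbb C)$ be the embedding that replaces each entry $q$ by $\begin{pmatrix}t+zi& ix-y\\ ix+y& t-zi\end{pmatrix}$. Put $I_{3,1}=\mathrm{diag}(1,1,1,-1)$ and $$SU(3,1)=\{S\in SL(4,\mathbb C): S^\dagger I_{3,1}S=I_{3,1}\},\qquad SO^*(2n)=\{A\in GL(n,\mathbb H):\det\phi(A)=1,\ \tilde A^{\mathsf T}A=I_n\},$$ $$\mathfrak{su}(3,1)=\{s\in M_4(\mathbb C):\operatorname{tr}s=0,\ I_{3,1}sI_{3,1}=-s^\dagger\},\qquad \mathfrak{so}^*(2n)=\{a\in M_n(\mathbb H):\operatorname{Re}\operatorname{tr}a=0,\ -\tilde a^{\mathsf T}=a\},$$ the last two being real Lie algebras under the commutator. $Spin^*(2n)$ is the preimage of $\phi(SO^*(2n))\subset SO(2n,\mathbb C)$ under the double cover $Spin(2n,\mathbb C)\to SO(2n,\mathbb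 C)$, where $Spin(2n,\mathbb C)$ lies in the complex Clifford algebra of $\sum z_i^2$ and acts on vectors by $v\mapsto xvx^{-1}$. Let $\lambda_1,\dots,\lambda_8$ be $i$ times the usual Gell-Mann matrices divided by $2$, except that $\lambda_2,\lambda_5,\lambda_7$ are $\frac12(E_{21}-E_{12})$, $\frac12(E_{31}-E_{13})$, $\frac12(E_{32}-E_{23})$ (so $\lambda_8=\frac{i}{2\sqrt3}\mathrm{diag}(1,1,-2)$, and $\lambda^\dagger=-\lambda$). Define $s_1,\dots,s_{15}\in M_4(\mathbb C)$ by $s_i=\begin{pmatrix}\overline{\lambda_i}&0\\0&0\end{pmatrix}$ for $1\le i\le 8$, $s_{15}=\frac{i}{2\sqrt6}\mathrm{diag}(1,1,1,-3)$, and $$\sum_{i=9}^{14}\theta_is_i=\frac12\begin{pmatrix}0&v\\ v^\dagger&0\end{pmatrix},\qquad v=(-\theta_{13}+i\theta_{14},\ \theta_{11}-i\theta_{12},\ -\theta_9+i\theta_{10})^{\mathsf T}\qquad(\theta_i\in\mathbb R).$$ Define $a_1,\dots,a_{15}\in M_3(\mathbb H)$ by $$\sum_{i=1}^{15}\theta_ia_i=\frac12\begin{pmatrix}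 \frac{\sqrt2\theta_{15}-2\theta_8}{\sqrt3}j & p & q\\ -\tilde p& \frac{\sqrt2\theta_{15}+\theta_8-\sqrt3\theta_3}{\sqrt3}j & r\\ -\tilde q&-\tilde r&\frac{\sqrt2\theta_{15}+\theta_8+\sqrt3\theta_3}{\sqrt3}j\end{pmatrix},$$ with $p=\theta_7+\theta_{13}i+\theta_6j+\theta_{14}k$, $q=\theta_5+\theta_{11}i+\theta_4j+\theta_{12}k$, $r=\theta_2+\theta_9i+\theta_1j+\theta_{10}k$. Finally let $$U=\frac1{\sqrt2}\begin{pmatrix}0&0&i&0&0&i\\0&0&1&0&0&-1\\0&i&0&0&i&0\\0&1&0&0&-1&0\\i&0&0&i&0&0\\1&0&0&-1&0&0\end{pmatrix}.$$ **Theorem.** 1. (Lie algebras.) $(s_i)$ is a basis of $\mathfrak{su}(3,1)$, $(a_i)$ is a basis of $\mathfrak{so}^*(6)$, and the two bases have the same structure constants: if $[s_i,s_j]=\sum_kf_{ij}{}^ks_k$ and $[a_i,a_j]=\sum_kc_{ij}{}^ka_k$, then $f_{ij}{}^k=c_{ij}{}^k$ for all $i,j,k$. Hence $\sigma:s_i\mapsto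 a_i$ is an isomorphism of Lie algebras $\mathfrak{su}(3,1)\cong\mathfrak{so}^*(6)$. Moreover $U$ is unitary, and the matrices $\hat a_i=U^\dagger\phi(a_i)U$ are, in $3\times3$ blocks, $\hat a_i=\mathrm{diag}(\lambda_i,\overline{\lambda_i})$ for $i\le8$, $\hat a_{15}=\frac{i}{\sqrt6}\mathrm{diag}(I_3,-I_3)$, $\hat a_m=\begin{pmatrix}0&-\lambda_l\\ \lambda_l&0\end{pmatrix}$ and $\hat a_{m+1}=\begin{pmatrix}0&i\lambda_l\\ i\lambda_l&0\end{pmatrix}$ for $(m,l)=(9,2),(11,5),(13,7)$. 2. (Double covering by the exterior square.) There is a continuous homomorphism $\pi:SU(3,1)\to SO^*(6)$ with $\pi(\exp X)=\exp\sigma(X)$ for all $X\in\mathfrak{su}(3,1)$, such that for every $S\in SU(3,1)$ the matrix $U^\dagger\phi(\pi(S))U$ is the matrix of $\wedge^2S$ in the basis $e_2\wedge e_3,\ e_3\wedge e_1,\ e_1\wedge e_2,\ -e_1\wedge e_4,\ -e_2\wedge e_4,\ -e_3\wedge e_4$ of $\wedge^2\mathbb C^4$. It is surjective and a covering map, its kernel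 is $\{\pm I_4\}$, and each of its fibres has exactly two elements; thus $SO^*(6)\cong SU(3,1)/\mathbb Z_2$ as topological groups. 3. (Centers.) The center of $SU(3,1)$ is $\{zI_4:z^4=1\}\cong\mathbb Z_4$, generated by $\exp(\sqrt6\,\pi\,s_{15})=iI_4$. The center of $SO^*(6)$ is $\{\pm I_3\}\cong\mathbb Z_2$, and $\exp(\sqrt6\,\pi\,a_{15})=-I_3$ (here $\pi$ is the number). The covering sends each central element to its square: $\phi(\pi(zI_4))=z^2I_6$ whenever $z^4=1$. 4. There is an isomorphism of topological groups $SU(3,1)\cong Spin^*(6)$ which is compatible with the covering $\pi$ and the projection $Spin^*(6)\to SO^*(6)$. -/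

import Mathlib

open Matrix
open scoped Quaternion

attribute [local instance 100] LieRing.ofAssociativeRing

/-! ### Quaternionic matrices, the complex embedding, and reversion -/

/-- Reversion of a quaternion: only the `j` component changes sign. -/
def reversion (q : ℍ[ℝ]) : ℍ[ℝ] := ⟨q.re, q.imI, -q.imJ, q.imK⟩

/-- The reversion-transpose of a quaternionic matrix. -/
def revTranspose {n : ℕ} (A : Matrix (Fin n) (Fin n) ℍ[ℝ]) : Matrix (Fin n) (Fin n) ℍ[ℝ] :=
  Aᵀ.map reversion

/-- The standard identification `t + x i + y j + z k ↦ !![t + z i, i x - y; i x + y, t - z i]`. -/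
noncomputable def quatToMat (q : ℍ[ℝ]) : Matrix (Fin 2) (Fin 2) ℂ :=
  !![(q.re : ℂ) + q.imK * Complex.I, Complex.I * q.imI - q.imJ;
     Complex.I * q.imI + q.imJ, (q.re : ℂ) - q.imK * Complex.I]

/-- The embedding of `n × n` quaternionic matrices into `2n × 2n` complex matrices, in which each
entry is replaced by its `2 × 2` complex block. -/
noncomputable def complexify {n : ℕ} (A : Matrix (Fin n) (Fin n) ℍ[ℝ]) :
    Matrix (Fin n × Fin 2) (Fin n × Fin 2) ℂ :=
  Matrix.of fun p q => quatToMat (A p.1 q.1) p.2 q.2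

theorem reversion_re (q : ℍ[ℝ]) : (reversion q).re = q.re := rfl

theorem reversion_imI (q : ℍ[ℝ]) : (reversion q).imI = q.imI := rfl

theorem reversion_imJ (q : ℍ[ℝ]) : (reversion q).imJ = -q.imJ := rfl

theorem reversion_imK (q : ℍ[ℝ]) : (reversion q).imK = q.imK := rfl

theorem reversion_mul (p q : ℍ[ℝ]) : reversion (p * q) = reversion q * reversion p := by
  apply Quaternion.ext <;> simp only [Quaternion.re_mul, Quaternion.imI_mul, Quaternion.imJ_mul,
    Quaternion.imK_mul,
    reversion_re, reversion_imI, reversion_imJ, reversion_imK] <;> ring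

theorem reversion_add (p q : ℍ[ℝ]) : reversion (p + q) = reversion p + reversion q := by
  apply Quaternion.ext <;> simp only [Quaternion.re_add, Quaternion.imI_add, Quaternion.imJ_add,
    Quaternion.imK_add,
    reversion_re, reversion_imI, reversion_imJ, reversion_imK] <;> ring

theorem reversion_smul (c : ℝ) (q : ℍ[ℝ]) : reversion (c • q) = c • reversion q := by
  apply Quaternion.ext <;> simp only [Quaternion.re_smul, Quaternion.imI_smul, Quaternion.imJ_smul,
    Quaternion.imK_smul,
    reversion_re, reversion_imI, reversion_imJ, reversion_imK, smul_neg]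

theorem reversion_zero : reversion 0 = 0 := by
  ext <;> simp [reversion]

theorem reversion_one : reversion 1 = 1 := by
  ext <;> simp [reversion]

/-- Reversion as an additive map. -/
def reversionHom : ℍ[ℝ] →+ ℍ[ℝ] where
  toFun := reversion
  map_zero' := reversion_zero
  map_add' := reversion_add

theorem revTranspose_mul {n : ℕ} (A B : Matrix (Fin n) (Fin n) ℍ[ℝ]) :
    revTranspose (A * B) = revTranspose B * revTranspose A := by
  ext1 i j
  simp only [revTranspose, Matrix.map_apply, Matrix.transpose_apply, Matrix.mul_apply]
  exact (map_sum reversionHom _ _).trans (Finset.sum_congr rfl fun k _ => reversion_mul _ _)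

theorem revTranspose_one {n : ℕ} : revTranspose (1 : Matrix (Fin n) (Fin n) ℍ[ℝ]) = 1 := by
  ext1 i j
  by_cases h : i = j
  · subst h; simp [revTranspose, reversion_one]
  · simp [revTranspose, h, reversion_zero]

theorem revTranspose_add {n : ℕ} (A B : Matrix (Fin n) (Fin n) ℍ[ℝ]) :
    revTranspose (A + B) = revTranspose A + revTranspose B := by
  ext1 i j
  simp [revTranspose, reversion_add]

theorem revTranspose_smul {n : ℕ} (c : ℝ) (A : Matrix (Fin n) (Fin n) ℍ[ℝ]) :
    revTranspose (c • A) = c • revTranspose A := by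
  ext1 i j
  simp [revTranspose, reversion_smul]

theorem quatToMat_mul (p q : ℍ[ℝ]) : quatToMat (p * q) = quatToMat p * quatToMat q := by
  ext i j
  fin_cases i <;> fin_cases j <;> simp [quatToMat, Matrix.mul_apply, Fin.sum_univ_two] <;>
    apply Complex.ext <;> simp <;> ring

theorem quatToMat_add (p q : ℍ[ℝ]) : quatToMat (p + q) = quatToMat p + quatToMat q := by
  ext i j
  fin_cases i <;> fin_cases j <;> simp [quatToMat] <;> ring

/-- The identification of a quaternion with a complex matrix, as an additive map. -/
noncomputable def quatToMatHom : ℍ[ℝ] →+ Matrix (Fin 2) (Fin 2) ℂ where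
  toFun := quatToMat
  map_zero' := by ext i j; fin_cases i <;> fin_cases j <;> simp [quatToMat]
  map_add' := quatToMat_add

theorem complexify_mul {n : ℕ} (A B : Matrix (Fin n) (Fin n) ℍ[ℝ]) :
    complexify (A * B) = complexify A * complexify B := by
  ext ⟨i, a⟩ ⟨j, b⟩
  have h : quatToMat (∑ k, A i k * B k j) = ∑ k, quatToMat (A i k) * quatToMat (B k j) :=
    (map_sum quatToMatHom _ _).trans (Finset.sum_congr rfl fun k _ => quatToMat_mul _ _)
  simp only [complexify, Matrix.of_apply, Matrix.mul_apply, h, Fintype.sum_prod_type,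
    Matrix.sum_apply]

theorem complexify_one {n : ℕ} : complexify (1 : Matrix (Fin n) (Fin n) ℍ[ℝ]) = 1 := by
  ext ⟨i, a⟩ ⟨j, b⟩
  by_cases h : i = j
  · subst h
    fin_cases a <;> fin_cases b <;> simp [complexify, quatToMat, Matrix.one_apply]
  · fin_cases a <;> fin_cases b <;> simp [complexify, quatToMat, Matrix.one_apply, h]

/-! ### The groups -/

/-- The diagonal matrix `I_{3,1} = diag(1, 1, 1, -1)`. -/
def I31 : Matrix (Fin 4) (Fin 4) ℂ := Matrix.diagonal ![1, 1, 1, -1]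

/-- `SU(3,1) = {S ∈ SL(4, ℂ) | S† I_{3,1} S = I_{3,1}}`. -/
def SU31 : Subgroup (SpecialLinearGroup (Fin 4) ℂ) where
  carrier := {S | (S : Matrix (Fin 4) (Fin 4) ℂ)ᴴ * I31 * (S : Matrix (Fin 4) (Fin 4) ℂ) = I31}
  one_mem' := by
    change (1 : Matrix (Fin 4) (Fin 4) ℂ)ᴴ * I31 * 1 = I31
    rw [conjTranspose_one, Matrix.one_mul, Matrix.mul_one]
  mul_mem' := by
    intro S R hS hR
    change S.1ᴴ * I31 * S.1 = I31 at hS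
    change R.1ᴴ * I31 * R.1 = I31 at hR
    change (S.1 * R.1)ᴴ * I31 * (S.1 * R.1) = I31
    rw [conjTranspose_mul]
    calc R.1ᴴ * S.1ᴴ * I31 * (S.1 * R.1) = R.1ᴴ * (S.1ᴴ * I31 * S.1) * R.1 := by
          simp only [Matrix.mul_assoc]
      _ = I31 := by rw [hS, hR]
  inv_mem' := by
    intro S hS
    change S.1ᴴ * I31 * S.1 = I31 at hS
    have h : S.1 * S⁻¹.1 = 1 := congrArg Subtype.val (mul_inv_cancel S)
    change S⁻¹.1ᴴ * I31 * S⁻¹.1 = I31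
    calc S⁻¹.1ᴴ * I31 * S⁻¹.1 = S⁻¹.1ᴴ * (S.1ᴴ * I31 * S.1) * S⁻¹.1 := by rw [hS]
      _ = (S.1 * S⁻¹.1)ᴴ * I31 * (S.1 * S⁻¹.1) := by
          rw [conjTranspose_mul]; simp only [Matrix.mul_assoc]
      _ = I31 := by rw [h, conjTranspose_one, Matrix.one_mul, Matrix.mul_one]

/-- `SL(n, ℍ)`: the invertible quaternionic matrices whose Study determinant, which is the
determinant of the associated `2n × 2n` complex matrix, is `1`. -/
def SLH (n : ℕ) : Subgroup (Matrix (Fin n) (Fin n) ℍ[ℝ])ˣ where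
  carrier := {A | (complexify (A : Matrix (Fin n) (Fin n) ℍ[ℝ])).det = 1}
  one_mem' := by simp [complexify_one]
  mul_mem' := by
    intro A B hA hB
    simp only [Set.mem_ofPred_eq, Units.val_mul, complexify_mul, det_mul] at *
    rw [hA, hB, one_mul]
  inv_mem' := by
    intro A hA
    simp only [Set.mem_ofPred_eq] at *
    have h := congrArg (fun M => (complexify M).det) A.mul_inv
    simpa only [complexify_mul, complexify_one, det_mul, det_one, hA, one_mul] using h

/-- `SO*(2n) = {A ∈ SL(n, ℍ) | Ãᵀ A = 1}`, the tilde being entrywise reversion. -/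
def SOStar (n : ℕ) : Subgroup (Matrix (Fin n) (Fin n) ℍ[ℝ])ˣ where
  carrier := {A | A ∈ SLH n ∧ revTranspose (A : Matrix (Fin n) (Fin n) ℍ[ℝ]) *
    (A : Matrix (Fin n) (Fin n) ℍ[ℝ]) = 1}
  one_mem' := ⟨one_mem _, by simp [revTranspose_one]⟩
  mul_mem' := by
    intro A B hA hB
    refine ⟨mul_mem hA.1 hB.1, ?_⟩
    rw [Units.val_mul, revTranspose_mul, Matrix.mul_assoc, ← Matrix.mul_assoc _ A.val, hA.2,
      Matrix.one_mul, hB.2]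
  inv_mem' := by
    intro A hA
    refine ⟨inv_mem hA.1, ?_⟩
    have h : revTranspose (A : Matrix (Fin n) (Fin n) ℍ[ℝ]) =
        ((A⁻¹ : (Matrix (Fin n) (Fin n) ℍ[ℝ])ˣ) : Matrix (Fin n) (Fin n) ℍ[ℝ]) := by
      rw [← mul_one (revTranspose (A : Matrix (Fin n) (Fin n) ℍ[ℝ])), ← A.mul_inv,
        ← mul_assoc, hA.2, one_mul]
    rw [← h, ← revTranspose_mul, h, A.mul_inv, revTranspose_one]

/-! ### The Lie algebras -/

/-- `su(3,1) = {s ∈ sl(4, ℂ) | I_{3,1} s I_{3,1} = -s†}`, as a real Lie algebra. -/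
def su31 : LieSubalgebra ℝ (Matrix (Fin 4) (Fin 4) ℂ) where
  carrier := {s | s.trace = 0 ∧ I31 * s * I31 = -sᴴ}
  zero_mem' := by simp
  add_mem' := by
    intro a b ha hb
    refine ⟨by rw [trace_add, ha.1, hb.1, add_zero], ?_⟩
    rw [Matrix.mul_add, Matrix.add_mul, ha.2, hb.2, conjTranspose_add, neg_add]
  smul_mem' := by
    intro c a ha
    refine ⟨by rw [trace_smul, ha.1, smul_zero], ?_⟩
    rw [Matrix.mul_smul, Matrix.smul_mul, ha.2, conjTranspose_smul, star_trivial, smul_neg]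
  lie_mem' := by
    intro a b ha hb
    have hI : I31 * I31 = 1 := by
      rw [I31, diagonal_mul_diagonal, ← diagonal_one]
      congr 1
      ext i
      fin_cases i <;> simp
    have key : ∀ x y : Matrix (Fin 4) (Fin 4) ℂ,
        I31 * (x * y) * I31 = (I31 * x * I31) * (I31 * y * I31) := by
      intro x y
      calc I31 * (x * y) * I31 = I31 * x * 1 * y * I31 := by simp only [Matrix.mul_assoc,
            Matrix.one_mul]
        _ = _ := by rw [← hI]; simp only [Matrix.mul_assoc]
    refine ⟨by rw [Ring.lie_def, trace_sub, trace_mul_comm, sub_self], ?_⟩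
    rw [Ring.lie_def, Matrix.mul_sub, Matrix.sub_mul, key, key, ha.2, hb.2, conjTranspose_sub,
      conjTranspose_mul, conjTranspose_mul]
    noncomm_ring

/-- `so*(2n) = {a ∈ sl(n, ℍ) | -ãᵀ = a}`, as a real Lie algebra; `sl(n, ℍ)` consists of the
quaternionic matrices whose trace has real part zero. -/
def soStar (n : ℕ) : LieSubalgebra ℝ (Matrix (Fin n) (Fin n) ℍ[ℝ]) where
  carrier := {a | a.trace.re = 0 ∧ -revTranspose a = a}
  zero_mem' := by
    refine ⟨by simp, ?_⟩
    ext1 i j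
    simp [revTranspose, reversion_zero]
  add_mem' := by
    intro a b ha hb
    refine ⟨by rw [trace_add, Quaternion.re_add, ha.1, hb.1, add_zero], ?_⟩
    rw [revTranspose_add, neg_add, ha.2, hb.2]
  smul_mem' := by
    intro c a ha
    refine ⟨by rw [trace_smul, Quaternion.re_smul, ha.1, smul_zero], ?_⟩
    rw [revTranspose_smul, ← smul_neg, ha.2]
  lie_mem' := by
    intro a b ha hb
    have h : -revTranspose ⁅a, b⁆ = ⁅a, b⁆ := by
      have hab : revTranspose (a * b) = b * a := by
        rw [revTranspose_mul, ← neg_mul_neg, ha.2, hb.2]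
      have hba : revTranspose (b * a) = a * b := by
        rw [revTranspose_mul, ← neg_mul_neg, ha.2, hb.2]
      have hs : revTranspose (a * b - b * a) = b * a - a * b := by
        rw [sub_eq_add_neg, revTranspose_add, ← neg_one_smul ℝ (b * a), revTranspose_smul, hab,
          hba, neg_one_smul, sub_eq_add_neg]
      rw [Ring.lie_def, hs, neg_sub]
    refine ⟨?_, h⟩
    have hd : ∀ i, (⁅a, b⁆ i i).re = 0 := by
      intro i
      have h1 : -(⁅a, b⁆ i i).re = (⁅a, b⁆ i i).re :=
        congrArg QuaternionAlgebra.re (congrFun (congrFun h i) i)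
      linarith
    have ht : (trace ⁅a, b⁆).re = ∑ i, (⁅a, b⁆ i i).re := by
      simp only [trace, diag_apply]
      exact map_sum (AddMonoidHom.mk' (fun q : ℍ[ℝ] => q.re) fun _ _ => rfl) _ _
    rw [ht, Finset.sum_eq_zero fun i _ => hd i]

/-! ### The explicit bases; the index `i : Fin 15` stands for the generator number `i + 1` -/

/-- The (anti-Hermitian) Gell-Mann matrices `λ₁, …, λ₈`. -/
noncomputable def gellMann : Fin 8 → Matrix (Fin 3) (Fin 3) ℂ :=
  let c : ℂ := 1 / 2
  let d : ℂ := 1 / (2 * (Real.sqrt 3 : ℂ))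
  let I := Complex.I
  ![c • !![0, I, 0; I, 0, 0; 0, 0, 0],
    c • !![0, -1, 0; 1, 0, 0; 0, 0, 0],
    c • !![I, 0, 0; 0, -I, 0; 0, 0, 0],
    c • !![0, 0, I; 0, 0, 0; I, 0, 0],
    c • !![0, 0, -1; 0, 0, 0; 1, 0, 0],
    c • !![0, 0, 0; 0, 0, I; 0, I, 0],
    c • !![0, 0, 0; 0, 0, -1; 0, 1, 0],
    d • !![I, 0, 0; 0, I, 0; 0, 0, -2 * I]]

/-- Entrywise complex conjugation. -/
def conjMat {m : Type*} (M : Matrix m m ℂ) : Matrix m m ℂ := M.map (starRingEnd ℂ)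

/-- The `4 × 4` matrix with upper left `3 × 3` block `M` and all other entries zero. -/
def cornerBlock (M : Matrix (Fin 3) (Fin 3) ℂ) : Matrix (Fin 4) (Fin 4) ℂ :=
  !![M 0 0, M 0 1, M 0 2, 0; M 1 0, M 1 1, M 1 2, 0; M 2 0, M 2 1, M 2 2, 0; 0, 0, 0, 0]

/-- The general combination `∑ θ_i s_i` of the generators of `su(3,1)`. -/
noncomputable def suMatrix (θ : Fin 15 → ℝ) : Matrix (Fin 4) (Fin 4) ℂ :=
  let I := Complex.I
  (∑ k : Fin 8, (θ (Fin.castLE (by norm_num) k) : ℂ) • cornerBlock (conjMat (gellMann k))) +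
  (1 / 2 : ℂ) •
    !![0, 0, 0, -θ 12 + I * θ 13;
       0, 0, 0, θ 10 - I * θ 11;
       0, 0, 0, -θ 8 + I * θ 9;
       -θ 12 - I * θ 13, θ 10 + I * θ 11, -θ 8 - I * θ 9, 0] +
  ((θ 14 : ℂ) * (I / (2 * (Real.sqrt 6 : ℂ)))) • Matrix.diagonal ![1, 1, 1, -3]

/-- The general combination `∑ θ_i a_i` of the generators of `so*(6)`; `⟨t, x, y, z⟩` is the
quaternion `t + x i + y j + z k`. -/
noncomputable def soMatrix (θ : Fin 15 → ℝ) : Matrix (Fin 3) (Fin 3) ℍ[ℝ] :=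
  let r2 := Real.sqrt 2
  let r3 := Real.sqrt 3
  (1 / 2 : ℝ) •
    !![⟨0, 0, (r2 * θ 14 - 2 * θ 7) / r3, 0⟩, ⟨θ 6, θ 12, θ 5, θ 13⟩, ⟨θ 4, θ 10, θ 3, θ 11⟩;
       ⟨-θ 6, -θ 12, θ 5, -θ 13⟩, ⟨0, 0, (r2 * θ 14 + θ 7 - r3 * θ 2) / r3, 0⟩,
         ⟨θ 1, θ 8, θ 0, θ 9⟩;
       ⟨-θ 4, -θ 10, θ 3, -θ 11⟩, ⟨-θ 1, -θ 8, θ 0, -θ 9⟩,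
         ⟨0, 0, (r2 * θ 14 + θ 7 + r3 * θ 2) / r3, 0⟩]

/-- The complex `6 × 6` form of the generators of `so*(6)`, in `3 × 3` blocks. -/
noncomputable def soComplexGen : Fin 15 → Matrix (Fin 3 ⊕ Fin 3) (Fin 3 ⊕ Fin 3) ℂ :=
  let I := Complex.I
  let D := fun k : Fin 8 => fromBlocks (gellMann k) 0 0 (conjMat (gellMann k))
  let X := fun k : Fin 8 => fromBlocks 0 (-gellMann k) (gellMann k) 0
  let Y := fun k : Fin 8 => fromBlocks 0 (I • gellMann k) (I • gellMann k) 0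
  ![D 0, D 1, D 2, D 3, D 4, D 5, D 6, D 7, X 1, Y 1, X 4, Y 4, X 6, Y 6,
    (I / (Real.sqrt 6 : ℂ)) • fromBlocks 1 0 0 (-1)]

/-- The change of basis matrix; its rows are numbered by (quaternionic coordinate, position in the
`2 × 2` block) and its columns by the two blocks of three coordinates. -/
noncomputable def changeOfBasis : Matrix (Fin 3 × Fin 2) (Fin 3 ⊕ Fin 3) ℂ :=
  let I := Complex.I
  Matrix.submatrix (m := Fin 6) (n := Fin 6) ((1 / (Real.sqrt 2 : ℂ)) •
    !![0, 0, I, 0, 0, I;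
       0, 0, 1, 0, 0, -1;
       0, I, 0, 0, I, 0;
       0, 1, 0, 0, -1, 0;
       I, 0, 0, I, 0, 0;
       1, 0, 0, -1, 0, 0]) finProdFinEquiv finSumFinEquiv

/-- The basis `e₂∧e₃, e₃∧e₁, e₁∧e₂, -e₁∧e₄, -e₂∧e₄, -e₃∧e₄` of `⋀²ℂ⁴`. -/
noncomputable def wedgeVec : Fin 3 ⊕ Fin 3 → ⋀[ℂ]^2 (Fin 4 → ℂ) :=
  let w := fun i j : Fin 4 =>
    exteriorPower.ιMulti ℂ 2 ![(Pi.single i 1 : Fin 4 → ℂ), Pi.single j 1]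
  Sum.elim ![w 1 2, w 2 0, w 0 1] ![-w 0 3, -w 1 3, -w 2 3]

/-! ### The group `Spin*(2n)` -/

/-- The standard quadratic form `∑ z_i²` on `ℂ²ⁿ`. -/
noncomputable def stdQuad (n : ℕ) : QuadraticForm ℂ (Fin n × Fin 2 → ℂ) :=
  QuadraticMap.weightedSumSquares ℂ fun _ => (1 : ℂ)

/-- The complex Clifford algebra carries its topology as a finite dimensional vector space. -/
noncomputable instance cliffordTopology (n : ℕ) : TopologicalSpace (CliffordAlgebra (stdQuad n)) :=
  moduleTopology ℂ (CliffordAlgebra (stdQuad n))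

/-- `Spin*(2n)`: the preimage of `SO*(2n) ⊆ SO(2n, ℂ)` under the double cover
`Spin(2n, ℂ) → SO(2n, ℂ)`, where `x` acts on vectors `v` by `v ↦ x v x⁻¹ = x v (star x)`. -/
def SpinStar (n : ℕ) : Subgroup (spinGroup (stdQuad n)) where
  carrier := {x | ∃ A ∈ SOStar n, ∀ v : Fin n × Fin 2 → ℂ,
    (x : CliffordAlgebra (stdQuad n)) * CliffordAlgebra.ι (stdQuad n) v *
      star (x : CliffordAlgebra (stdQuad n)) =
        CliffordAlgebra.ι (stdQuad n)
          (complexify (A : Matrix (Fin n) (Fin n) ℍ[ℝ]) *ᵥ v)}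
  one_mem' := ⟨1, one_mem _, fun v => by simp [complexify_one]⟩
  mul_mem' := by
    rintro x y ⟨A, hA, hx⟩ ⟨B, hB, hy⟩
    refine ⟨A * B, mul_mem hA hB, fun v => ?_⟩
    rw [Units.val_mul, complexify_mul, ← mulVec_mulVec, ← hx, ← hy, Submonoid.coe_mul, star_mul]
    simp only [mul_assoc]
  inv_mem' := by
    rintro x ⟨A, hA, hx⟩
    refine ⟨A⁻¹, inv_mem hA, fun v => ?_⟩
    have h1 : star (x : CliffordAlgebra (stdQuad n)) * x = 1 :=
      spinGroup.star_mul_self_of_mem x.2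
    have hi : ((x⁻¹ : spinGroup (stdQuad n)) : CliffordAlgebra (stdQuad n)) = star x.val := rfl
    have hv : complexify (A : Matrix (Fin n) (Fin n) ℍ[ℝ]) *ᵥ
        (complexify ((A⁻¹ : (Matrix (Fin n) (Fin n) ℍ[ℝ])ˣ) : Matrix (Fin n) (Fin n) ℍ[ℝ]) *ᵥ v)
        = v := by
      rw [mulVec_mulVec, ← complexify_mul, A.mul_inv, complexify_one, one_mulVec]
    have h := hx (complexify ((A⁻¹ : (Matrix (Fin n) (Fin n) ℍ[ℝ])ˣ) :
      Matrix (Fin n) (Fin n) ℍ[ℝ]) *ᵥ v)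
    rw [hv] at h
    rw [hi, star_star, ← h]
    simp only [mul_assoc, h1, mul_one]
    rw [← mul_assoc, h1, one_mul]

/-! ### The exterior square of `ℂ⁴` in coordinates -/

/-! The theorem is the coincidence A₃ = D₃ for a particular pair of real forms, realised on Λ²ℂ⁴.
The wedge product Λ² × Λ² → Λ⁴ is a symmetric bilinear form which a matrix scales by its determinant
(`wedgeSq_gram`), so `SL(4, ℂ)` acts on Λ²ℂ⁴ by orthogonal maps. A matrix preserving `I31` also
preserves the induced Hermitian form. The two forms together define an antilinear operator of square
-1, which such a matrix commutes with: a quaternionic structure on ℂ⁶ (`wedgeSq_mul_conj`). The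
unitary matrix U carries the bilinear form to ∑ zᵢ² and this operator to the one whose commutant is
the image of φ (`changeOfBasis_transpose_mul`, `changeOfBasis_mul_transpose`). As φ turns
reversion-transpose into transpose, the exterior square written in the frame U takes values in
SO*(6).

Kernel and surjectivity come from the Clifford algebra. An antisymmetric 4 × 4 matrix times its
Hodge dual is a scalar, the quadratic form (`bivec_mul_bivecDual`), so bivectors act as gamma
matrices on ℂ⁴ ⊕ ℂ⁴, and the Clifford algebra becomes the full algebra of 8 × 8 matrices
(`spinor_surjective` and a dimension count). The block matrix of S and its inverse transpose
implements Λ²S on gamma matrices (`spinBlock_mul_spinor_ι`). If Λ²S = 1, this block matrix is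
central, hence scalar, and S = ±1. Conversely a complex rotation is an even product of reflections,
and a product of two unit gamma matrices is such a block matrix and lies in the spin group
(`hasSpinLift_of_orthogonal`). This identifies `SL(4, ℂ)` with the complex spin group. If the
rotation is quaternionic, a lift S has the same image as I S⁻† I with I = `I31`, so the two agree up
to sign, and the signature (3,1) rules out the minus sign (`mem_SU31_of_wedgeRot_eq_complexify`).

On Lie algebras σ is the derivation of Λ² in the frame U. One entrywise comparison of the generators
(`complexify_soMatrix_mul`) gives the brackets, the structure constants and, with `wedgeSq_exp`, the
compatibility with exponentials. The covering property follows from the open mapping theorem for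
groups, and the center of SO*(6) is found by lifting to SU(3,1), where elements commute up to sign.
-/

/-- The index set of the basis `wedgeVec`. -/
abbrev WedgeIdx := Fin 3 ⊕ Fin 3

/-- The pairs `(p, q)` such that `wedgeVec x = e_p ∧ e_q`. -/
def wedgePair : WedgeIdx → Fin 4 × Fin 4 :=
  Sum.elim ![(1, 2), (2, 0), (0, 1)] ![(3, 0), (3, 1), (3, 2)]

/-- The matrix of `2 × 2` minors of a `4 × 4` matrix: its exterior square. -/
def wedgeSq (S : Matrix (Fin 4) (Fin 4) ℂ) : Matrix WedgeIdx WedgeIdx ℂ :=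
  Matrix.of fun x y =>
    S (wedgePair x).1 (wedgePair y).1 * S (wedgePair x).2 (wedgePair y).2 -
      S (wedgePair x).1 (wedgePair y).2 * S (wedgePair x).2 (wedgePair y).1

/-- The derivation of the exterior square induced by a `4 × 4` matrix. -/
def wedgeDer (X : Matrix (Fin 4) (Fin 4) ℂ) : Matrix WedgeIdx WedgeIdx ℂ :=
  let δ := (1 : Matrix (Fin 4) (Fin 4) ℂ)
  Matrix.of fun x y =>
    X (wedgePair x).1 (wedgePair y).1 * δ (wedgePair x).2 (wedgePair y).2 +
      δ (wedgePair x).1 (wedgePair y).1 * X (wedgePair x).2 (wedgePair y).2 -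
      X (wedgePair x).1 (wedgePair y).2 * δ (wedgePair x).2 (wedgePair y).1 -
      δ (wedgePair x).1 (wedgePair y).2 * X (wedgePair x).2 (wedgePair y).1

/-- The antisymmetric matrix of a bivector. -/
def bivec : (WedgeIdx → ℂ) →ₗ[ℂ] Matrix (Fin 4) (Fin 4) ℂ where
  toFun w := !![0, w (.inl 2), -w (.inl 1), -w (.inr 0);
    -w (.inl 2), 0, w (.inl 0), -w (.inr 1);
    w (.inl 1), -w (.inl 0), 0, -w (.inr 2);
    w (.inr 0), w (.inr 1), w (.inr 2), 0]
  map_add' v w := by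
    ext i j
    fin_cases i <;> fin_cases j <;> simp <;> ring
  map_smul' c w := by
    ext i j
    fin_cases i <;> fin_cases j <;> simp

/-- Twice the Hodge dual of the antisymmetric matrix of a bivector, up to sign. -/
def bivecDual : (WedgeIdx → ℂ) →ₗ[ℂ] Matrix (Fin 4) (Fin 4) ℂ where
  toFun w := (2 : ℂ) • !![0, w (.inr 2), -w (.inr 1), -w (.inl 0);
    -w (.inr 2), 0, w (.inr 0), -w (.inl 1);
    w (.inr 1), -w (.inr 0), 0, -w (.inl 2);
    w (.inl 0), w (.inl 1), w (.inl 2), 0]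
  map_add' v w := by
    ext i j
    fin_cases i <;> fin_cases j <;> simp <;> ring
  map_smul' c w := by
    ext i j
    fin_cases i <;> fin_cases j <;> simp <;> ring

/-- The symmetric bilinear form `-2 · vol` on bivectors. -/
def wedgeGram : Matrix WedgeIdx WedgeIdx ℂ := fromBlocks 0 (-1) (-1) 0

/-- The Hermitian form on bivectors induced by `I31`. -/
def wedgeHerm : Matrix WedgeIdx WedgeIdx ℂ := fromBlocks 1 0 0 (-1)

theorem bivec_injective : Function.Injective bivec := by
  intro v w h
  have h' : ∀ i j, bivec v i j = bivec w i j := fun i j => by rw [h]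
  funext x
  rcases x with x | x <;> fin_cases x
  · simpa [bivec] using h' 1 2
  · simpa [bivec] using h' 2 0
  · simpa [bivec] using h' 0 1
  · simpa [bivec] using h' 3 0
  · simpa [bivec] using h' 3 1
  · simpa [bivec] using h' 3 2

theorem transpose_bivec (w : WedgeIdx → ℂ) : (bivec w)ᵀ = -bivec w := by
  ext i j
  fin_cases i <;> fin_cases j <;> simp [bivec]

theorem transpose_bivecDual (w : WedgeIdx → ℂ) : (bivecDual w)ᵀ = -bivecDual w := by
  ext i j
  fin_cases i <;> fin_cases j <;> simp [bivecDual]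

/-- Two different matrices are allowed so that the case S = T yields the exterior square, and the
cases where one factor is 1 yield its derivation. -/
theorem mul_bivec_mul_transpose_apply (S T : Matrix (Fin 4) (Fin 4) ℂ) (w : WedgeIdx → ℂ)
    (i j : Fin 4) : (S * bivec w * Tᵀ) i j = ∑ x, (S i (wedgePair x).1 * T j (wedgePair x).2 -
      S i (wedgePair x).2 * T j (wedgePair x).1) * w x := by
  simp [bivec, wedgePair, Matrix.mul_apply, Fin.sum_univ_four, Fin.sum_univ_three]
  ring

theorem bivec_eq_of_antisymm (F : Fin 4 → Fin 4 → ℂ) (hF : ∀ i j, F i j = -F j i) :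
    bivec (fun x => F (wedgePair x).1 (wedgePair x).2) = of F := by
  have h0 : ∀ i, F i i = 0 := fun i => by linear_combination (1 / 2 : ℂ) * hF i i
  ext i j
  fin_cases i <;> fin_cases j <;> simp [bivec, wedgePair, h0] <;> simpa using (hF _ _).symm

/-- In terms of antisymmetric matrices the exterior square is congruence; identities between 2 × 2
minors thereby become matrix algebra. -/
theorem bivec_mulVec_wedgeSq (S : Matrix (Fin 4) (Fin 4) ℂ) (w : WedgeIdx → ℂ) :
    bivec (wedgeSq S *ᵥ w) = S * bivec w * Sᵀ := by
  have h := bivec_eq_of_antisymm (fun i j => (S * bivec w * Sᵀ) i j) fun i j => by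
    rw [mul_bivec_mul_transpose_apply, mul_bivec_mul_transpose_apply, ← Finset.sum_neg_distrib]
    exact Finset.sum_congr rfl fun x _ => by ring
  refine Eq.trans (congrArg bivec ?_) h
  funext x
  exact (mul_bivec_mul_transpose_apply S S w _ _).symm

theorem bivec_mulVec_wedgeDer (X : Matrix (Fin 4) (Fin 4) ℂ) (w : WedgeIdx → ℂ) :
    bivec (wedgeDer X *ᵥ w) = X * bivec w + bivec w * Xᵀ := by
  have h1 : ∀ i j, (X * bivec w + bivec w * Xᵀ) i j =
      (X * bivec w * (1 : Matrix (Fin 4) (Fin 4) ℂ)ᵀ) i j +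
        ((1 : Matrix (Fin 4) (Fin 4) ℂ) * bivec w * Xᵀ) i j := by
    intro i j
    rw [transpose_one, Matrix.mul_one, Matrix.one_mul, Matrix.add_apply]
  have h := bivec_eq_of_antisymm (fun i j => (X * bivec w + bivec w * Xᵀ) i j) fun i j => by
    simp only [h1, mul_bivec_mul_transpose_apply]
    rw [← Finset.sum_add_distrib, ← Finset.sum_add_distrib, ← Finset.sum_neg_distrib]
    exact Finset.sum_congr rfl fun x _ => by ring
  refine Eq.trans (congrArg bivec ?_) h
  funext x
  simp only [h1, mul_bivec_mul_transpose_apply]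
  rw [← Finset.sum_add_distrib, mulVec, dotProduct]
  exact Finset.sum_congr rfl fun y _ => by simp only [wedgeDer, of_apply]; ring

theorem dotProduct_wedgeGram_mulVec (v w : WedgeIdx → ℂ) :
    v ⬝ᵥ wedgeGram *ᵥ w = -∑ k, (v (.inl k) * w (.inr k) + v (.inr k) * w (.inl k)) := by
  simp [wedgeGram, fromBlocks_mulVec, neg_mulVec, dotProduct, Finset.sum_add_distrib]
  ring

/-- This is the Pfaffian identity, and it is what makes bivectors satisfy the Clifford relation. -/
theorem bivec_mul_bivecDual (w : WedgeIdx → ℂ) :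
    bivec w * bivecDual w = (w ⬝ᵥ wedgeGram *ᵥ w) • 1 := by
  rw [dotProduct_wedgeGram_mulVec]
  ext i j
  fin_cases i <;> fin_cases j <;>
    simp [bivec, bivecDual, Matrix.mul_apply, Fin.sum_univ_four, Fin.sum_univ_three] <;>
    ring

theorem bivecDual_mul_bivec (w : WedgeIdx → ℂ) :
    bivecDual w * bivec w = (w ⬝ᵥ wedgeGram *ᵥ w) • 1 := by
  have h := congrArg Matrix.transpose (bivec_mul_bivecDual w)
  simpa [transpose_mul, transpose_bivec, transpose_bivecDual] using h

theorem mulVec_ext {m n : Type*} [Fintype n] [DecidableEq n] {A B : Matrix m n ℂ}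
    (h : ∀ v, A *ᵥ v = B *ᵥ v) : A = B := by
  ext i j
  simpa using congrFun (h (Pi.single j 1)) i

/-- The Cauchy–Binet formula for 2 × 2 minors, read off from (ST)B(ST)ᵀ = S(TBTᵀ)Sᵀ. -/
theorem wedgeSq_mul (S T : Matrix (Fin 4) (Fin 4) ℂ) :
    wedgeSq (S * T) = wedgeSq S * wedgeSq T := by
  refine mulVec_ext fun w => bivec_injective ?_
  rw [← mulVec_mulVec]
  simp only [bivec_mulVec_wedgeSq, transpose_mul, Matrix.mul_assoc]

theorem wedgeSq_one : wedgeSq 1 = 1 := by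
  refine mulVec_ext fun w => bivec_injective ?_
  simp only [bivec_mulVec_wedgeSq, transpose_one, Matrix.one_mul, Matrix.mul_one, one_mulVec]

theorem wedgeSq_smul (c : ℂ) (S : Matrix (Fin 4) (Fin 4) ℂ) :
    wedgeSq (c • S) = c ^ 2 • wedgeSq S := by
  ext x y
  simp only [wedgeSq, of_apply, Matrix.smul_apply, smul_eq_mul]
  ring

theorem wedgeSq_conjTranspose (S : Matrix (Fin 4) (Fin 4) ℂ) : wedgeSq Sᴴ = (wedgeSq S)ᴴ := by
  ext x y
  simp only [wedgeSq, of_apply, conjTranspose_apply, star_sub, star_mul']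
  ring

theorem wedgeSq_I31 : wedgeSq I31 = wedgeHerm := by
  ext x y
  rcases x with x | x <;> rcases y with y | y <;> fin_cases x <;> fin_cases y <;>
    simp [wedgeSq, wedgePair, wedgeHerm, I31]

theorem wedgeDer_lie (X Y : Matrix (Fin 4) (Fin 4) ℂ) :
    wedgeDer ⁅X, Y⁆ = ⁅wedgeDer X, wedgeDer Y⁆ := by
  refine mulVec_ext fun w => bivec_injective ?_
  rw [Ring.lie_def, Ring.lie_def, sub_mulVec, ← mulVec_mulVec, ← mulVec_mulVec, map_sub]
  simp only [bivec_mulVec_wedgeDer, transpose_sub, transpose_mul]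
  noncomm_ring

/-- Laplace expansion along the first two rows, so that the determinant appears through the minors
occurring in `wedgeSq`. -/
theorem det_fin_four (S : Matrix (Fin 4) (Fin 4) ℂ) :
    S.det = (S 0 0 * S 1 1 - S 0 1 * S 1 0) * (S 2 2 * S 3 3 - S 2 3 * S 3 2)
      - (S 0 0 * S 1 2 - S 0 2 * S 1 0) * (S 2 1 * S 3 3 - S 2 3 * S 3 1)
      + (S 0 0 * S 1 3 - S 0 3 * S 1 0) * (S 2 1 * S 3 2 - S 2 2 * S 3 1)
      + (S 0 1 * S 1 2 - S 0 2 * S 1 1) * (S 2 0 * S 3 3 - S 2 3 * S 3 0)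
      - (S 0 1 * S 1 3 - S 0 3 * S 1 1) * (S 2 0 * S 3 2 - S 2 2 * S 3 0)
      + (S 0 2 * S 1 3 - S 0 3 * S 1 2) * (S 2 0 * S 3 1 - S 2 1 * S 3 0) := by
  simp [det_succ_row_zero, Fin.sum_univ_succ, Fin.succAbove]
  ring

theorem transpose_mul_wedgeGram_mul_apply (A B : Matrix WedgeIdx WedgeIdx ℂ) (x y : WedgeIdx) :
    (Aᵀ * wedgeGram * B) x y =
      -∑ k, (A (.inl k) x * B (.inr k) y + A (.inr k) x * B (.inl k) y) := by
  rw [← dotProduct_wedgeGram_mulVec (fun z => A z x) fun z => B z y, Matrix.mul_assoc]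
  rfl

/-- The form is -2 times the pairing into the line Λ⁴ℂ⁴, on which S acts by its determinant; in
entries this is Laplace expansion, with repeated rows or columns giving the zeros. -/
theorem wedgeSq_gram (S : Matrix (Fin 4) (Fin 4) ℂ) :
    (wedgeSq S)ᵀ * wedgeGram * wedgeSq S = S.det • wedgeGram := by
  ext x y
  rw [transpose_mul_wedgeGram_mul_apply, det_fin_four]
  rcases x with x | x <;> rcases y with y | y <;> fin_cases x <;> fin_cases y <;>
    simp [wedgeSq, wedgePair, wedgeGram, Fin.sum_univ_three] <;> ring

theorem wedgeGram_mul_apply (A : Matrix WedgeIdx WedgeIdx ℂ) (x y : WedgeIdx) :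
    (wedgeGram * A) x y = -A x.swap y := by
  rcases x with x | x <;> simp [wedgeGram, Matrix.mul_apply, Matrix.one_apply]

theorem transpose_wedgeGram : wedgeGramᵀ = wedgeGram := by
  simp [wedgeGram, fromBlocks_transpose]

theorem wedgeDer_gram (X : Matrix (Fin 4) (Fin 4) ℂ) :
    (wedgeDer X)ᵀ * wedgeGram + wedgeGram * wedgeDer X = X.trace • wedgeGram := by
  rw [← transpose_wedgeGram, ← transpose_mul, transpose_wedgeGram]
  ext x y
  rw [Matrix.add_apply, transpose_apply, wedgeGram_mul_apply, wedgeGram_mul_apply]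
  rcases x with x | x <;> rcases y with y | y <;> fin_cases x <;> fin_cases y <;>
    simp [wedgeDer, wedgePair, wedgeGram, Matrix.one_apply, Fin.sum_univ_four, trace] <;> ring

theorem wedgeSq_diagonal (D : Fin 4 → ℂ) :
    wedgeSq (diagonal D) = diagonal fun x => D (wedgePair x).1 * D (wedgePair x).2 := by
  ext x y
  rcases x with x | x <;> rcases y with y | y <;> fin_cases x <;> fin_cases y <;>
    simp [wedgeSq, wedgePair, diagonal_apply]

theorem wedgeGram_mul_self : wedgeGram * wedgeGram = 1 := by
  simp [wedgeGram, fromBlocks_multiply]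

/-- Invariance of a nondegenerate bilinear form determines the determinant only up to sign; the sign
is settled in `det_wedgeSq`. -/
theorem det_wedgeSq_sq (S : Matrix (Fin 4) (Fin 4) ℂ) (hS : S.det = 1) :
    (wedgeSq S).det * (wedgeSq S).det = 1 := by
  have hG : wedgeGram.det * wedgeGram.det = 1 := by
    rw [← det_mul, wedgeGram_mul_self, det_one]
  have h := congrArg det (wedgeSq_gram S)
  rw [hS, one_smul, det_mul, det_mul, det_transpose] at h
  linear_combination (wedgeGram.det) * h + (1 - (wedgeSq S).det * (wedgeSq S).det) * hG

/-- Both sides are multiplicative, so diagonal matrices and transvections suffice. In the diagonal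
case each index lies in three of the six pairs. -/
theorem det_wedgeSq (S : Matrix (Fin 4) (Fin 4) ℂ) : (wedgeSq S).det = S.det ^ 3 := by
  refine diagonal_transvection_induction (fun M => (wedgeSq M).det = M.det ^ 3) S ?_ ?_ ?_
  · intro D _
    rw [wedgeSq_diagonal, det_diagonal, det_diagonal]
    simp [wedgePair, Fin.prod_univ_succ]
    ring
  · intro t
    -- A transvection is the square of the one with half its parameter, so a determinant known up to
    -- sign becomes 1.
    have h : t.toMatrix = transvection t.i t.j (t.c / 2) * transvection t.i t.j (t.c / 2) := by
      rw [transvection_mul_transvection_same _ _ t.hij, add_halves]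
      rfl
    rw [t.det, h, wedgeSq_mul, det_mul, det_wedgeSq_sq _ (det_transvection_of_ne _ _ t.hij _),
      one_pow]
  · intro A B hA hB
    rw [wedgeSq_mul, det_mul, det_mul, hA, hB, mul_pow]

/-! ### The exterior square as a space, and its basis. -/

/-- The exterior product of two vectors of `ℂ⁴`. -/
noncomputable def wedge (u v : Fin 4 → ℂ) : ⋀[ℂ]^2 (Fin 4 → ℂ) := exteriorPower.ιMulti ℂ 2 ![u, v]

theorem wedge_self (u : Fin 4 → ℂ) : wedge u u = 0 :=
  (exteriorPower.ιMulti ℂ 2).map_eq_zero_of_eq ![u, u] (i := 0) (j := 1) rfl (by decide)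

theorem wedge_add_left (u u' v : Fin 4 → ℂ) : wedge (u + u') v = wedge u v + wedge u' v :=
  (exteriorPower.ιMulti ℂ 2).map_vecCons_add ![v] u u'

theorem wedge_smul_left (c : ℂ) (u v : Fin 4 → ℂ) : wedge (c • u) v = c • wedge u v :=
  (exteriorPower.ιMulti ℂ 2).map_vecCons_smul ![v] c u

theorem wedge_swap (u v : Fin 4 → ℂ) : wedge v u = -wedge u v := by
  have h := (exteriorPower.ιMulti ℂ 2).map_swap ![u, v] (i := 0) (j := 1) (by decide)
  refine Eq.trans (congrArg _ (funext fun i => ?_)) h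
  fin_cases i <;> rfl

theorem wedge_add_right (u v v' : Fin 4 → ℂ) : wedge u (v + v') = wedge u v + wedge u v' := by
  rw [wedge_swap, wedge_add_left, neg_add, ← wedge_swap, ← wedge_swap]

theorem wedge_smul_right (c : ℂ) (u v : Fin 4 → ℂ) : wedge u (c • v) = c • wedge u v := by
  rw [wedge_swap (c • v) u, wedge_smul_left, wedge_swap u v, smul_neg, neg_neg]

theorem wedgeVec_eq (x : WedgeIdx) :
    wedgeVec x = wedge (Pi.single (wedgePair x).1 1) (Pi.single (wedgePair x).2 1) := by
  rcases x with x | x <;> fin_cases x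
  · rfl
  · rfl
  · rfl
  · exact (wedge_swap _ _).symm
  · exact (wedge_swap _ _).symm
  · exact (wedge_swap _ _).symm

theorem wedge_eq_sum (u v : Fin 4 → ℂ) :
    wedge u v = ∑ x, (u (wedgePair x).1 * v (wedgePair x).2 -
      u (wedgePair x).2 * v (wedgePair x).1) • wedgeVec x := by
  have h : ∀ w : Fin 4 → ℂ, w = w 0 • Pi.single 0 1 + w 1 • Pi.single 1 1 + w 2 • Pi.single 2 1 +
      w 3 • Pi.single 3 1 := by
    intro w
    ext i
    fin_cases i <;> simp
  simp only [wedgeVec_eq, Fintype.sum_sum_type, Fin.sum_univ_three, wedgePair, Sum.elim_inl,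
    Sum.elim_inr, cons_val_zero, cons_val_one, cons_val]
  -- The basis vectors become opaque symbols, so that only bilinearity and antisymmetry are used
  -- below.
  generalize hE : (fun i : Fin 4 => (Pi.single i 1 : Fin 4 → ℂ)) = E at *
  have hE' : ∀ i, (Pi.single i 1 : Fin 4 → ℂ) = E i := fun i => by rw [← hE]
  simp only [hE'] at h ⊢
  conv_lhs => rw [h u, h v]
  -- One orientation is fixed for each pair of indices, so that both sides are combinations of the
  -- same six wedges.
  simp only [wedge_add_left, wedge_add_right, wedge_smul_left, wedge_smul_right, wedge_self,
    wedge_swap (E 1) (E 0), wedge_swap (E 0) (E 2), wedge_swap (E 2) (E 1),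
    wedge_swap (E 3) (E 0), wedge_swap (E 3) (E 1), wedge_swap (E 3) (E 2)]
  module

theorem finrank_exteriorSquare : Module.finrank ℂ (⋀[ℂ]^2 (Fin 4 → ℂ)) = 6 := by
  rw [exteriorPower.finrank_eq, Module.finrank_fin_fun]
  rfl

/-- Six spanning vectors in a space of dimension six form a basis, so linear independence needs no
separate argument. -/
theorem top_le_span_wedgeVec : ⊤ ≤ Submodule.span ℂ (Set.range wedgeVec) := by
  rw [← exteriorPower.ιMulti_family_span_of_span ℂ (Pi.basisFun ℂ (Fin 4)).span_eq (n := 2),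
    Submodule.span_le]
  rintro _ ⟨s, rfl⟩
  have h : ∀ m : Fin 2 → Fin 4 → ℂ, exteriorPower.ιMulti ℂ 2 m = wedge (m 0) (m 1) := fun m =>
    congrArg _ (funext fun i => by fin_cases i <;> rfl)
  rw [exteriorPower.ιMulti_family, h, wedge_eq_sum]
  exact Submodule.sum_mem _ fun x _ =>
    Submodule.smul_mem _ _ (Submodule.subset_span ⟨x, rfl⟩)

/-- The vectors `wedgeVec` as a basis of the exterior square. -/
noncomputable def wedgeBasis : Module.Basis WedgeIdx ℂ (⋀[ℂ]^2 (Fin 4 → ℂ)) :=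
  basisOfTopLeSpanOfCardEqFinrank wedgeVec top_le_span_wedgeVec
    (by rw [finrank_exteriorSquare]; rfl)

theorem wedgeBasis_apply (x : WedgeIdx) : wedgeBasis x = wedgeVec x := by
  simp [wedgeBasis]

theorem toMatrix_exteriorSquare (S : Matrix (Fin 4) (Fin 4) ℂ) :
    LinearMap.toMatrix wedgeBasis wedgeBasis (exteriorPower.map 2 (Matrix.toLin' S)) =
      wedgeSq S := by
  ext x y
  have h : exteriorPower.map 2 (Matrix.toLin' S) (wedgeBasis y) =
      ∑ x, wedgeSq S x y • wedgeBasis x := by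
    have hw : exteriorPower.map 2 (Matrix.toLin' S) (wedgeBasis y) =
        wedge (S *ᵥ Pi.single (wedgePair y).1 1) (S *ᵥ Pi.single (wedgePair y).2 1) := by
      rw [wedgeBasis_apply, wedgeVec_eq, wedge, exteriorPower.map_apply_ιMulti]
      refine congrArg _ (funext fun i => ?_)
      fin_cases i <;> simp
    rw [hw, wedge_eq_sum]
    refine Finset.sum_congr rfl fun x _ => ?_
    rw [wedgeBasis_apply]
    simp only [mulVec_single_one, col_apply, wedgeSq, of_apply]
    congr 1
    ring
  rw [LinearMap.toMatrix_apply, h, map_sum, Finset.sum_apply']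
  simp [Finsupp.single_apply]

/-! ### The change of basis -/

/-- `√2` times the change of basis matrix. -/
noncomputable def scaledBasis : Matrix (Fin 3 × Fin 2) WedgeIdx ℂ :=
  Matrix.of fun p x => Sum.elim (fun l => if l = p.1.rev then ![Complex.I, 1] p.2 else 0)
    (fun l => if l = p.1.rev then ![Complex.I, -1] p.2 else 0) x

theorem changeOfBasis_eq : changeOfBasis = (1 / (Real.sqrt 2 : ℂ)) • scaledBasis := by
  rw [changeOfBasis, submatrix_smul]
  ext ⟨k, a⟩ x
  rcases x with x | x <;> fin_cases k <;> fin_cases a <;> fin_cases x <;>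
    rfl

theorem scaledBasis_conjTranspose_mul : scaledBasisᴴ * scaledBasis = (2 : ℂ) • 1 := by
  ext x y
  rcases x with x | x <;> rcases y with y | y <;> fin_cases x <;> fin_cases y <;>
    simp [scaledBasis, Matrix.mul_apply, Fintype.sum_prod_type, Fin.sum_univ_three] <;> norm_num

/-- Together with unitarity this says that the wedge form becomes ∑ zᵢ² in the new frame. -/
theorem scaledBasis_transpose_mul : scaledBasisᵀ * scaledBasis = (2 : ℂ) • wedgeGram := by
  ext x y
  rcases x with x | x <;> rcases y with y | y <;> fin_cases x <;> fin_cases y <;>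
    simp [scaledBasis, Matrix.mul_apply, Fintype.sum_prod_type, Fin.sum_univ_three,
      wedgeGram] <;> norm_num

/-- The matrix implementing the quaternionic structure of `ℂ⁶`. -/
def quatStr : Matrix (Fin 3 × Fin 2) (Fin 3 × Fin 2) ℂ :=
  Matrix.of fun p q => if p.1 = q.1 then !![0, Complex.I; -Complex.I, 0] p.2 q.2 else 0

/-- The antilinear map v ↦ HG v̄ on bivectors, with H and G the Hermitian and bilinear Gram
matrices, becomes v ↦ `quatStr` v̄. The transpose appears because conjugating an antilinear map by
the unitary U involves the conjugate of U⁻¹, which is Uᵀ. -/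
theorem scaledBasis_mul_transpose :
    scaledBasis * (wedgeHerm * wedgeGram) * scaledBasisᵀ = (2 : ℂ) • quatStr := by
  have h : ∀ p q, (scaledBasis * (wedgeHerm * wedgeGram) * scaledBasisᵀ) p q =
      ∑ l, (scaledBasis p (.inr l) * scaledBasis q (.inl l) -
        scaledBasis p (.inl l) * scaledBasis q (.inr l)) := by
    intro p q
    have hb : wedgeHerm * wedgeGram = fromBlocks 0 (-1) 1 0 := by
      simp [wedgeHerm, wedgeGram, fromBlocks_multiply]
    rw [hb, Matrix.mul_apply]
    simp [Matrix.mul_apply, Matrix.one_apply, Finset.sum_sub_distrib]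
    ring
  ext ⟨k, a⟩ ⟨l, b⟩
  rw [h]
  fin_cases k <;> fin_cases a <;> fin_cases l <;> fin_cases b <;>
    simp [scaledBasis, quatStr] <;> ring

theorem inv_sqrt_two_mul_self : (1 / (Real.sqrt 2 : ℂ)) * (1 / (Real.sqrt 2 : ℂ)) = 1 / 2 := by
  have h : (Real.sqrt 2 : ℂ) * Real.sqrt 2 = 2 := by
    rw [← Complex.ofReal_mul, Real.mul_self_sqrt (by norm_num)]; norm_num
  rw [div_mul_div_comm, h, one_mul]

theorem changeOfBasis_conjTranspose_mul : changeOfBasisᴴ * changeOfBasis = 1 := by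
  have hs : star (1 / (Real.sqrt 2 : ℂ)) = 1 / (Real.sqrt 2 : ℂ) := by simp
  rw [changeOfBasis_eq, conjTranspose_smul, hs, Matrix.smul_mul, Matrix.mul_smul, smul_smul, inv_sqrt_two_mul_self,
    scaledBasis_conjTranspose_mul, smul_smul]
  norm_num

theorem changeOfBasis_mul_conjTranspose : changeOfBasis * changeOfBasisᴴ = 1 :=
  (mul_eq_one_comm_of_card_eq _ _ _ (by simp)).mp changeOfBasis_conjTranspose_mul

theorem changeOfBasis_transpose_mul : changeOfBasisᵀ * changeOfBasis = wedgeGram := by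
  rw [changeOfBasis_eq, transpose_smul, Matrix.smul_mul, Matrix.mul_smul, smul_smul, inv_sqrt_two_mul_self,
    scaledBasis_transpose_mul, smul_smul]
  norm_num

theorem changeOfBasis_mul_transpose :
    changeOfBasis * (wedgeHerm * wedgeGram) * changeOfBasisᵀ = quatStr := by
  rw [changeOfBasis_eq, transpose_smul, Matrix.smul_mul, Matrix.smul_mul, Matrix.mul_smul, smul_smul,
    inv_sqrt_two_mul_self, scaledBasis_mul_transpose, smul_smul]
  norm_num

theorem quatStr_mul_self : quatStr * quatStr = 1 := by
  ext ⟨k, a⟩ ⟨l, b⟩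
  fin_cases a <;> fin_cases b <;>
    simp [quatStr, Matrix.mul_apply, Fintype.sum_prod_type, Matrix.one_apply]

/-! ### Quaternionic matrices among the complex ones -/

/-- Changing the sign of the j component exchanges the two off-diagonal entries of a 2 × 2 block.
Hence the defining equation of SO*(2n) is complex orthogonality of the image under φ. -/
theorem complexify_revTranspose {n : ℕ} (A : Matrix (Fin n) (Fin n) ℍ[ℝ]) :
    complexify (revTranspose A) = (complexify A)ᵀ := by
  ext ⟨i, a⟩ ⟨j, b⟩
  fin_cases a <;> fin_cases b <;>
    simp [complexify, revTranspose, quatToMat, reversion] <;> ring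

theorem complexify_add {n : ℕ} (A B : Matrix (Fin n) (Fin n) ℍ[ℝ]) :
    complexify (A + B) = complexify A + complexify B := by
  ext ⟨i, a⟩ ⟨j, b⟩
  simp [complexify, quatToMat_add]

theorem complexify_smul {n : ℕ} (c : ℝ) (A : Matrix (Fin n) (Fin n) ℍ[ℝ]) :
    complexify (c • A) = c • complexify A := by
  ext ⟨i, a⟩ ⟨j, b⟩
  fin_cases a <;> fin_cases b <;> simp [complexify, quatToMat] <;> ring

/-- The quaternion with the given coordinates. -/
def quatMk (a b c d : ℝ) : ℍ[ℝ] := ⟨a, b, c, d⟩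

@[simp] theorem quatMk_re (a b c d : ℝ) : (quatMk a b c d).re = a := rfl

@[simp] theorem quatMk_imI (a b c d : ℝ) : (quatMk a b c d).imI = b := rfl

@[simp] theorem quatMk_imJ (a b c d : ℝ) : (quatMk a b c d).imJ = c := rfl

@[simp] theorem quatMk_imK (a b c d : ℝ) : (quatMk a b c d).imK = d := rfl

/-- The quaternionic matrix underlying a complex matrix. -/
noncomputable def decomplexify {n : ℕ} (M : Matrix (Fin n × Fin 2) (Fin n × Fin 2) ℂ) :
    Matrix (Fin n) (Fin n) ℍ[ℝ] :=
  Matrix.of fun i j => quatMk (M (i, 0) (j, 0)).re (M (i, 1) (j, 0)).im (M (i, 1) (j, 0)).re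
    (M (i, 0) (j, 0)).im

theorem decomplexify_apply {n : ℕ} (M : Matrix (Fin n × Fin 2) (Fin n × Fin 2) ℂ) (i j : Fin n) :
    decomplexify M i j = quatMk (M (i, 0) (j, 0)).re (M (i, 1) (j, 0)).im (M (i, 1) (j, 0)).re
      (M (i, 0) (j, 0)).im := rfl

theorem decomplexify_complexify {n : ℕ} (A : Matrix (Fin n) (Fin n) ℍ[ℝ]) :
    decomplexify (complexify A) = A := by
  ext i j <;> simp [decomplexify_apply, complexify, quatToMat]

theorem complexify_injective {n : ℕ} :
    Function.Injective (complexify : Matrix (Fin n) (Fin n) ℍ[ℝ] → _) :=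
  Function.LeftInverse.injective decomplexify_complexify

/-- `complexify` as a homomorphism of real algebras. -/
noncomputable def complexifyHom (n : ℕ) :
    Matrix (Fin n) (Fin n) ℍ[ℝ] →+* Matrix (Fin n × Fin 2) (Fin n × Fin 2) ℂ where
  toFun := complexify
  map_one' := complexify_one
  map_mul' := complexify_mul
  map_zero' := by simpa using complexify_smul 0 (0 : Matrix (Fin n) (Fin n) ℍ[ℝ])
  map_add' := complexify_add

/-- Quaternionic matrices commute with the antilinear map v ↦ `quatStr` v̄; `Mᴴᵀ` is the entrywise
conjugate. The converse is `complexify_decomplexify`. -/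
theorem quatStr_mul_conj_complexify (A : Matrix (Fin 3) (Fin 3) ℍ[ℝ]) :
    complexify A * quatStr = quatStr * (complexify A)ᴴᵀ := by
  ext ⟨k, a⟩ ⟨l, b⟩
  fin_cases a <;> fin_cases b <;>
    simp [quatStr, Matrix.mul_apply, Fintype.sum_prod_type, complexify, quatToMat] <;> ring_nf

theorem complexify_decomplexify {M : Matrix (Fin 3 × Fin 2) (Fin 3 × Fin 2) ℂ}
    (hM : M * quatStr = quatStr * Mᴴᵀ) : complexify (decomplexify M) = M := by
  -- In each block the second column is determined by the first, from which `decomplexify` reads the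
  -- quaternion.
  have h1 : ∀ k l, M (k, 0) (l, 1) = -star (M (k, 1) (l, 0)) := by
    intro k l
    have h := congrFun (congrFun hM (k, 0)) (l, 0)
    simp [quatStr, Matrix.mul_apply, Fintype.sum_prod_type] at h
    apply mul_right_cancel₀ Complex.I_ne_zero
    simp only [Complex.star_def]
    linear_combination -h
  have h2 : ∀ k l, M (k, 1) (l, 1) = star (M (k, 0) (l, 0)) := by
    intro k l
    have h := congrFun (congrFun hM (k, 1)) (l, 0)
    simp [quatStr, Matrix.mul_apply, Fintype.sum_prod_type] at h
    apply mul_right_cancel₀ Complex.I_ne_zero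
    simp only [Complex.star_def]
    linear_combination h
  ext ⟨k, a⟩ ⟨l, b⟩
  fin_cases a <;> fin_cases b
  · simp [complexify, decomplexify_apply, quatToMat, Complex.re_add_im]
  · simp [complexify, decomplexify_apply, quatToMat, h1, Complex.ext_iff]
  · simp [complexify, decomplexify_apply, quatToMat, Complex.ext_iff]
  · simp [complexify, decomplexify_apply, quatToMat, h2, Complex.ext_iff]

/-! ### The exterior square in the frame of `ℂ³ ⊗ ℂ²` -/

/-- The action of a `4 × 4` matrix on bivectors, in the coordinates given by `changeOfBasis`. -/
noncomputable def wedgeRot (S : Matrix (Fin 4) (Fin 4) ℂ) :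
    Matrix (Fin 3 × Fin 2) (Fin 3 × Fin 2) ℂ :=
  changeOfBasis * wedgeSq S * changeOfBasisᴴ

theorem conj_changeOfBasis_mul (A B : Matrix WedgeIdx WedgeIdx ℂ) :
    changeOfBasis * A * changeOfBasisᴴ * (changeOfBasis * B * changeOfBasisᴴ) =
      changeOfBasis * (A * B) * changeOfBasisᴴ := by
  calc _ = changeOfBasis * A * (changeOfBasisᴴ * changeOfBasis) * B * changeOfBasisᴴ := by
        simp only [Matrix.mul_assoc]
    _ = _ := by rw [changeOfBasis_conjTranspose_mul, Matrix.mul_one]; simp only [Matrix.mul_assoc]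

theorem conjTranspose_changeOfBasis_conj (A : Matrix WedgeIdx WedgeIdx ℂ) :
    changeOfBasisᴴ * (changeOfBasis * A * changeOfBasisᴴ) * changeOfBasis = A := by
  calc _ = (changeOfBasisᴴ * changeOfBasis) * A * (changeOfBasisᴴ * changeOfBasis) := by
        simp only [Matrix.mul_assoc]
    _ = _ := by rw [changeOfBasis_conjTranspose_mul, Matrix.mul_one, Matrix.one_mul]

theorem wedgeRot_mul (S T : Matrix (Fin 4) (Fin 4) ℂ) :
    wedgeRot (S * T) = wedgeRot S * wedgeRot T := by
  rw [wedgeRot, wedgeRot, wedgeRot, conj_changeOfBasis_mul, wedgeSq_mul]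

theorem wedgeRot_one : wedgeRot 1 = 1 := by
  rw [wedgeRot, wedgeSq_one, Matrix.mul_one, changeOfBasis_mul_conjTranspose]

theorem wedgeRot_smul (c : ℂ) (S : Matrix (Fin 4) (Fin 4) ℂ) :
    wedgeRot (c • S) = c ^ 2 • wedgeRot S := by
  rw [wedgeRot, wedgeRot, wedgeSq_smul, Matrix.mul_smul, Matrix.smul_mul]

theorem wedgeRot_neg (S : Matrix (Fin 4) (Fin 4) ℂ) : wedgeRot (-S) = wedgeRot S := by
  rw [← neg_one_smul ℂ S, wedgeRot_smul]
  norm_num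

theorem wedgeRot_transpose_mul (S : Matrix (Fin 4) (Fin 4) ℂ) (hS : S.det = 1) :
    (wedgeRot S)ᵀ * wedgeRot S = 1 := by
  have h : changeOfBasisᴴᵀ * changeOfBasisᵀ = 1 := by
    rw [← transpose_mul, changeOfBasis_mul_conjTranspose, transpose_one]
  calc (wedgeRot S)ᵀ * wedgeRot S
      = changeOfBasisᴴᵀ * ((wedgeSq S)ᵀ * (changeOfBasisᵀ * changeOfBasis) * wedgeSq S) *
          changeOfBasisᴴ := by
        simp only [wedgeRot, transpose_mul, Matrix.mul_assoc]
    _ = (changeOfBasisᴴᵀ * changeOfBasisᵀ) * (changeOfBasis * changeOfBasisᴴ) := by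
        rw [changeOfBasis_transpose_mul, wedgeSq_gram, hS, one_smul,
          ← changeOfBasis_transpose_mul]
        simp only [Matrix.mul_assoc]
    _ = 1 := by rw [h, changeOfBasis_mul_conjTranspose, Matrix.one_mul]

theorem det_wedgeRot (S : Matrix (Fin 4) (Fin 4) ℂ) : (wedgeRot S).det = S.det ^ 3 := by
  rw [wedgeRot, det_conj_of_mul_eq_one changeOfBasis_mul_conjTranspose
    changeOfBasis_conjTranspose_mul, det_wedgeSq]

theorem wedgeHerm_mul_self : wedgeHerm * wedgeHerm = 1 := by
  simp [wedgeHerm, fromBlocks_multiply]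

/-- With Y the inverse of (Λ²S)†, Hermitian invariance gives H Λ²T = Y H, and the conjugated
bilinear invariance expresses the conjugate of Λ²S through the same Y; eliminating Y gives the
claim. The second matrix T is kept separate because the proof of surjectivity applies this before S
is known to be pseudounitary. -/
theorem wedgeSq_mul_conj {S T : Matrix (Fin 4) (Fin 4) ℂ} (hS : S.det = 1)
    (h : Sᴴ * I31 * T = I31) :
    wedgeSq T * (wedgeHerm * wedgeGram) = wedgeHerm * wedgeGram * (wedgeSq S)ᴴᵀ := by
  have h1 : (wedgeSq S)ᴴ * wedgeHerm * wedgeSq T = wedgeHerm := by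
    rw [← wedgeSq_conjTranspose, ← wedgeSq_I31, ← wedgeSq_mul, ← wedgeSq_mul, h]
  have h2 : (wedgeSq S)ᴴ * wedgeGram * (wedgeSq S)ᴴᵀ = wedgeGram := by
    have hG : wedgeGramᴴᵀ = wedgeGram := by
      simp [wedgeGram, fromBlocks_conjTranspose, fromBlocks_transpose]
    have h := congrArg (fun M => Mᴴᵀ) (wedgeSq_gram S)
    simp only [conjTranspose_mul, transpose_mul, hS, one_smul, hG, ← Matrix.mul_assoc] at h
    exact h
  have hdet : IsUnit (wedgeSq S)ᴴ := by
    rw [isUnit_iff_isUnit_det, det_conjTranspose, det_wedgeSq, hS]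
    simp
  obtain ⟨Y, hY⟩ := hdet.exists_left_inv
  have e1 : wedgeHerm * wedgeSq T = Y * wedgeHerm := by
    conv_rhs => rw [← h1]
    rw [← Matrix.mul_assoc, ← Matrix.mul_assoc, hY, Matrix.one_mul]
  have e2 : wedgeGram * (wedgeSq S)ᴴᵀ = Y * wedgeGram := by
    conv_rhs => rw [← h2]
    rw [← Matrix.mul_assoc, ← Matrix.mul_assoc, hY, Matrix.one_mul]
  calc wedgeSq T * (wedgeHerm * wedgeGram)
      = wedgeHerm * (wedgeHerm * wedgeSq T) * wedgeHerm * wedgeGram := by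
        rw [← Matrix.mul_assoc wedgeHerm, wedgeHerm_mul_self, Matrix.one_mul, Matrix.mul_assoc]
    _ = wedgeHerm * Y * (wedgeHerm * wedgeHerm) * wedgeGram := by
        rw [e1]; simp only [Matrix.mul_assoc]
    _ = wedgeHerm * wedgeGram * (wedgeSq S)ᴴᵀ := by
        rw [wedgeHerm_mul_self, Matrix.mul_one, Matrix.mul_assoc, ← e2, Matrix.mul_assoc]

/-- For S = T this says that the rotation attached to an element of SU(3,1) is quaternionic. -/
theorem wedgeRot_mul_quatStr {S T : Matrix (Fin 4) (Fin 4) ℂ} (hS : S.det = 1)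
    (h : Sᴴ * I31 * T = I31) : wedgeRot T * quatStr = quatStr * (wedgeRot S)ᴴᵀ := by
  have hU : changeOfBasisᵀ * changeOfBasisᴴᵀ = 1 := by
    rw [← transpose_mul, changeOfBasis_conjTranspose_mul, transpose_one]
  rw [← changeOfBasis_mul_transpose]
  calc wedgeRot T * (changeOfBasis * (wedgeHerm * wedgeGram) * changeOfBasisᵀ)
      = changeOfBasis * wedgeSq T * (changeOfBasisᴴ * changeOfBasis) *
          (wedgeHerm * wedgeGram) * changeOfBasisᵀ := by
        simp only [wedgeRot, Matrix.mul_assoc]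
    _ = changeOfBasis * (wedgeHerm * wedgeGram * (wedgeSq S)ᴴᵀ) * changeOfBasisᵀ := by
        rw [changeOfBasis_conjTranspose_mul, Matrix.mul_one, Matrix.mul_assoc changeOfBasis,
          wedgeSq_mul_conj hS h]
    _ = changeOfBasis * (wedgeHerm * wedgeGram) * (changeOfBasisᵀ * changeOfBasisᴴᵀ) *
          (wedgeSq S)ᴴᵀ * changeOfBasisᵀ := by
        rw [hU, Matrix.mul_one]; simp only [Matrix.mul_assoc]
    _ = _ := by
        simp only [wedgeRot, conjTranspose_mul, transpose_mul, conjTranspose_conjTranspose,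
          Matrix.mul_assoc]

/-! ### The spinor representation -/

theorem stdQuad_apply {n : ℕ} (v : Fin n × Fin 2 → ℂ) : stdQuad n v = v ⬝ᵥ v := by
  simp [stdQuad, QuadraticMap.weightedSumSquares_apply, dotProduct]

theorem stdQuad_polar {n : ℕ} (u v : Fin n × Fin 2 → ℂ) :
    QuadraticMap.polar (stdQuad n) u v = 2 * (u ⬝ᵥ v) := by
  simp only [QuadraticMap.polar, stdQuad_apply, add_dotProduct, dotProduct_add,
    dotProduct_comm v u]
  ring

theorem wedgeGram_frame (v : Fin 3 × Fin 2 → ℂ) :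
    (changeOfBasisᴴ *ᵥ v) ⬝ᵥ wedgeGram *ᵥ (changeOfBasisᴴ *ᵥ v) = stdQuad 3 v := by
  rw [stdQuad_apply, ← changeOfBasis_transpose_mul, ← mulVec_mulVec, dotProduct_mulVec,
    vecMul_transpose, mulVec_mulVec, changeOfBasis_mul_conjTranspose, one_mulVec]

/-- Clifford multiplication by a bivector on the sum of the two half spin representations. -/
noncomputable def gammaMatrix : (WedgeIdx → ℂ) →ₗ[ℂ] Matrix (Fin 4 ⊕ Fin 4) (Fin 4 ⊕ Fin 4) ℂ where
  toFun w := fromBlocks 0 (bivec w) (bivecDual w) 0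
  map_add' v w := by simp [fromBlocks_add]
  map_smul' c w := by simp [fromBlocks_smul]

theorem gammaMatrix_apply (w : WedgeIdx → ℂ) :
    gammaMatrix w = fromBlocks 0 (bivec w) (bivecDual w) 0 := rfl

theorem gammaMatrix_mul_self (w : WedgeIdx → ℂ) :
    gammaMatrix w * gammaMatrix w = (w ⬝ᵥ wedgeGram *ᵥ w) • 1 := by
  simp [gammaMatrix_apply, fromBlocks_multiply, bivec_mul_bivecDual, bivecDual_mul_bivec,
    ← fromBlocks_one, fromBlocks_smul]

/-- The spinor representation of the complex Clifford algebra. -/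
noncomputable def spinor :
    CliffordAlgebra (stdQuad 3) →ₐ[ℂ] Matrix (Fin 4 ⊕ Fin 4) (Fin 4 ⊕ Fin 4) ℂ :=
  CliffordAlgebra.lift (stdQuad 3) ⟨gammaMatrix ∘ₗ (changeOfBasisᴴ).mulVecLin, fun v => by
    rw [LinearMap.comp_apply, mulVecLin_apply, gammaMatrix_mul_self, wedgeGram_frame,
      Algebra.algebraMap_eq_smul_one]⟩

theorem spinor_ι (v : Fin 3 × Fin 2 → ℂ) :
    spinor (CliffordAlgebra.ι (stdQuad 3) v) = gammaMatrix (changeOfBasisᴴ *ᵥ v) := by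
  rw [spinor, CliffordAlgebra.lift_ι_apply]
  rfl

theorem gammaMatrix_mem_range (w : WedgeIdx → ℂ) : gammaMatrix w ∈ spinor.range :=
  ⟨CliffordAlgebra.ι (stdQuad 3) (changeOfBasis *ᵥ w), by
    change spinor _ = _
    rw [spinor_ι, mulVec_mulVec, changeOfBasis_conjTranspose_mul, one_mulVec]⟩

theorem exists_bivec_eq (A : Matrix (Fin 4) (Fin 4) ℂ) (hA : Aᵀ = -A) : ∃ w, bivec w = A :=
  ⟨_, bivec_eq_of_antisymm (fun i j => A i j) fun i j => congrFun (congrFun hA j) i⟩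

theorem exists_bivecDual_eq (A : Matrix (Fin 4) (Fin 4) ℂ) (hA : Aᵀ = -A) :
    ∃ w, bivecDual w = A := by
  obtain ⟨w, hw⟩ := exists_bivec_eq ((1 / 2 : ℂ) • A) (by rw [transpose_smul, hA, smul_neg])
  refine ⟨w ∘ Sum.swap, ?_⟩
  have h : bivecDual (w ∘ Sum.swap) = (2 : ℂ) • bivec w := rfl
  rw [h, hw, smul_smul]
  norm_num

theorem mul_single_of_col {n : Type*} [Fintype n] [DecidableEq n] {M : Matrix n n ℂ} {a k : n}
    (h : ∀ i, M i a = if i = k then 1 else 0) (b : n) (c : ℂ) :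
    M * single a b c = single k b c := by
  ext i j
  by_cases hj : b = j
  · subst hj
    rw [mul_single_apply_same, h, single_apply]
    by_cases hi : i = k
    · simp [hi]
    · simp [hi, Ne.symm hi]
  · simp [mul_single_apply_of_ne _ _ _ _ _ (Ne.symm hj), hj]

theorem single_mul_of_row {n : Type*} [Fintype n] [DecidableEq n] {M : Matrix n n ℂ} {b k : n}
    (h : ∀ i, M b i = if i = k then 1 else 0) (a : n) (c : ℂ) :
    single a b c * M = single a k c := by
  have h' := congrArg transpose (mul_single_of_col (M := Mᵀ) (a := b) (k := k) h a c)
  simpa using h'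

/-- The elementary antisymmetric matrix. -/
def skewSingle (k j : Fin 4) : Matrix (Fin 4) (Fin 4) ℂ := single k j 1 - single j k 1

theorem skewSingle_transpose (k j : Fin 4) : (skewSingle k j)ᵀ = -skewSingle k j := by
  simp [skewSingle]

theorem skewSingle_col {k j : Fin 4} (h : k ≠ j) (i : Fin 4) :
    skewSingle k j i j = if i = k then 1 else 0 := by
  simp [skewSingle, single_apply, h, eq_comm]

/-- The skew matrix of k and j sends the j-th basis vector to the k-th, so multiplying by its gamma
matrix moves a row or column index from j to k and switches the half spin space. -/
theorem spinor_range_step {z : Fin 4 ⊕ Fin 4} {c : ℂ} {j k : Fin 4} (hkj : k ≠ j) :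
    (single (.inr j) z c ∈ spinor.range → single (.inl k) z c ∈ spinor.range) ∧
    (single (.inl j) z c ∈ spinor.range → single (.inr k) z c ∈ spinor.range) ∧
    (single z (.inr j) c ∈ spinor.range → single z (.inl k) c ∈ spinor.range) ∧
    (single z (.inl j) c ∈ spinor.range → single z (.inr k) c ∈ spinor.range) := by
  obtain ⟨w, hw⟩ := exists_bivec_eq _ (skewSingle_transpose k j)
  obtain ⟨w', hw'⟩ := exists_bivecDual_eq _ (skewSingle_transpose k j)
  have hrow : ∀ i, skewSingle k j j i = -(if i = k then 1 else 0) := fun i => by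
    rw [← skewSingle_col hkj i]
    exact congrFun (congrFun (skewSingle_transpose k j) i) j
  refine ⟨fun h => ?_, fun h => ?_, fun h => ?_, fun h => ?_⟩
  · rw [← mul_single_of_col (M := gammaMatrix w) (a := .inr j)]
    · exact mul_mem (gammaMatrix_mem_range w) h
    · rintro (i | i) <;> simp [gammaMatrix_apply, hw, skewSingle_col hkj]
  · rw [← mul_single_of_col (M := gammaMatrix w') (a := .inl j)]
    · exact mul_mem (gammaMatrix_mem_range w') h
    · rintro (i | i) <;> simp [gammaMatrix_apply, hw', skewSingle_col hkj]
  -- Row j of the skew matrix is minus the k-th unit row; the sign is absorbed in the vector.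
  · rw [← single_mul_of_row (M := gammaMatrix (-w')) (b := .inr j)]
    · exact mul_mem h (gammaMatrix_mem_range (-w'))
    · rintro (i | i) <;> simp [gammaMatrix_apply, hw', hrow]
  · rw [← single_mul_of_row (M := gammaMatrix (-w)) (b := .inl j)]
    · exact mul_mem h (gammaMatrix_mem_range (-w))
    · rintro (i | i) <;> simp [gammaMatrix_apply, hw, hrow]

/-- The first three basis vectors span a maximal isotropic subspace, and the product of their gamma
matrices has rank one; this provides a first matrix unit, up to the factor 4. -/
theorem single_mem_spinor_range : single (.inr 3) (.inl 3) 4 ∈ spinor.range := by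
  have h : gammaMatrix (Pi.single (.inl 0) 1) * gammaMatrix (Pi.single (.inl 1) 1) *
      gammaMatrix (Pi.single (.inl 2) 1) = single (.inr 3) (.inl 3) 4 := by
    have b0 : bivec (Pi.single (.inl 0) 1) = skewSingle 1 2 := by
      ext i j; fin_cases i <;> fin_cases j <;> simp [bivec, skewSingle]
    have b1 : bivec (Pi.single (.inl 1) 1) = skewSingle 2 0 := by
      ext i j; fin_cases i <;> fin_cases j <;> simp [bivec, skewSingle]
    have b2 : bivec (Pi.single (.inl 2) 1) = skewSingle 0 1 := by
      ext i j; fin_cases i <;> fin_cases j <;> simp [bivec, skewSingle]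
    have d0 : bivecDual (Pi.single (.inl 0) 1) = (2 : ℂ) • skewSingle 3 0 := by
      ext i j; fin_cases i <;> fin_cases j <;> simp [bivecDual, skewSingle]
    have d1 : bivecDual (Pi.single (.inl 1) 1) = (2 : ℂ) • skewSingle 3 1 := by
      ext i j; fin_cases i <;> fin_cases j <;> simp [bivecDual, skewSingle]
    have d2 : bivecDual (Pi.single (.inl 2) 1) = (2 : ℂ) • skewSingle 3 2 := by
      ext i j; fin_cases i <;> fin_cases j <;> simp [bivecDual, skewSingle]
    have hs : (single (.inr 3) (.inl 3) 4 : Matrix (Fin 4 ⊕ Fin 4) (Fin 4 ⊕ Fin 4) ℂ) =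
        fromBlocks 0 0 (single 3 3 4) 0 := by
      ext (i | i) (j | j) <;> simp [single_apply]
    have e1 : skewSingle 1 2 * ((2 : ℂ) • skewSingle 3 1) * skewSingle 0 1 = 0 := by
      simp [skewSingle, Matrix.sub_mul, Matrix.mul_sub]
    have e2 : ((2 : ℂ) • skewSingle 3 0) * skewSingle 2 0 * ((2 : ℂ) • skewSingle 3 2) =
        single 3 3 4 := by
      simp [skewSingle, Matrix.sub_mul, Matrix.mul_sub, smul_sub]
      norm_num
    rw [gammaMatrix_apply, gammaMatrix_apply, gammaMatrix_apply, b0, b1, b2, d0, d1, d2, hs]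
    simp only [fromBlocks_multiply, Matrix.zero_mul, Matrix.mul_zero, add_zero, zero_add, e1, e2]
  rw [← h]
  exact mul_mem (mul_mem (gammaMatrix_mem_range _) (gammaMatrix_mem_range _))
    (gammaMatrix_mem_range _)

theorem spinor_surjective : Function.Surjective spinor := by
  have hc : ∀ x y, single x y (4 : ℂ) ∈ spinor.range := by
    -- Two moves through an intermediate index different from both ends return to the same half spin
    -- space, including the case i = j.
    have exists_ne₂ : ∀ i j : Fin 4, ∃ k, k ≠ i ∧ j ≠ k := by decide
    have hl : ∀ z (i j : Fin 4), single (.inl i) z (4 : ℂ) ∈ spinor.range →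
        single (.inl j) z (4 : ℂ) ∈ spinor.range := fun z i j h => by
      obtain ⟨k, hki, hjk⟩ := exists_ne₂ i j
      exact (spinor_range_step hjk).1 ((spinor_range_step hki).2.1 h)
    have hr : ∀ z (i j : Fin 4), single z (.inl i) (4 : ℂ) ∈ spinor.range →
        single z (.inl j) (4 : ℂ) ∈ spinor.range := fun z i j h => by
      obtain ⟨k, hki, hjk⟩ := exists_ne₂ i j
      exact (spinor_range_step hjk).2.2.1 ((spinor_range_step hki).2.2.2 h)
    have h0 : single (.inl 0) (.inl 3) (4 : ℂ) ∈ spinor.range :=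
      (spinor_range_step (by decide)).1 single_mem_spinor_range
    have h1 : ∀ i j : Fin 4, single (.inl i) (.inl j) (4 : ℂ) ∈ spinor.range := fun i j =>
      hr _ _ _ (hl _ _ _ h0)
    rintro (i | i) (j | j)
    · exact h1 i j
    · obtain ⟨k, -, hk⟩ := exists_ne₂ j j
      exact (spinor_range_step hk).2.2.2 (h1 i k)
    · obtain ⟨k, -, hk⟩ := exists_ne₂ i i
      exact (spinor_range_step hk).2.1 (h1 k j)
    · obtain ⟨k, -, hk⟩ := exists_ne₂ i i
      obtain ⟨l, -, hl⟩ := exists_ne₂ j j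
      exact (spinor_range_step hk).2.1 ((spinor_range_step hl).2.2.2 (h1 k l))
  intro M
  change M ∈ spinor.range
  rw [matrix_eq_sum_single M]
  refine sum_mem fun i _ => sum_mem fun j _ => ?_
  have h : single i j (M i j) = (M i j / 4) • single i j (4 : ℂ) := by
    rw [smul_single, smul_eq_mul, div_mul_cancel₀ _ (by norm_num)]
  rw [h]
  exact Subalgebra.smul_mem _ (hc i j) _

/-- As a vector space the Clifford algebra is the exterior algebra on six generators, of dimension
2⁶. This equals 8², the dimension of the matrix algebra, so the surjective spinor representation is
injective. -/
theorem finrank_clifford : Module.Finite ℂ (CliffordAlgebra (stdQuad 3)) ∧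
    Module.finrank ℂ (CliffordAlgebra (stdQuad 3)) = 64 := by
  let b : Module.Basis (Fin 6) ℂ (Fin 3 × Fin 2 → ℂ) :=
    (Pi.basisFun ℂ (Fin 3 × Fin 2)).reindex finProdFinEquiv
  have : Invertible (2 : ℂ) := invertibleOfNonzero two_ne_zero
  let B := b.ExteriorAlgebra.map (CliffordAlgebra.equivExterior (stdQuad 3)).symm
  refine ⟨Module.Finite.of_basis B, ?_⟩
  rw [Module.finrank_eq_card_basis B, Fintype.card_finset, Fintype.card_fin]
  norm_num

theorem spinor_injective : Function.Injective spinor := by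
  have := finrank_clifford.1
  refine (LinearMap.injective_iff_surjective_of_finrank_eq_finrank
    (f := spinor.toLinearMap) ?_).mpr spinor_surjective
  rw [finrank_clifford.2, Module.finrank_matrix]
  simp

/-- The spinor representation as an isomorphism onto the full matrix algebra. -/
noncomputable def spinorEquiv :
    CliffordAlgebra (stdQuad 3) ≃ₐ[ℂ] Matrix (Fin 4 ⊕ Fin 4) (Fin 4 ⊕ Fin 4) ℂ :=
  AlgEquiv.ofBijective spinor ⟨spinor_injective, spinor_surjective⟩

theorem spinor_spinorEquiv_symm (M : Matrix (Fin 4 ⊕ Fin 4) (Fin 4 ⊕ Fin 4) ℂ) :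
    spinor (spinorEquiv.symm M) = M :=
  spinorEquiv.apply_symm_apply M

/-- Vectors generate the Clifford algebra, so such an element is central, and the center of a full
matrix algebra consists of the scalars. -/
theorem eq_algebraMap_of_commute_ι {z : CliffordAlgebra (stdQuad 3)}
    (hz : ∀ v, z * CliffordAlgebra.ι (stdQuad 3) v = CliffordAlgebra.ι (stdQuad 3) v * z) :
    ∃ c : ℂ, z = algebraMap ℂ _ c := by
  have h1 : ∀ a, z * a = a * z := by
    intro a
    have h : Algebra.adjoin ℂ (Set.range (CliffordAlgebra.ι (stdQuad 3))) ≤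
        Subalgebra.centralizer ℂ {z} := by
      rw [Algebra.adjoin_le_iff]
      rintro _ ⟨v, rfl⟩
      rw [SetLike.mem_coe, Subalgebra.mem_centralizer_iff]
      simpa using hz v
    rw [CliffordAlgebra.adjoin_range_ι] at h
    simpa [Subalgebra.mem_centralizer_iff] using h (x := a) trivial
  have h2 : ∀ M, Commute M (spinor z) := by
    intro M
    obtain ⟨a, rfl⟩ := spinor_surjective M
    rw [Commute, SemiconjBy, ← map_mul, ← map_mul, h1]
  obtain ⟨c, hc⟩ := mem_range_scalar_of_commute_single fun {i j} _ => h2 (single i j 1)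
  refine ⟨c, spinor_injective ?_⟩
  rw [← hc, AlgHom.commutes]
  rfl

/-! ### The special linear group acting on spinors -/

/-- Even size gives the special linear group its negation. -/
instance : Fact (Even (Fintype.card (Fin 4))) := ⟨by decide⟩

/-- The action of `SL(4, ℂ)` on the sum of the two half spin representations. -/
def spinBlock : SpecialLinearGroup (Fin 4) ℂ →* Matrix (Fin 4 ⊕ Fin 4) (Fin 4 ⊕ Fin 4) ℂ where
  toFun S := fromBlocks S.1 0 0 (S⁻¹).1ᵀ
  map_one' := by simp [fromBlocks_one]
  map_mul' S T := by
    rw [_root_.mul_inv_rev]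
    simp [fromBlocks_multiply, transpose_mul]

theorem spinBlock_apply (S : SpecialLinearGroup (Fin 4) ℂ) :
    spinBlock S = fromBlocks S.1 0 0 (S⁻¹).1ᵀ := rfl

theorem coe_mul_coe_inv (S : SpecialLinearGroup (Fin 4) ℂ) : S.1 * (S⁻¹).1 = 1 :=
  congrArg Subtype.val (mul_inv_cancel S)

theorem coe_inv_mul_coe (S : SpecialLinearGroup (Fin 4) ℂ) : (S⁻¹).1 * S.1 = 1 :=
  congrArg Subtype.val (inv_mul_cancel S)

theorem gram_mulVec_wedgeSq (S : SpecialLinearGroup (Fin 4) ℂ) (w : WedgeIdx → ℂ) :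
    (wedgeSq S.1 *ᵥ w) ⬝ᵥ wedgeGram *ᵥ (wedgeSq S.1 *ᵥ w) = w ⬝ᵥ wedgeGram *ᵥ w := by
  have h := wedgeSq_gram S.1
  rw [S.2, one_smul] at h
  conv_rhs => rw [← h]
  rw [← mulVec_mulVec, ← mulVec_mulVec, dotProduct_mulVec w, vecMul_transpose]

/-- For a nonisotropic w the dual matrix is a multiple of the inverse of `bivec w`, so it transforms
by the inverse congruence with the same scalar. Isotropic vectors follow by linearity. -/
theorem bivecDual_mulVec_wedgeSq (S : SpecialLinearGroup (Fin 4) ℂ) (w : WedgeIdx → ℂ) :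
    bivecDual (wedgeSq S.1 *ᵥ w) = (S⁻¹).1ᵀ * bivecDual w * (S⁻¹).1 := by
  have hT : S.1ᵀ * (S⁻¹).1ᵀ = 1 := by rw [← transpose_mul, coe_inv_mul_coe, transpose_one]
  have key : ∀ w, w ⬝ᵥ wedgeGram *ᵥ w ≠ 0 →
      bivecDual (wedgeSq S.1 *ᵥ w) = (S⁻¹).1ᵀ * bivecDual w * (S⁻¹).1 := by
    intro w hw
    have h1 := bivecDual_mul_bivec (wedgeSq S.1 *ᵥ w)
    rw [gram_mulVec_wedgeSq, bivec_mulVec_wedgeSq] at h1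
    have h2 : S.1 * bivec w * S.1ᵀ * ((S⁻¹).1ᵀ * bivecDual w * (S⁻¹).1) =
        (w ⬝ᵥ wedgeGram *ᵥ w) • 1 := by
      calc _ = S.1 * (bivec w * (S.1ᵀ * (S⁻¹).1ᵀ) * bivecDual w) * (S⁻¹).1 := by
            simp only [Matrix.mul_assoc]
        _ = _ := by
            rw [hT, Matrix.mul_one, bivec_mul_bivecDual, Matrix.mul_smul, Matrix.smul_mul,
              Matrix.mul_one, coe_mul_coe_inv]
    have h3 := congrArg (bivecDual (wedgeSq S.1 *ᵥ w) * ·) h2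
    simp only [← Matrix.mul_assoc] at h1 h3
    rw [h1] at h3
    simp only [Matrix.smul_mul, Matrix.mul_smul, Matrix.one_mul, Matrix.mul_one] at h3
    exact (smul_right_injective _ hw h3).symm
  by_cases hw : w ⬝ᵥ wedgeGram *ᵥ w = 0
  -- The form takes the value -6 at u. Since q(w + u) + q(w - u) = 2 q(u) ≠ 0, at least one of w ± u
  -- is nonisotropic, and w is recovered from it and u.
  · let u : WedgeIdx → ℂ := fun _ => 1
    have hu : u ⬝ᵥ wedgeGram *ᵥ u ≠ 0 := by
      rw [dotProduct_wedgeGram_mulVec]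
      simp [u]
    have hsum : (w + u) ⬝ᵥ wedgeGram *ᵥ (w + u) + (w - u) ⬝ᵥ wedgeGram *ᵥ (w - u) =
        2 * (u ⬝ᵥ wedgeGram *ᵥ u) := by
      simp only [mulVec_add, mulVec_sub, add_dotProduct, sub_dotProduct, dotProduct_add,
        dotProduct_sub, hw]
      ring
    by_cases hp : (w + u) ⬝ᵥ wedgeGram *ᵥ (w + u) = 0
    · have h := key (w - u) fun h0 => hu (by
        rw [hp, h0] at hsum
        linear_combination (-1 / 2 : ℂ) * hsum)
      have h' := key u hu
      rw [mulVec_sub, map_sub, map_sub, h', Matrix.mul_sub, Matrix.sub_mul] at h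
      exact sub_left_injective h
    · have h := key (w + u) hp
      have h' := key u hu
      rw [mulVec_add, map_add, map_add, h', Matrix.mul_add, Matrix.add_mul] at h
      exact add_right_cancel h
  · exact key w hw

theorem frame_mulVec_wedgeRot (S : Matrix (Fin 4) (Fin 4) ℂ) (v : Fin 3 × Fin 2 → ℂ) :
    changeOfBasisᴴ *ᵥ (wedgeRot S *ᵥ v) = wedgeSq S *ᵥ (changeOfBasisᴴ *ᵥ v) := by
  rw [mulVec_mulVec, mulVec_mulVec, wedgeRot, ← Matrix.mul_assoc, ← Matrix.mul_assoc,
    changeOfBasis_conjTranspose_mul, Matrix.one_mul]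

theorem spinBlock_mul_spinor_ι (S : SpecialLinearGroup (Fin 4) ℂ) (v : Fin 3 × Fin 2 → ℂ) :
    spinBlock S * spinor (CliffordAlgebra.ι (stdQuad 3) v) =
      spinor (CliffordAlgebra.ι (stdQuad 3) (wedgeRot S.1 *ᵥ v)) * spinBlock S := by
  have hT : S.1ᵀ * (S⁻¹).1ᵀ = 1 := by rw [← transpose_mul, coe_inv_mul_coe, transpose_one]
  rw [spinor_ι, spinor_ι, frame_mulVec_wedgeRot, gammaMatrix_apply, gammaMatrix_apply,
    spinBlock_apply, bivec_mulVec_wedgeSq, bivecDual_mulVec_wedgeSq, fromBlocks_multiply,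
    fromBlocks_multiply]
  simp only [Matrix.zero_mul, Matrix.mul_zero, add_zero, zero_add]
  rw [Matrix.mul_assoc _ S.1ᵀ, hT, Matrix.mul_one, Matrix.mul_assoc _ (S⁻¹).1, coe_inv_mul_coe,
    Matrix.mul_one]

theorem spinBlock_mul_inv (S : SpecialLinearGroup (Fin 4) ℂ) :
    spinBlock S * spinBlock S⁻¹ = 1 := by
  rw [← map_mul, mul_inv_cancel, map_one]

theorem spinBlock_injective : Function.Injective spinBlock := by
  intro S T h
  exact Subtype.ext (fromBlocks_inj.mp h).1

theorem spinBlock_neg (S : SpecialLinearGroup (Fin 4) ℂ) : spinBlock (-S) = -spinBlock S := by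
  have h : (-S)⁻¹ = -S⁻¹ := by
    rw [inv_eq_iff_mul_eq_one, neg_mul_neg, mul_inv_cancel]
  rw [spinBlock_apply, spinBlock_apply, h, fromBlocks_neg]
  simp

/-- The block matrix of S then commutes with all gamma matrices, so it is a scalar c. Its blocks
give S = c and S⁻¹ = c, whence c² = 1. -/
theorem eq_one_or_eq_neg_one_of_wedgeRot_eq_one {S : SpecialLinearGroup (Fin 4) ℂ}
    (hS : wedgeRot S.1 = 1) : S = 1 ∨ S = -1 := by
  obtain ⟨c, hc⟩ := eq_algebraMap_of_commute_ι (z := spinorEquiv.symm (spinBlock S)) fun v => by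
    apply spinor_injective
    rw [map_mul, map_mul, spinor_spinorEquiv_symm, spinBlock_mul_spinor_ι, hS, one_mulVec]
  have h := congrArg spinor hc
  rw [spinor_spinorEquiv_symm, AlgHom.commutes, spinBlock_apply, Algebra.algebraMap_eq_smul_one,
    ← fromBlocks_one, fromBlocks_smul, fromBlocks_inj] at h
  have h1 : S.1 = c • 1 := h.1
  have h2 : (S⁻¹).1 = c • 1 := by
    rw [← transpose_transpose (S⁻¹).1, h.2.2.2, transpose_smul, transpose_one]
  have h3 := coe_mul_coe_inv S
  rw [h1, h2, Matrix.smul_mul, Matrix.mul_smul, smul_smul, Matrix.one_mul] at h3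
  have h4 : c * c = 1 := by simpa using congrFun (congrFun h3 0) 0
  rcases mul_self_eq_one_iff.mp h4 with rfl | rfl
  · left; exact Subtype.ext (by rw [h1, one_smul]; rfl)
  · right; exact Subtype.ext (by rw [h1, neg_one_smul]; rfl)

theorem eq_or_eq_neg_of_wedgeRot_eq {S T : SpecialLinearGroup (Fin 4) ℂ}
    (h : wedgeRot S.1 = wedgeRot T.1) : S = T ∨ S = -T := by
  have h1 : wedgeRot (S * T⁻¹).1 = 1 := by
    change wedgeRot (S.1 * (T⁻¹).1) = 1
    rw [wedgeRot_mul, h, ← wedgeRot_mul, coe_mul_coe_inv, wedgeRot_one]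
  rcases eq_one_or_eq_neg_one_of_wedgeRot_eq_one h1 with h2 | h2
  · left; exact mul_inv_eq_one.mp h2
  · right; rw [mul_inv_eq_iff_eq_mul] at h2; rw [h2, neg_mul, one_mul]

/-! ### Reflections -/

section Reflections

variable {n : Type*} [Fintype n] [DecidableEq n]

/-- The reflection in the hyperplane orthogonal to a unit vector. -/
def reflMatrix (u : n → ℂ) : Matrix n n ℂ := 1 - (2 : ℂ) • vecMulVec u u

theorem reflMatrix_mulVec (u v : n → ℂ) : reflMatrix u *ᵥ v = v - (2 * (u ⬝ᵥ v)) • u := by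
  rw [reflMatrix, sub_mulVec, one_mulVec, smul_mulVec, vecMulVec_mulVec, op_smul_eq_smul, smul_smul]

theorem reflMatrix_mul_self {u : n → ℂ} (hu : u ⬝ᵥ u = 1) : reflMatrix u * reflMatrix u = 1 := by
  refine mulVec_ext fun v => ?_
  rw [← mulVec_mulVec, reflMatrix_mulVec, reflMatrix_mulVec, one_mulVec, dotProduct_sub,
    dotProduct_smul, hu]
  ext i
  simp
  ring

theorem transpose_reflMatrix (u : n → ℂ) : (reflMatrix u)ᵀ = reflMatrix u := by
  simp [reflMatrix, transpose_vecMulVec]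

theorem det_reflMatrix {u : n → ℂ} (hu : u ⬝ᵥ u = 1) : (reflMatrix u).det = -1 := by
  have h : reflMatrix u = 1 + replicateCol Unit ((-2 : ℂ) • u) * replicateRow Unit u := by
    rw [← vecMulVec_eq, smul_vecMulVec, neg_smul, reflMatrix, sub_eq_add_neg]
  rw [h, det_one_add_replicateCol_mul_replicateRow, dotProduct_smul, hu]
  norm_num

/-- Over ℂ every nonisotropic vector can be normalised, by a square root of u · u, so unit vectors
give all reflections. -/
theorem exists_unit_smul {u : n → ℂ} (hu : u ⬝ᵥ u ≠ 0) :
    ∃ u', u' ⬝ᵥ u' = 1 ∧ ∀ v, reflMatrix u' *ᵥ v = v - (2 * (u ⬝ᵥ v) / (u ⬝ᵥ u)) • u := by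
  obtain ⟨c, hc⟩ := IsAlgClosed.exists_pow_nat_eq (u ⬝ᵥ u) (n := 2) (by norm_num)
  have hc0 : c ≠ 0 := by rintro rfl; exact hu (by rw [← hc]; norm_num)
  refine ⟨c⁻¹ • u, ?_, fun v => ?_⟩
  · rw [smul_dotProduct, dotProduct_smul, ← hc]
    simp only [smul_eq_mul]
    field_simp
  · rw [reflMatrix_mulVec, smul_dotProduct, smul_smul, ← hc]
    congr 2
    simp only [smul_eq_mul]
    field_simp

/-- The Cartan–Dieudonné argument, by induction on a set s outside which all standard basis vectors
are fixed. One or two reflections bring the image x of a basis vector back to e, and their vectors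
are combinations of x and e, hence orthogonal to the basis vectors already fixed. -/
theorem exists_reflections_of_fixes (s : Finset n) : ∀ R : Matrix n n ℂ, Rᵀ * R = 1 →
    (∀ i ∉ s, R *ᵥ Pi.single i 1 = Pi.single i 1) →
    ∃ l : List (n → ℂ), (∀ u ∈ l, u ⬝ᵥ u = 1) ∧ (l.map reflMatrix).prod = R := by
  induction s using Finset.induction_on with
  | empty =>
    intro R _ hR
    refine ⟨[], by simp, ?_⟩
    ext i j
    simpa [Matrix.one_apply, Pi.single_apply] using (congrFun (hR j (by simp)) i).symm
  | insert k s hk ih =>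
    intro R hR hfix
    have hdot : ∀ v w, (R *ᵥ v) ⬝ᵥ (R *ᵥ w) = v ⬝ᵥ w := by
      intro v w
      rw [dotProduct_mulVec, ← mulVec_transpose, mulVec_mulVec, hR, one_mulVec]
    set e : n → ℂ := Pi.single k 1 with he
    set x := R *ᵥ e with hx
    have hee : e ⬝ᵥ e = 1 := by simp [he]
    have hxx : x ⬝ᵥ x = 1 := by rw [hx, hdot, hee]
    have hxi : ∀ i, i ∉ insert k s → x i = 0 := by
      intro i hi
      have h := hdot e (Pi.single i 1)
      rw [hfix i hi, dotProduct_single_one, dotProduct_single_one] at h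
      rw [hx, h, he, Pi.single_apply, if_neg]
      rintro rfl
      exact hi (Finset.mem_insert_self _ _)
    have hei : ∀ i, i ∉ insert k s → e i = 0 := by
      intro i hi
      rw [he, Pi.single_apply, if_neg]
      rintro rfl
      exact hi (Finset.mem_insert_self _ _)
    -- it is enough to bring `x` back to `e` by reflections fixing the other basis vectors
    suffices h : ∃ l : List (n → ℂ), (∀ u ∈ l, u ⬝ᵥ u = 1) ∧
        (∀ i, i ∉ insert k s → ((l.map reflMatrix).prod)ᵀ *ᵥ Pi.single i 1 = Pi.single i 1) ∧
        (l.map reflMatrix).prod * (l.map reflMatrix).prodᵀ = 1 ∧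
        (l.map reflMatrix).prodᵀ *ᵥ x = e by
      obtain ⟨l, hl, hli, hlo, hlx⟩ := h
      set L := (l.map reflMatrix).prod
      obtain ⟨m, hm, hmR⟩ := ih (Lᵀ * R) (by
        rw [transpose_mul, transpose_transpose, Matrix.mul_assoc, ← Matrix.mul_assoc L, hlo,
          Matrix.one_mul, hR]) (by
        intro i hi
        by_cases hik : i = k
        · subst hik
          rw [← mulVec_mulVec, ← he, ← hx, hlx]
        · have hi' : i ∉ insert k s := by simp [hik, hi]
          rw [← mulVec_mulVec, hfix i hi', hli i hi'])
      refine ⟨l ++ m, ?_, ?_⟩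
      · intro u hu
        rcases List.mem_append.mp hu with h | h
        · exact hl u h
        · exact hm u h
      · rw [List.map_append, List.prod_append, hmR, ← Matrix.mul_assoc, hlo, Matrix.one_mul]
    -- If x - e is isotropic then x · e = 1 and x + e has square 4. Reflecting in x + e sends x to
    -- -e, and reflecting in e then gives e. Otherwise the reflection in x - e suffices.
    by_cases h1 : (x - e) ⬝ᵥ (x - e) = 0
    · have hxe : x ⬝ᵥ e = 1 := by
        simp only [sub_dotProduct, dotProduct_sub, hxx, hee, dotProduct_comm e x] at h1
        linear_combination (-1 / 2 : ℂ) * h1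
      have h2 : (x + e) ⬝ᵥ (x + e) = 4 := by
        simp only [add_dotProduct, dotProduct_add, hxx, hee, hxe, dotProduct_comm e x]
        norm_num
      obtain ⟨u, hu, hur⟩ := exists_unit_smul (u := x + e) (by rw [h2]; norm_num)
      refine ⟨[u, e], by simp [hu, hee], ?_, ?_, ?_⟩
      · intro i hi
        simp only [List.map_cons, List.map_nil, List.prod_cons, List.prod_nil, mul_one,
          transpose_mul, transpose_reflMatrix, ← mulVec_mulVec]
        rw [hur, dotProduct_single_one, Pi.add_apply, hxi i hi, hei i hi, add_zero, mul_zero,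
          zero_div, zero_smul, sub_zero, reflMatrix_mulVec, dotProduct_single_one, hei i hi,
          mul_zero, zero_smul, sub_zero]
      · simp only [List.map_cons, List.map_nil, List.prod_cons, List.prod_nil, mul_one,
          transpose_mul, transpose_reflMatrix]
        rw [Matrix.mul_assoc, ← Matrix.mul_assoc (reflMatrix e), reflMatrix_mul_self hee,
          Matrix.one_mul, reflMatrix_mul_self hu]
      · simp only [List.map_cons, List.map_nil, List.prod_cons, List.prod_nil, mul_one,
          transpose_mul, transpose_reflMatrix, ← mulVec_mulVec]
        rw [hur, h2, add_dotProduct, hxx, dotProduct_comm e x, hxe, reflMatrix_mulVec]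
        simp only [dotProduct_sub, dotProduct_smul, dotProduct_add, hee, dotProduct_comm e x, hxe]
        ext i
        simp
        ring
    · obtain ⟨u, hu, hur⟩ := exists_unit_smul h1
      refine ⟨[u], by simp [hu], ?_, ?_, ?_⟩
      · intro i hi
        simp only [List.map_cons, List.map_nil, List.prod_cons, List.prod_nil, mul_one,
          transpose_reflMatrix]
        rw [hur, dotProduct_single_one, Pi.sub_apply, hxi i hi, hei i hi]
        simp
      · simp only [List.map_cons, List.map_nil, List.prod_cons, List.prod_nil, mul_one,
          transpose_reflMatrix, reflMatrix_mul_self hu]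
      · simp only [List.map_cons, List.map_nil, List.prod_cons, List.prod_nil, mul_one,
          transpose_reflMatrix]
        rw [hur]
        have h3 : 2 * ((x - e) ⬝ᵥ x) / ((x - e) ⬝ᵥ (x - e)) = 1 := by
          rw [div_eq_one_iff_eq h1]
          simp only [sub_dotProduct, dotProduct_sub, hxx, hee, dotProduct_comm e x]
          ring
        rw [h3, one_smul, sub_sub_cancel]

/-- A complex orthogonal matrix is a product of reflections. -/
theorem exists_reflections {R : Matrix n n ℂ} (hR : Rᵀ * R = 1) :
    ∃ l : List (n → ℂ), (∀ u ∈ l, u ⬝ᵥ u = 1) ∧ (l.map reflMatrix).prod = R :=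
  exists_reflections_of_fixes Finset.univ R hR fun i hi => (hi (Finset.mem_univ i)).elim

end Reflections

/-! ### Spin group elements from reflections -/

/-- Conjugation by a unit vector is minus the reflection; the signs cancel in products of two
vectors. -/
theorem ι_mul_ι_reflMatrix {u : Fin 3 × Fin 2 → ℂ} (hu : u ⬝ᵥ u = 1) (v : Fin 3 × Fin 2 → ℂ) :
    CliffordAlgebra.ι (stdQuad 3) u * CliffordAlgebra.ι (stdQuad 3) v =
      -(CliffordAlgebra.ι (stdQuad 3) (reflMatrix u *ᵥ v) * CliffordAlgebra.ι (stdQuad 3) u) := by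
  have h1 := CliffordAlgebra.ι_mul_ι_add_swap (Q := stdQuad 3) u v
  have h2 := CliffordAlgebra.ι_sq_scalar (stdQuad 3) u
  rw [stdQuad_polar] at h1
  rw [stdQuad_apply, hu, map_one] at h2
  rw [reflMatrix_mulVec, map_sub, map_smul, sub_mul, smul_mul_assoc, h2, neg_sub,
    ← Algebra.algebraMap_eq_smul_one, ← h1, add_sub_cancel_right]

theorem ι_mul_ι_self {u : Fin 3 × Fin 2 → ℂ} (hu : u ⬝ᵥ u = 1) :
    CliffordAlgebra.ι (stdQuad 3) u * CliffordAlgebra.ι (stdQuad 3) u = 1 := by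
  rw [CliffordAlgebra.ι_sq_scalar, stdQuad_apply, hu, map_one]

theorem ι_mul_ι_mem_spinGroup {u w : Fin 3 × Fin 2 → ℂ} (hu : u ⬝ᵥ u = 1) (hw : w ⬝ᵥ w = 1) :
    CliffordAlgebra.ι (stdQuad 3) u * CliffordAlgebra.ι (stdQuad 3) w ∈
      spinGroup (stdQuad 3) := by
  have hlip : ∀ {u : Fin 3 × Fin 2 → ℂ}, u ⬝ᵥ u = 1 → CliffordAlgebra.ι (stdQuad 3) u ∈
      (lipschitzGroup (stdQuad 3)).toSubmonoid.map
        (Units.coeHom <| CliffordAlgebra (stdQuad 3)) := fun {u} hu =>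
    ⟨⟨_, _, ι_mul_ι_self hu, ι_mul_ι_self hu⟩, Subgroup.subset_closure ⟨u, rfl⟩, rfl⟩
  have hstar : star (CliffordAlgebra.ι (stdQuad 3) u * CliffordAlgebra.ι (stdQuad 3) w) =
      CliffordAlgebra.ι (stdQuad 3) w * CliffordAlgebra.ι (stdQuad 3) u := by
    rw [star_mul, CliffordAlgebra.star_ι, CliffordAlgebra.star_ι, neg_mul_neg]
  refine ⟨⟨mul_mem (hlip hu) (hlip hw), ?_⟩, CliffordAlgebra.ι_mul_ι_mem_evenOdd_zero _ _ _⟩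
  rw [SetLike.mem_coe, Unitary.mem_iff, hstar]
  constructor
  · rw [mul_assoc, ← mul_assoc (CliffordAlgebra.ι (stdQuad 3) u), ι_mul_ι_self hu, one_mul,
      ι_mul_ι_self hw]
  · rw [mul_assoc, ← mul_assoc (CliffordAlgebra.ι (stdQuad 3) w), ι_mul_ι_self hw, one_mul,
      ι_mul_ι_self hu]

theorem neg_one_mem_spinGroup : (-1 : CliffordAlgebra (stdQuad 3)) ∈ spinGroup (stdQuad 3) := by
  have hu : (Pi.single (0, 0) 1 : Fin 3 × Fin 2 → ℂ) ⬝ᵥ Pi.single (0, 0) 1 = 1 := by simp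
  -- For a unit vector u, the element -1 is the product of u and -u.
  have h := ι_mul_ι_mem_spinGroup hu (w := -Pi.single (0, 0) 1) (by simp)
  rwa [map_neg, mul_neg, ι_mul_ι_self hu] at h

theorem det_bivec (w : WedgeIdx → ℂ) :
    (bivec w).det = (1 / 4) * (w ⬝ᵥ wedgeGram *ᵥ w) ^ 2 := by
  rw [det_fin_four, dotProduct_wedgeGram_mulVec]
  simp [bivec, Fin.sum_univ_three]
  ring

theorem det_bivecDual (w : WedgeIdx → ℂ) :
    (bivecDual w).det = 4 * (w ⬝ᵥ wedgeGram *ᵥ w) ^ 2 := by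
  rw [det_fin_four, dotProduct_wedgeGram_mulVec]
  simp [bivecDual, Fin.sum_univ_three]
  ring

/-- A product of two gamma matrices is block diagonal. Its first block B_a D_b has inverse B_b D_a,
whose transpose D_a B_b is the second block, because all four factors are antisymmetric. -/
theorem exists_spinBlock_eq {u w : Fin 3 × Fin 2 → ℂ} (hu : u ⬝ᵥ u = 1) (hw : w ⬝ᵥ w = 1) :
    ∃ S : SpecialLinearGroup (Fin 4) ℂ, spinBlock S =
      spinor (CliffordAlgebra.ι (stdQuad 3) u * CliffordAlgebra.ι (stdQuad 3) w) := by
  set a := changeOfBasisᴴ *ᵥ u with ha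
  set b := changeOfBasisᴴ *ᵥ w with hb
  have hqa : a ⬝ᵥ wedgeGram *ᵥ a = 1 := by rw [ha, wedgeGram_frame, stdQuad_apply, hu]
  have hqb : b ⬝ᵥ wedgeGram *ᵥ b = 1 := by rw [hb, wedgeGram_frame, stdQuad_apply, hw]
  have hdet : (bivec a * bivecDual b).det = 1 := by
    rw [det_mul, det_bivec, det_bivecDual, hqa, hqb]
    norm_num
  let S : SpecialLinearGroup (Fin 4) ℂ := ⟨bivec a * bivecDual b, hdet⟩
  have h1 : bivec b * bivecDual a * S.1 = 1 := by
    change bivec b * bivecDual a * (bivec a * bivecDual b) = 1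
    rw [Matrix.mul_assoc, ← Matrix.mul_assoc (bivecDual a), bivecDual_mul_bivec, hqa, one_smul,
      Matrix.one_mul, bivec_mul_bivecDual, hqb, one_smul]
  have h2 : (S⁻¹).1 = bivec b * bivecDual a := by
    rw [← Matrix.one_mul (S⁻¹).1, ← h1, Matrix.mul_assoc, coe_mul_coe_inv, Matrix.mul_one]
  refine ⟨S, ?_⟩
  rw [map_mul, spinor_ι, spinor_ι, spinBlock_apply, h2, transpose_mul, transpose_bivec,
    transpose_bivecDual, neg_mul_neg, gammaMatrix_apply, gammaMatrix_apply, fromBlocks_multiply]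
  simp [S, ha, hb]

theorem ι_injective : Function.Injective (CliffordAlgebra.ι (stdQuad 3)) := by
  intro v w h
  have h1 := congrArg spinor h
  rw [spinor_ι, spinor_ι, gammaMatrix_apply, gammaMatrix_apply, fromBlocks_inj] at h1
  have h2 := congrArg (changeOfBasis *ᵥ ·) (bivec_injective h1.2.1)
  simpa only [mulVec_mulVec, changeOfBasis_mul_conjTranspose, one_mulVec] using h2

/-- The matrices lifting simultaneously to `SL(4, ℂ)` and to the spin group. -/
def HasSpinLift (R : Matrix (Fin 3 × Fin 2) (Fin 3 × Fin 2) ℂ) : Prop :=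
  ∃ (S : SpecialLinearGroup (Fin 4) ℂ) (x : CliffordAlgebra (stdQuad 3)),
    x ∈ spinGroup (stdQuad 3) ∧ spinor x = spinBlock S ∧ wedgeRot S.1 = R

theorem HasSpinLift.one : HasSpinLift 1 :=
  ⟨1, 1, one_mem _, by rw [map_one, map_one], wedgeRot_one⟩

theorem HasSpinLift.mul {R R' : Matrix (Fin 3 × Fin 2) (Fin 3 × Fin 2) ℂ} (hR : HasSpinLift R)
    (hR' : HasSpinLift R') : HasSpinLift (R * R') := by
  obtain ⟨S, x, hx, hS, rfl⟩ := hR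
  obtain ⟨S', x', hx', hS', rfl⟩ := hR'
  exact ⟨S * S', x * x', mul_mem hx hx', by rw [map_mul, map_mul, hS, hS'], wedgeRot_mul _ _⟩

theorem hasSpinLift_reflMatrix_mul {u w : Fin 3 × Fin 2 → ℂ} (hu : u ⬝ᵥ u = 1)
    (hw : w ⬝ᵥ w = 1) : HasSpinLift (reflMatrix u * reflMatrix w) := by
  obtain ⟨S, hS⟩ := exists_spinBlock_eq hu hw
  refine ⟨S, _, ι_mul_ι_mem_spinGroup hu hw, hS.symm, mulVec_ext fun v => ι_injective ?_⟩
  have h := spinBlock_mul_spinor_ι S v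
  apply_fun (· * spinBlock S⁻¹) at h
  rw [mul_assoc (spinor _), spinBlock_mul_inv, mul_one, hS, ← map_mul] at h
  apply spinor_injective
  rw [← h, mul_assoc, ι_mul_ι_reflMatrix hw, mul_neg, ← mul_assoc, ι_mul_ι_reflMatrix hu,
    neg_mul, neg_neg, mulVec_mulVec, mul_assoc, map_mul, ← hS, mul_assoc, spinBlock_mul_inv,
    mul_one]

/-- Lifts exist for pairs of reflections only. The induction therefore carries, in the odd case, the
lifts obtained after one more reflection. -/
theorem hasSpinLift_list (l : List (Fin 3 × Fin 2 → ℂ)) (hl : ∀ u ∈ l, u ⬝ᵥ u = 1) :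
    ((l.map reflMatrix).prod.det = 1 ∧ HasSpinLift (l.map reflMatrix).prod) ∨
      ((l.map reflMatrix).prod.det = -1 ∧
        ∀ u, u ⬝ᵥ u = 1 → HasSpinLift (reflMatrix u * (l.map reflMatrix).prod)) := by
  induction l with
  | nil => exact Or.inl ⟨by simp, by simpa using HasSpinLift.one⟩
  | cons w l ih =>
    have hw := hl w (by simp)
    rw [List.map_cons, List.prod_cons, det_mul, det_reflMatrix hw]
    rcases ih fun u hu => hl u (by simp [hu]) with ⟨hd, h⟩ | ⟨hd, h⟩
    · right
      refine ⟨by rw [hd, mul_one], fun u hu => ?_⟩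
      rw [← Matrix.mul_assoc]
      exact (hasSpinLift_reflMatrix_mul hu hw).mul h
    · left
      exact ⟨by rw [hd]; norm_num, h w hw⟩

/-- `SO(6, ℂ)` is covered by `SL(4, ℂ)` and by the spin group. -/
theorem hasSpinLift_of_orthogonal {R : Matrix (Fin 3 × Fin 2) (Fin 3 × Fin 2) ℂ}
    (hR : Rᵀ * R = 1) (hdet : R.det = 1) : HasSpinLift R := by
  obtain ⟨l, hl, rfl⟩ := exists_reflections hR
  rcases hasSpinLift_list l hl with ⟨-, h⟩ | ⟨hd, -⟩
  · exact h
  · rw [hd] at hdet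
    norm_num at hdet

/-- The element of the Clifford algebra acting on spinors through `S`. -/
noncomputable def spinLift : SpecialLinearGroup (Fin 4) ℂ →* CliffordAlgebra (stdQuad 3) :=
  (spinorEquiv.symm : _ →* CliffordAlgebra (stdQuad 3)).comp spinBlock

theorem spinor_spinLift (S : SpecialLinearGroup (Fin 4) ℂ) : spinor (spinLift S) = spinBlock S :=
  spinor_spinorEquiv_symm _

/-- The rotation of S has a lift T built from reflections, whose Clifford element is in the spin
group. S and T differ at most by a sign, and -1 is in the spin group. -/
theorem spinLift_mem_spinGroup (S : SpecialLinearGroup (Fin 4) ℂ) :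
    spinLift S ∈ spinGroup (stdQuad 3) := by
  obtain ⟨T, x, hx, hT, hR⟩ := hasSpinLift_of_orthogonal (wedgeRot_transpose_mul S.1 S.2)
    (by rw [det_wedgeRot, S.2, one_pow])
  rcases eq_or_eq_neg_of_wedgeRot_eq hR with h | h
  · have : spinLift S = x := spinor_injective (by rw [spinor_spinLift, hT, h])
    rwa [this]
  · have : spinLift S = -1 * x := spinor_injective (by
      rw [spinor_spinLift, map_mul, map_neg, map_one, hT, h, spinBlock_neg, neg_one_mul, neg_neg])
    rw [this]
    exact mul_mem neg_one_mem_spinGroup hx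

theorem spinLift_conj (S : SpecialLinearGroup (Fin 4) ℂ) (v : Fin 3 × Fin 2 → ℂ) :
    spinLift S * CliffordAlgebra.ι (stdQuad 3) v * star (spinLift S) =
      CliffordAlgebra.ι (stdQuad 3) (wedgeRot S.1 *ᵥ v) := by
  have h : spinLift S * CliffordAlgebra.ι (stdQuad 3) v =
      CliffordAlgebra.ι (stdQuad 3) (wedgeRot S.1 *ᵥ v) * spinLift S := spinor_injective (by
    rw [map_mul, map_mul, spinor_spinLift, spinBlock_mul_spinor_ι])
  rw [h, mul_assoc, spinGroup.mul_star_self_of_mem (spinLift_mem_spinGroup S), mul_one]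

/-- With y the lift of S, the element y⁻¹x commutes with all vectors and is a scalar c. The Clifford
star fixes complex scalars, so unitarity reads c² = 1 instead of |c| = 1. -/
theorem eq_spinLift_of_conj {x : CliffordAlgebra (stdQuad 3)} (hx : x ∈ spinGroup (stdQuad 3))
    {S : SpecialLinearGroup (Fin 4) ℂ}
    (h : ∀ v, x * CliffordAlgebra.ι (stdQuad 3) v * star x =
      CliffordAlgebra.ι (stdQuad 3) (wedgeRot S.1 *ᵥ v)) :
    x = spinLift S ∨ x = spinLift (-S) := by
  have hS := spinLift_mem_spinGroup S
  set y := spinLift S with hy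
  have hyy := spinGroup.star_mul_self_of_mem hS
  have hyy' := spinGroup.mul_star_self_of_mem hS
  have hxx := spinGroup.star_mul_self_of_mem hx
  obtain ⟨c, hc⟩ := eq_algebraMap_of_commute_ι (z := star y * x) fun v => by
    have h1 : x * CliffordAlgebra.ι (stdQuad 3) v =
        y * CliffordAlgebra.ι (stdQuad 3) v * star y * x := by
      rw [hy, spinLift_conj, ← h, mul_assoc _ (star x), hxx, mul_one]
    rw [mul_assoc, h1, mul_assoc (y * _), mul_assoc y, ← mul_assoc (star y), hyy, one_mul]
  have hx' : x = c • y := by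
    rw [← one_mul x, ← hyy', mul_assoc, hc, ← Algebra.commutes, Algebra.smul_def]
  have h2 : star (star y * x) * (star y * x) = 1 := by
    rw [star_mul, star_star, mul_assoc, ← mul_assoc y, hyy', one_mul, hxx]
  rw [hc, CliffordAlgebra.star_algebraMap, ← map_mul] at h2
  have h3 : c * c = 1 := (algebraMap ℂ (CliffordAlgebra (stdQuad 3))).injective
    (by rw [h2, map_one])
  rcases mul_self_eq_one_iff.mp h3 with rfl | rfl
  · left; rw [hx', one_smul]
  · right
    rw [hx', neg_one_smul]
    apply spinor_injective
    rw [map_neg, spinor_spinLift, spinor_spinLift, spinBlock_neg]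

/-! ### Exponentials of matrices -/

section Exponential

open scoped Matrix.Norms.Operator in
theorem hasSum_matrix_exp {m : Type*} [Fintype m] [DecidableEq m] (A : Matrix m m ℂ) :
    HasSum (fun n : ℕ => ((n.factorial : ℂ)⁻¹) • A ^ n) (NormedSpace.exp A) := by
  exact NormedSpace.exp_series_hasSum_exp' (𝕂 := ℂ) A

variable {m n : Type*} [Fintype m] [DecidableEq m] [Fintype n] [DecidableEq n]

/-- The rectangular P covers changes of basis, invariance of forms, and the inclusion of a
subrepresentation. -/
theorem exp_mul_of_intertwine {A : Matrix m m ℂ} {B : Matrix n n ℂ} {P : Matrix m n ℂ}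
    (h : A * P = P * B) : NormedSpace.exp A * P = P * NormedSpace.exp B := by
  have hpow : ∀ k : ℕ, A ^ k * P = P * B ^ k := by
    intro k
    induction k with
    | zero => simp
    | succ k ih =>
      rw [pow_succ, pow_succ, Matrix.mul_assoc, h, ← Matrix.mul_assoc, ih, Matrix.mul_assoc]
  have hl := (hasSum_matrix_exp A).map (addMonoidHomMulRight P)
    (Continuous.matrix_mul continuous_id continuous_const)
  have hr := (hasSum_matrix_exp B).map (addMonoidHomMulLeft P)
    (Continuous.matrix_mul continuous_const continuous_id)
  have hf : ∀ k : ℕ, P * ((k.factorial : ℂ)⁻¹ • B ^ k) = ((k.factorial : ℂ)⁻¹ • A ^ k) * P := by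
    intro k
    rw [Matrix.smul_mul, Matrix.mul_smul, hpow]
  have e := funext hf
  refine hl.unique ?_
  change HasSum (fun k : ℕ => ((k.factorial : ℂ)⁻¹ • A ^ k) * P) _
  rw [← e]
  exact hr

theorem algHom_matrix_exp (f : Matrix m m ℂ →ₐ[ℂ] Matrix n n ℂ) (A : Matrix m m ℂ) :
    f (NormedSpace.exp A) = NormedSpace.exp (f A) := by
  have hl := (hasSum_matrix_exp A).map f f.toLinearMap.continuous_of_finiteDimensional
  refine hl.unique ?_
  have e : f ∘ (fun k : ℕ => (k.factorial : ℂ)⁻¹ • A ^ k) =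
      fun k : ℕ => (k.factorial : ℂ)⁻¹ • f A ^ k := by
    ext1 k
    rw [Function.comp_apply, map_smul, map_pow]
  rw [e]
  exact hasSum_matrix_exp (f A)

open scoped Kronecker

/-- `A ↦ A ⊗ 1` as an algebra homomorphism. -/
noncomputable def kroneckerLeft (m n : Type*) [Fintype m] [DecidableEq m] [Fintype n]
    [DecidableEq n] : Matrix m m ℂ →ₐ[ℂ] Matrix (m × n) (m × n) ℂ :=
  AlgHom.ofLinearMap ((kroneckerBilinear (R := ℂ) (α := ℂ)).flip (1 : Matrix n n ℂ)) one_kronecker_one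
    fun A B => by
      change (A * B) ⊗ₖ (1 : Matrix n n ℂ) = (A ⊗ₖ 1) * (B ⊗ₖ 1)
      rw [← mul_kronecker_mul, Matrix.mul_one]

/-- `B ↦ 1 ⊗ B` as an algebra homomorphism. -/
noncomputable def kroneckerRight (m n : Type*) [Fintype m] [DecidableEq m] [Fintype n]
    [DecidableEq n] : Matrix n n ℂ →ₐ[ℂ] Matrix (m × n) (m × n) ℂ :=
  AlgHom.ofLinearMap (kroneckerBilinear (R := ℂ) (α := ℂ) (1 : Matrix m m ℂ)) one_kronecker_one
    fun A B => by
      change (1 : Matrix m m ℂ) ⊗ₖ (A * B) = (1 ⊗ₖ A) * (1 ⊗ₖ B)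
      rw [← mul_kronecker_mul, Matrix.mul_one]

theorem exp_kronecker (A : Matrix m m ℂ) (B : Matrix n n ℂ) :
    NormedSpace.exp (A ⊗ₖ (1 : Matrix n n ℂ) + (1 : Matrix m m ℂ) ⊗ₖ B) =
      NormedSpace.exp A ⊗ₖ NormedSpace.exp B := by
  have hc : Commute (A ⊗ₖ (1 : Matrix n n ℂ)) ((1 : Matrix m m ℂ) ⊗ₖ B) := by
    rw [Commute, SemiconjBy, ← mul_kronecker_mul, ← mul_kronecker_mul]
    simp
  have hA := algHom_matrix_exp (kroneckerLeft m n) A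
  have hB := algHom_matrix_exp (kroneckerRight m n) B
  change _ = NormedSpace.exp (A ⊗ₖ (1 : Matrix n n ℂ)) at hA
  change _ = NormedSpace.exp ((1 : Matrix m m ℂ) ⊗ₖ B) at hB
  rw [Matrix.exp_add_of_commute _ _ hc, ← hA, ← hB]
  change (NormedSpace.exp A ⊗ₖ (1 : Matrix n n ℂ)) * ((1 : Matrix m m ℂ) ⊗ₖ NormedSpace.exp B) = _
  rw [← mul_kronecker_mul, Matrix.mul_one, Matrix.one_mul]

/-- The embedding of bivectors into `ℂ⁴ ⊗ ℂ⁴`. -/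
noncomputable def bivecEmbed : Matrix (Fin 4 × Fin 4) WedgeIdx ℂ :=
  Matrix.of fun p x => vec (bivec (Pi.single x 1)) p

theorem bivecEmbed_mulVec (w : WedgeIdx → ℂ) : bivecEmbed *ᵥ w = vec (bivec w) := by
  conv_rhs => rw [pi_eq_sum_univ w]
  ext p
  simp only [map_sum, map_smul, bivecEmbed, mulVec, dotProduct, of_apply, vec, Matrix.sum_apply,
    Matrix.smul_apply, smul_eq_mul]
  refine Finset.sum_congr rfl fun x _ => ?_
  rw [mul_comm]
  have hx : (Pi.single x 1 : WedgeIdx → ℂ) = fun y => if x = y then 1 else 0 := by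
    ext y
    simp [Pi.single_apply, eq_comm]
  rw [hx]

theorem vec_bivec_injective : Function.Injective fun w => vec (bivec w) := fun _ _ h =>
  bivec_injective (vec_inj.mp h)

/-- Λ² sits in ℂ⁴ ⊗ ℂ⁴ as the antisymmetric tensors. There X acts by X ⊗ 1 + 1 ⊗ X, with exponential
eˣ ⊗ eˣ, and the inclusion intertwines the exponentials as well. -/
theorem wedgeSq_exp (X : Matrix (Fin 4) (Fin 4) ℂ) :
    wedgeSq (NormedSpace.exp X) = NormedSpace.exp (wedgeDer X) := by
  have h1 : (X ⊗ₖ (1 : Matrix (Fin 4) (Fin 4) ℂ) + (1 : Matrix (Fin 4) (Fin 4) ℂ) ⊗ₖ X) *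
      bivecEmbed = bivecEmbed * wedgeDer X := by
    refine mulVec_ext fun w => ?_
    rw [← mulVec_mulVec, ← mulVec_mulVec, bivecEmbed_mulVec, bivecEmbed_mulVec, add_mulVec,
      kronecker_mulVec_vec, kronecker_mulVec_vec, bivec_mulVec_wedgeDer, transpose_one,
      Matrix.mul_one, Matrix.one_mul, ← vec_add, add_comm]
  have h2 := exp_mul_of_intertwine h1
  rw [exp_kronecker] at h2
  refine mulVec_ext fun w => vec_bivec_injective ?_
  have h3 := congrArg (· *ᵥ w) h2
  simp only [← mulVec_mulVec, bivecEmbed_mulVec, kronecker_mulVec_vec] at h3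
  simp only [bivec_mulVec_wedgeSq, h3]

/-- A traceless X acts on bivectors by maps skew for the wedge form, so the exponential preserves
the form. By `wedgeSq_gram` it also scales the form by the determinant of exp X, and one nonzero
entry shows that this is 1. -/
theorem det_exp_of_trace_eq_zero {X : Matrix (Fin 4) (Fin 4) ℂ} (hX : X.trace = 0) :
    (NormedSpace.exp X).det = 1 := by
  have h1 : (-(wedgeDer X)ᵀ) * wedgeGram = wedgeGram * wedgeDer X := by
    have h := wedgeDer_gram X
    rw [hX, zero_smul] at h
    rw [Matrix.neg_mul, neg_eq_iff_add_eq_zero, h]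
  have h2 := exp_mul_of_intertwine h1
  have h3 := wedgeSq_gram (NormedSpace.exp X)
  have h4 : NormedSpace.exp (wedgeDer X)ᵀ * NormedSpace.exp (-(wedgeDer X)ᵀ) = 1 := by
    rw [← Matrix.exp_add_of_commute _ _ (by simp [Commute, SemiconjBy]), add_neg_cancel,
      NormedSpace.exp_zero]
  rw [wedgeSq_exp, ← Matrix.exp_transpose, Matrix.mul_assoc, ← h2, ← Matrix.mul_assoc, h4,
    Matrix.one_mul] at h3
  have h5 := congrFun (congrFun h3 (.inl 0)) (.inr 0)
  simpa [wedgeGram] using h5.symm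

theorem exp_mem_unitary {X : Matrix (Fin 4) (Fin 4) ℂ} (hX : I31 * X * I31 = -Xᴴ) :
    (NormedSpace.exp X)ᴴ * I31 * NormedSpace.exp X = I31 := by
  have hI : I31 * I31 = 1 := by
    ext i j
    fin_cases i <;> fin_cases j <;> simp [I31]
  have h1 : Xᴴ * I31 = I31 * -X := by
    rw [← neg_eq_iff_eq_neg.mpr hX, Matrix.neg_mul, Matrix.mul_assoc, hI, Matrix.mul_one,
      Matrix.mul_neg]
  rw [← Matrix.exp_conjTranspose, exp_mul_of_intertwine h1, Matrix.mul_assoc,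
    ← Matrix.exp_add_of_commute _ _ (by simp [Commute, SemiconjBy]), neg_add_cancel,
    NormedSpace.exp_zero, Matrix.mul_one]

/-! ### Quaternionic exponentials through complex ones. -/

theorem decomplexify_add {n : ℕ} (A B : Matrix (Fin n × Fin 2) (Fin n × Fin 2) ℂ) :
    decomplexify (A + B) = decomplexify A + decomplexify B := by
  ext i j <;> simp [decomplexify_apply]

theorem continuous_quatMk {X : Type*} [TopologicalSpace X] {a b c d : X → ℝ}
    (ha : Continuous a) (hb : Continuous b) (hc : Continuous c) (hd : Continuous d) :
    Continuous fun x => quatMk (a x) (b x) (c x) (d x) := by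
  have h : Continuous fun x => Quaternion.linearIsometryEquivTuple.symm
      (WithLp.toLp 2 ![a x, b x, c x, d x]) := by
    refine Quaternion.linearIsometryEquivTuple.symm.continuous.comp
      ((PiLp.continuous_toLp 2 _).comp (continuous_pi fun i => ?_))
    fin_cases i <;> assumption
  exact h

theorem continuous_decomplexify {n : ℕ} :
    Continuous (decomplexify : Matrix (Fin n × Fin 2) (Fin n × Fin 2) ℂ → _) := by
  refine continuous_matrix fun i j => ?_
  simp only [decomplexify_apply]
  exact continuous_quatMk (by fun_prop) (by fun_prop) (by fun_prop) (by fun_prop)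

/-- `decomplexify` is additive and continuous, so it may be applied termwise to the complex
exponential series, each term of which comes from a quaternionic matrix. -/
theorem exp_eq_decomplexify {n : ℕ} (A : Matrix (Fin n) (Fin n) ℍ[ℝ]) :
    NormedSpace.exp A = decomplexify (NormedSpace.exp (complexify A)) := by
  have h := (hasSum_matrix_exp (complexify A)).map
    (AddMonoidHom.mk' decomplexify decomplexify_add) continuous_decomplexify
  rw [NormedSpace.exp_eq_tsum_rat]
  refine HasSum.tsum_eq ?_
  have e : (AddMonoidHom.mk' decomplexify decomplexify_add ∘
      fun k : ℕ => (k.factorial : ℂ)⁻¹ • complexify A ^ k) =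
      fun k : ℕ => (k.factorial : ℚ)⁻¹ • A ^ k := by
    ext1 k
    have hp : complexify A ^ k = complexify (A ^ k) := ((complexifyHom n).map_pow A k).symm
    have hq : ((k.factorial : ℚ)⁻¹) • A ^ k = ((k.factorial : ℝ)⁻¹) • A ^ k := by
      rw [← Rat.cast_smul_eq_qsmul ℝ]
      norm_num
    have hs : ((k.factorial : ℂ)⁻¹) • complexify (A ^ k) =
        complexify (((k.factorial : ℚ)⁻¹) • A ^ k) := by
      rw [hq, complexify_smul, ← Complex.coe_smul]
      norm_num
    change decomplexify (((k.factorial : ℂ)⁻¹) • complexify A ^ k) = _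
    rw [hp, hs, decomplexify_complexify]
  rw [← e]
  exact h

end Exponential

/-! ### The bases of the Lie algebras -/

set_option maxHeartbeats 2000000 in
theorem suMatrix_eq (θ : Fin 15 → ℝ) : suMatrix θ =
    let I := Complex.I
    let b : ℂ := (Real.sqrt 3 : ℂ)⁻¹ / 2
    let c : ℂ := (Real.sqrt 6 : ℂ)⁻¹ / 2
    !![I * (-θ 2 / 2 - b * θ 7 + c * θ 14), (-θ 1 - I * θ 0) / 2, (-θ 4 - I * θ 3) / 2,
        (-θ 12 + I * θ 13) / 2;
      (θ 1 - I * θ 0) / 2, I * (θ 2 / 2 - b * θ 7 + c * θ 14), (-θ 6 - I * θ 5) / 2,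
        (θ 10 - I * θ 11) / 2;
      (θ 4 - I * θ 3) / 2, (θ 6 - I * θ 5) / 2, I * (2 * b * θ 7 + c * θ 14),
        (-θ 8 + I * θ 9) / 2;
      (-θ 12 - I * θ 13) / 2, (θ 10 + I * θ 11) / 2, (-θ 8 - I * θ 9) / 2,
        -(3 * c * I * θ 14)] := by
  have h2 : (starRingEnd ℂ) 2 = 2 := map_ofNat _ 2
  ext i j
  fin_cases i <;> fin_cases j <;>
    simp [suMatrix, Fin.sum_univ_succ, gellMann, cornerBlock, conjMat, h2] <;> ring

theorem sqrt_six : Real.sqrt 6 = Real.sqrt 2 * Real.sqrt 3 := by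
  rw [← Real.sqrt_mul (by norm_num)]
  norm_num

set_option maxHeartbeats 1000000 in
-- The one place where the two lists of generators are compared: equal coordinates θ give the same
-- operator on ℂ⁶. Linearity of `soMatrix`, preservation of brackets and the complex form of the
-- generators are all drawn from it.
theorem complexify_soMatrix_mul (θ : Fin 15 → ℝ) :
    complexify (soMatrix θ) * scaledBasis = scaledBasis * wedgeDer (suMatrix θ) := by
  have h2 : (Real.sqrt 2 : ℂ) ≠ 0 := by simp
  have h3 : (Real.sqrt 3 : ℂ) ≠ 0 := by simp
  have h22 : (Real.sqrt 2 : ℂ) ^ 2 = 2 := by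
    rw [← Complex.ofReal_pow, Real.sq_sqrt (by norm_num)]; norm_num
  -- All roots are expressed through √2 and 1/√3, after which √3 · (1/√3) = 1 is the only relation
  -- needed.
  have h6 : (Real.sqrt 6 : ℂ)⁻¹ = (Real.sqrt 2 : ℂ) * (Real.sqrt 3 : ℂ)⁻¹ / 2 := by
    rw [sqrt_six, Complex.ofReal_mul]
    field_simp
    rw [h22]
  have h3i : (Real.sqrt 3 : ℂ) * (Real.sqrt 3 : ℂ)⁻¹ = 1 := mul_inv_cancel₀ h3
  rw [suMatrix_eq, h6]
  generalize hs : (Real.sqrt 2 : ℂ) = s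
  generalize ht : (Real.sqrt 3 : ℂ) = t at *
  ext ⟨k, a⟩ x
  rcases x with x | x <;> fin_cases x <;> fin_cases k <;> fin_cases a <;>
    simp [scaledBasis, complexify, quatToMat, soMatrix, Matrix.mul_apply, Fintype.sum_prod_type,
      Fin.sum_univ_three, wedgeDer, wedgePair, Matrix.one_apply, hs, ht] <;>
    ring_nf <;> (try simp only [Complex.I_sq]) <;> ring_nf <;> (try simp only [h3i]) <;> ring

theorem suMatrix_add (θ η : Fin 15 → ℝ) : suMatrix (θ + η) = suMatrix θ + suMatrix η := by
  rw [suMatrix_eq, suMatrix_eq, suMatrix_eq]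
  ext i j
  fin_cases i <;> fin_cases j <;> simp <;> ring

theorem suMatrix_smul (c : ℝ) (θ : Fin 15 → ℝ) : suMatrix (c • θ) = c • suMatrix θ := by
  rw [suMatrix_eq, suMatrix_eq]
  ext i j
  fin_cases i <;> fin_cases j <;> simp <;> ring

theorem I31_conj_apply (X : Matrix (Fin 4) (Fin 4) ℂ) (i j : Fin 4) :
    (I31 * X * I31) i j =
      (![1, 1, 1, -1] : Fin 4 → ℂ) i * X i j * (![1, 1, 1, -1] : Fin 4 → ℂ) j := by
  rw [I31, mul_diagonal, diagonal_mul]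

theorem suMatrix_mem (θ : Fin 15 → ℝ) : suMatrix θ ∈ su31 := by
  refine ⟨?_, ?_⟩
  · rw [suMatrix_eq, trace, Fin.sum_univ_four]
    simp
    ring
  · ext i j
    rw [I31_conj_apply, suMatrix_eq]
    fin_cases i <;> fin_cases j <;> simp <;> ring

/-- The coordinates of an element of `su(3,1)`. -/
noncomputable def suCoord (X : Matrix (Fin 4) (Fin 4) ℂ) : Fin 15 → ℝ :=
  ![-2 * (X 0 1).im, -2 * (X 0 1).re, (X 1 1).im - (X 0 0).im, -2 * (X 0 2).im, -2 * (X 0 2).re,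
    -- Adding a third of the last diagonal entry cancels the contribution of s₁₅, leaving θ₈/√3.
    -2 * (X 1 2).im, -2 * (X 1 2).re, ((X 2 2).im + (X 3 3).im / 3) * Real.sqrt 3,
    -2 * (X 2 3).re, 2 * (X 2 3).im, 2 * (X 1 3).re, -2 * (X 1 3).im, -2 * (X 0 3).re,
    2 * (X 0 3).im, -(2 / 3) * Real.sqrt 6 * (X 3 3).im]

theorem suCoord_suMatrix (θ : Fin 15 → ℝ) : suCoord (suMatrix θ) = θ := by
  have h3 : Real.sqrt 3 ≠ 0 := by simp
  have h6 : Real.sqrt 6 ≠ 0 := by simp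
  have h33 : Real.sqrt 3 ^ 2 = 3 := Real.sq_sqrt (by norm_num)
  have h66 : Real.sqrt 6 ^ 2 = 6 := Real.sq_sqrt (by norm_num)
  rw [suMatrix_eq]
  simp only [← Complex.ofReal_inv]
  ext i
  fin_cases i <;> simp [suCoord] <;> field_simp <;> ring_nf <;> (try simp only [h33, h66]) <;> ring

theorem suMatrix_suCoord {X : Matrix (Fin 4) (Fin 4) ℂ} (hX : X ∈ su31) :
    suMatrix (suCoord X) = X := by
  have h3 : Real.sqrt 3 ≠ 0 := by simp
  have h6 : Real.sqrt 6 ≠ 0 := by simp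
  have h33 : Real.sqrt 3 ^ 2 = 3 := Real.sq_sqrt (by norm_num)
  have h66 : Real.sqrt 6 ^ 2 = 6 := Real.sq_sqrt (by norm_num)
  obtain ⟨ht, hX⟩ := hX
  have h (i j) : (![1, 1, 1, -1] : Fin 4 → ℂ) i * X i j * (![1, 1, 1, -1] : Fin 4 → ℂ) j =
      -star (X j i) := by
    rw [← I31_conj_apply, hX]
    rfl
  have hre (i j) := congrArg Complex.re (h i j)
  have him (i j) := congrArg Complex.im (h i j)
  rw [trace, Fin.sum_univ_four] at ht
  have htim := congrArg Complex.im ht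
  simp only [Fin.forall_fin_succ] at hre him
  simp at hre him htim
  rw [suMatrix_eq]
  simp only [← Complex.ofReal_inv]
  ext i j
  fin_cases i <;> fin_cases j <;> apply Complex.ext <;> simp [suCoord] <;>
    (try field_simp) <;> (try simp only [h33, h66]) <;> linarith

theorem soMatrix_eq (θ : Fin 15 → ℝ) : soMatrix θ =
    let r2 := Real.sqrt 2
    let r3 := Real.sqrt 3
    let h : ℝ := 1 / 2
    !![quatMk (h * 0) (h * 0) (h * ((r2 * θ 14 - 2 * θ 7) / r3)) (h * 0),
        quatMk (h * θ 6) (h * θ 12) (h * θ 5) (h * θ 13),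
        quatMk (h * θ 4) (h * θ 10) (h * θ 3) (h * θ 11);
      quatMk (h * -θ 6) (h * -θ 12) (h * θ 5) (h * -θ 13),
        quatMk (h * 0) (h * 0) (h * ((r2 * θ 14 + θ 7 - r3 * θ 2) / r3)) (h * 0),
        quatMk (h * θ 1) (h * θ 8) (h * θ 0) (h * θ 9);
      quatMk (h * -θ 4) (h * -θ 10) (h * θ 3) (h * -θ 11),
        quatMk (h * -θ 1) (h * -θ 8) (h * θ 0) (h * -θ 9),
        quatMk (h * 0) (h * 0) (h * ((r2 * θ 14 + θ 7 + r3 * θ 2) / r3)) (h * 0)] := by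
  ext1 i j
  fin_cases i <;> fin_cases j <;> rfl

theorem soMatrix_mem (θ : Fin 15 → ℝ) : soMatrix θ ∈ soStar 3 := by
  refine ⟨?_, ?_⟩
  · simp [soMatrix_eq, trace_fin_three]
  · ext1 i j
    rw [soMatrix_eq]
    change -reversion (_ : ℍ[ℝ]) = _
    fin_cases i <;> fin_cases j <;> apply Quaternion.ext <;>
      simp [reversion_re, reversion_imI, reversion_imJ, reversion_imK]

/-- The coordinates of an element of `so*(6)`. -/
noncomputable def soCoord (A : Matrix (Fin 3) (Fin 3) ℍ[ℝ]) : Fin 15 → ℝ :=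
  ![2 * (A 1 2).imJ, 2 * (A 1 2).re, (A 2 2).imJ - (A 1 1).imJ, 2 * (A 0 2).imJ, 2 * (A 0 2).re,
    2 * (A 0 1).imJ, 2 * (A 0 1).re, ((A 1 1).imJ + (A 2 2).imJ - 2 * (A 0 0).imJ) / Real.sqrt 3,
    2 * (A 1 2).imI, 2 * (A 1 2).imK, 2 * (A 0 2).imI, 2 * (A 0 2).imK, 2 * (A 0 1).imI,
    2 * (A 0 1).imK,
    2 * ((A 0 0).imJ + (A 1 1).imJ + (A 2 2).imJ) / (Real.sqrt 2 * Real.sqrt 3)]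

theorem soCoord_soMatrix (θ : Fin 15 → ℝ) : soCoord (soMatrix θ) = θ := by
  have h2 : Real.sqrt 2 ≠ 0 := by simp
  have h3 : Real.sqrt 3 ≠ 0 := by simp
  have h33 : Real.sqrt 3 ^ 2 = 3 := Real.sq_sqrt (by norm_num)
  ext i
  fin_cases i <;> simp [soCoord, soMatrix_eq] <;> field_simp <;> (try rw [h33]) <;> ring

theorem soMatrix_soCoord {A : Matrix (Fin 3) (Fin 3) ℍ[ℝ]} (hA : A ∈ soStar 3) :
    soMatrix (soCoord A) = A := by
  have h2 : Real.sqrt 2 ≠ 0 := by simp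
  have h3 : Real.sqrt 3 ≠ 0 := by simp
  have h33 : Real.sqrt 3 ^ 2 = 3 := Real.sq_sqrt (by norm_num)
  have h (i j) := congrFun (congrFun hA.2 i) j
  have hre (i j) : -(A j i).re = (A i j).re := congrArg QuaternionAlgebra.re (h i j)
  have hI (i j) : -(A j i).imI = (A i j).imI := congrArg QuaternionAlgebra.imI (h i j)
  have hJ (i j) : - -(A j i).imJ = (A i j).imJ := congrArg QuaternionAlgebra.imJ (h i j)
  have hK (i j) : -(A j i).imK = (A i j).imK := congrArg QuaternionAlgebra.imK (h i j)
  simp only [Fin.forall_fin_succ] at hre hI hJ hK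
  simp at hre hI hJ hK
  ext1 i j
  fin_cases i <;> fin_cases j <;> apply Quaternion.ext <;> simp [soMatrix_eq, soCoord] <;>
    (try field_simp) <;> (try rw [h33]) <;> linarith

theorem complexify_soMatrix (θ : Fin 15 → ℝ) :
    complexify (soMatrix θ) = changeOfBasis * wedgeDer (suMatrix θ) * changeOfBasisᴴ := by
  have h : complexify (soMatrix θ) * changeOfBasis = changeOfBasis * wedgeDer (suMatrix θ) := by
    rw [changeOfBasis_eq, Matrix.mul_smul, Matrix.smul_mul, complexify_soMatrix_mul]
  rw [← h, Matrix.mul_assoc, changeOfBasis_mul_conjTranspose, Matrix.mul_one]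

theorem wedgeDer_add (X Y : Matrix (Fin 4) (Fin 4) ℂ) :
    wedgeDer (X + Y) = wedgeDer X + wedgeDer Y := by
  ext x y
  simp only [wedgeDer, of_apply, Matrix.add_apply]
  ring

theorem wedgeDer_smul (c : ℝ) (X : Matrix (Fin 4) (Fin 4) ℂ) :
    wedgeDer (c • X) = c • wedgeDer X := by
  ext x y
  simp only [wedgeDer, of_apply, Matrix.smul_apply, Complex.real_smul]
  ring

/-- Linearity is inherited from `suMatrix` through the injective map φ. -/
theorem soMatrix_add (θ η : Fin 15 → ℝ) : soMatrix (θ + η) = soMatrix θ + soMatrix η := by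
  apply complexify_injective
  rw [complexify_add, complexify_soMatrix, complexify_soMatrix, complexify_soMatrix, suMatrix_add,
    wedgeDer_add, Matrix.mul_add, Matrix.add_mul]

theorem soMatrix_smul (c : ℝ) (θ : Fin 15 → ℝ) : soMatrix (c • θ) = c • soMatrix θ := by
  apply complexify_injective
  rw [complexify_smul, complexify_soMatrix, complexify_soMatrix, suMatrix_smul,
    wedgeDer_smul, Matrix.mul_smul, Matrix.smul_mul]

/-- The coordinates `θ ↦ ∑ θ_i s_i` on `su(3,1)`. -/
noncomputable def suEquiv : (Fin 15 → ℝ) ≃ₗ[ℝ] su31 where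
  toFun θ := ⟨suMatrix θ, suMatrix_mem θ⟩
  map_add' θ η := Subtype.ext (suMatrix_add θ η)
  map_smul' c θ := Subtype.ext (suMatrix_smul c θ)
  invFun X := suCoord X
  left_inv := suCoord_suMatrix
  right_inv X := Subtype.ext (suMatrix_suCoord X.2)

/-- The coordinates `θ ↦ ∑ θ_i a_i` on `so*(6)`. -/
noncomputable def soEquiv : (Fin 15 → ℝ) ≃ₗ[ℝ] soStar 3 where
  toFun θ := ⟨soMatrix θ, soMatrix_mem θ⟩
  map_add' θ η := Subtype.ext (soMatrix_add θ η)
  map_smul' c θ := Subtype.ext (soMatrix_smul c θ)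
  invFun A := soCoord A
  left_inv := soCoord_soMatrix
  right_inv A := Subtype.ext (soMatrix_soCoord A.2)

theorem coe_suEquiv (θ : Fin 15 → ℝ) : (suEquiv θ : Matrix (Fin 4) (Fin 4) ℂ) = suMatrix θ := rfl

theorem coe_soEquiv (θ : Fin 15 → ℝ) : (soEquiv θ : Matrix (Fin 3) (Fin 3) ℍ[ℝ]) = soMatrix θ :=
  rfl

/-- The basis `s₁, …, s₁₅` of `su(3,1)`. -/
noncomputable def suBasis : Module.Basis (Fin 15) ℝ su31 := Module.Basis.ofEquivFun suEquiv.symm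

/-- The basis `a₁, …, a₁₅` of `so*(6)`. -/
noncomputable def soBasis : Module.Basis (Fin 15) ℝ (soStar 3) :=
  Module.Basis.ofEquivFun soEquiv.symm

theorem sum_smul_suBasis (θ : Fin 15 → ℝ) : ∑ i, θ i • suBasis i = suEquiv θ := by
  rw [← Module.Basis.equivFun_symm_apply, suBasis, Module.Basis.equivFun_ofEquivFun,
    LinearEquiv.symm_symm]

theorem sum_smul_soBasis (θ : Fin 15 → ℝ) : ∑ i, θ i • soBasis i = soEquiv θ := by
  rw [← Module.Basis.equivFun_symm_apply, soBasis, Module.Basis.equivFun_ofEquivFun,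
    LinearEquiv.symm_symm]

/-- The linear isomorphism `s_i ↦ a_i`. -/
noncomputable def lieEquivLinear : su31 ≃ₗ[ℝ] soStar 3 := suEquiv.symm ≪≫ₗ soEquiv

theorem complexify_lieEquivLinear (X : su31) :
    complexify (lieEquivLinear X : Matrix (Fin 3) (Fin 3) ℍ[ℝ]) =
      changeOfBasis * wedgeDer X * changeOfBasisᴴ := by
  rw [lieEquivLinear, LinearEquiv.trans_apply, coe_soEquiv, complexify_soMatrix, ← coe_suEquiv,
    LinearEquiv.apply_symm_apply]

/-- The isomorphism of Lie algebras `su(3,1) ≅ so*(6)`. -/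
noncomputable def lieEquiv : su31 ≃ₗ⁅ℝ⁆ soStar 3 where
  __ := lieEquivLinear
  map_lie' := by
    intro X Y
    change lieEquivLinear ⁅X, Y⁆ = ⁅lieEquivLinear X, lieEquivLinear Y⁆
    apply Subtype.ext
    apply complexify_injective
    have hsub (A B : Matrix (Fin 3) (Fin 3) ℍ[ℝ]) :
        complexify (A * B - B * A) =
          complexify A * complexify B - complexify B * complexify A := by
      have h := map_sub (complexifyHom 3) (A * B) (B * A)
      rwa [map_mul, map_mul] at h
    rw [complexify_lieEquivLinear, LieSubalgebra.coe_bracket, LieSubalgebra.coe_bracket,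
      wedgeDer_lie, Ring.lie_def, Ring.lie_def, hsub, complexify_lieEquivLinear,
      complexify_lieEquivLinear, conj_changeOfBasis_mul, conj_changeOfBasis_mul, Matrix.mul_sub,
      Matrix.sub_mul]

theorem complexify_lieEquiv (X : su31) :
    complexify (lieEquiv X : Matrix (Fin 3) (Fin 3) ℍ[ℝ]) =
      changeOfBasis * wedgeDer X * changeOfBasisᴴ :=
  complexify_lieEquivLinear X

theorem suBasis_apply (i : Fin 15) : suBasis i = suEquiv (Pi.single i 1) := by
  rw [suBasis, Module.Basis.coe_ofEquivFun, LinearEquiv.symm_symm]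

theorem soBasis_apply (i : Fin 15) : soBasis i = soEquiv (Pi.single i 1) := by
  rw [soBasis, Module.Basis.coe_ofEquivFun, LinearEquiv.symm_symm]

theorem lieEquiv_suBasis (i : Fin 15) : lieEquiv (suBasis i) = soBasis i := by
  change soEquiv (suEquiv.symm (suBasis i)) = soBasis i
  rw [suBasis_apply, soBasis_apply, LinearEquiv.symm_apply_apply]

theorem soBasis_repr_lieEquiv (X : su31) (k : Fin 15) :
    soBasis.repr (lieEquiv X) k = suBasis.repr X k := by
  change soEquiv.symm (soEquiv (suEquiv.symm X)) k = suEquiv.symm X k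
  rw [LinearEquiv.symm_apply_apply]

/-- A Lie algebra isomorphism matching the bases matches the structure constants. -/
theorem repr_lie_eq (i j k : Fin 15) :
    suBasis.repr ⁅suBasis i, suBasis j⁆ k = soBasis.repr ⁅soBasis i, soBasis j⁆ k := by
  rw [← lieEquiv_suBasis, ← lieEquiv_suBasis, ← LieEquiv.map_lie, soBasis_repr_lieEquiv]

set_option maxHeartbeats 2000000 in
-- Both sides are compared for general coordinates; unit coordinates then give each generator.
theorem sum_smul_soComplexGen (θ : Fin 15 → ℝ) :
    ∑ i, (θ i : ℂ) • soComplexGen i = wedgeDer (suMatrix θ) := by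
  have h : ∀ v : Fin 15 → Matrix WedgeIdx WedgeIdx ℂ, ∑ i, (θ i : ℂ) • v i =
      (θ 0 : ℂ) • v 0 + ((θ 1 : ℂ) • v 1 + ((θ 2 : ℂ) • v 2 + ((θ 3 : ℂ) • v 3 +
      ((θ 4 : ℂ) • v 4 + ((θ 5 : ℂ) • v 5 + ((θ 6 : ℂ) • v 6 + ((θ 7 : ℂ) • v 7 +
      ((θ 8 : ℂ) • v 8 + ((θ 9 : ℂ) • v 9 + ((θ 10 : ℂ) • v 10 + ((θ 11 : ℂ) • v 11 +
      ((θ 12 : ℂ) • v 12 + ((θ 13 : ℂ) • v 13 + (θ 14 : ℂ) • v 14))))))))))))) := by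
    intro v
    simp only [Fin.sum_univ_succ, Finset.univ_unique, Finset.sum_singleton]
    rfl
  have h2 : (starRingEnd ℂ) 2 = 2 := map_ofNat _ 2
  rw [suMatrix_eq, h]
  ext x y
  rcases x with x | x <;> rcases y with y | y <;> fin_cases x <;> fin_cases y <;>
    simp [wedgeDer, wedgePair, soComplexGen, gellMann, conjMat, h2, Matrix.one_apply] <;> ring

theorem wedgeDer_suMatrix_single (i : Fin 15) :
    wedgeDer (suMatrix (Pi.single i 1)) = soComplexGen i := by
  rw [← sum_smul_soComplexGen, Finset.sum_eq_single i]
  · simp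
  · intro j _ hj
    simp [hj]
  · simp

theorem conj_complexify_soBasis (i : Fin 15) :
    changeOfBasisᴴ * complexify (soBasis i : Matrix (Fin 3) (Fin 3) ℍ[ℝ]) * changeOfBasis =
      soComplexGen i := by
  rw [soBasis_apply, coe_soEquiv, complexify_soMatrix, conjTranspose_changeOfBasis_conj,
    wedgeDer_suMatrix_single]

/-! ### The covering homomorphism -/

theorem mem_SU31 {S : SpecialLinearGroup (Fin 4) ℂ} : S ∈ SU31 ↔ S.1ᴴ * I31 * S.1 = I31 :=
  Iff.rfl

theorem neg_mem_SU31 {S : SpecialLinearGroup (Fin 4) ℂ} (hS : S ∈ SU31) : -S ∈ SU31 := by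
  rw [mem_SU31, SpecialLinearGroup.coe_neg, conjTranspose_neg, Matrix.neg_mul, Matrix.neg_mul,
    Matrix.mul_neg, neg_neg]
  exact hS

theorem complexify_decomplexify_wedgeRot {S : SpecialLinearGroup (Fin 4) ℂ} (hS : S ∈ SU31) :
    complexify (decomplexify (wedgeRot S.1)) = wedgeRot S.1 :=
  complexify_decomplexify (wedgeRot_mul_quatStr S.2 hS)

theorem mem_SOStar_iff {A : (Matrix (Fin 3) (Fin 3) ℍ[ℝ])ˣ} :
    A ∈ SOStar 3 ↔ (complexify A.1).det = 1 ∧ (complexify A.1)ᵀ * complexify A.1 = 1 := by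
  refine and_congr_right fun _ => ?_
  rw [← complexify_injective.eq_iff, complexify_mul, complexify_revTranspose, complexify_one]

/-- The homomorphism `SU(3,1) → SO*(6)`. -/
noncomputable def covering : SU31 →* SOStar 3 where
  toFun S := ⟨⟨decomplexify (wedgeRot S.1.1), decomplexify (wedgeRot (S⁻¹).1.1),
      complexify_injective (by
        rw [complexify_mul, complexify_decomplexify_wedgeRot S.2,
          complexify_decomplexify_wedgeRot (S⁻¹).2, ← wedgeRot_mul, Subgroup.coe_inv,
          coe_mul_coe_inv, wedgeRot_one, complexify_one]),
      complexify_injective (by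
        rw [complexify_mul, complexify_decomplexify_wedgeRot S.2,
          complexify_decomplexify_wedgeRot (S⁻¹).2, ← wedgeRot_mul, Subgroup.coe_inv,
          coe_inv_mul_coe, wedgeRot_one, complexify_one])⟩, mem_SOStar_iff.mpr (by
        rw [complexify_decomplexify_wedgeRot S.2]
        exact ⟨by rw [det_wedgeRot, S.1.2, one_pow], wedgeRot_transpose_mul S.1.1 S.1.2⟩)⟩
  map_one' := Subtype.ext (Units.ext (complexify_injective (by
    rw [complexify_decomplexify_wedgeRot (1 : SU31).2]
    exact wedgeRot_one.trans complexify_one.symm)))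
  map_mul' S T := Subtype.ext (Units.ext (complexify_injective (by
    rw [complexify_decomplexify_wedgeRot (S * T).2]
    refine (wedgeRot_mul _ _).trans (Eq.trans ?_ (complexify_mul _ _).symm)
    exact congrArg₂ _ (complexify_decomplexify_wedgeRot S.2).symm
      (complexify_decomplexify_wedgeRot T.2).symm)))

theorem coe_covering (S : SU31) :
    ((covering S : (Matrix (Fin 3) (Fin 3) ℍ[ℝ])ˣ) : Matrix (Fin 3) (Fin 3) ℍ[ℝ]) =
      decomplexify (wedgeRot S.1.1) := rfl

theorem complexify_covering (S : SU31) :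
    complexify ((covering S : (Matrix (Fin 3) (Fin 3) ℍ[ℝ])ˣ) : Matrix (Fin 3) (Fin 3) ℍ[ℝ]) =
      wedgeRot S.1.1 :=
  complexify_decomplexify_wedgeRot S.2

theorem covering_eq_iff_wedgeRot {S T : SU31} :
    covering S = covering T ↔ wedgeRot S.1.1 = wedgeRot T.1.1 := by
  rw [← complexify_covering, ← complexify_covering, complexify_injective.eq_iff, ← Units.ext_iff,
    ← Subtype.ext_iff]

instance : Neg SU31 := ⟨fun S => ⟨-S.1, neg_mem_SU31 S.2⟩⟩

theorem SU31.coe_neg (S : SU31) : ((-S : SU31) : SpecialLinearGroup (Fin 4) ℂ) = -S.1 := rfl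

theorem covering_eq_iff {S T : SU31} : covering S = covering T ↔ S = T ∨ S = -T := by
  rw [covering_eq_iff_wedgeRot]
  refine ⟨fun h => ?_, ?_⟩
  · rcases eq_or_eq_neg_of_wedgeRot_eq h with h | h
    · exact Or.inl (Subtype.ext h)
    · exact Or.inr (Subtype.ext h)
  · rintro (rfl | rfl)
    · rfl
    · rw [SU31.coe_neg, SpecialLinearGroup.coe_neg, wedgeRot_neg]

theorem SU31.neg_ne_self (S : SU31) : -S ≠ S := by
  intro h
  have h1 : -S.1.1 = S.1.1 := congrArg (fun T : SU31 => T.1.1) h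
  have h2 : S.1.1 = 0 := by
    ext i j
    have := congrFun (congrFun h1 i) j
    exact self_eq_neg.mp this.symm
  have h3 := S.1.2
  rw [h2, det_zero] at h3
  exact zero_ne_one h3

theorem covering_eq_one_iff (S : SU31) : covering S = 1 ↔ S.1.1 = 1 ∨ S.1.1 = -1 := by
  rw [← map_one covering, covering_eq_iff]
  exact or_congr (Subtype.ext_iff.trans Subtype.ext_iff) (Subtype.ext_iff.trans Subtype.ext_iff)

theorem I31_mul_self : I31 * I31 = 1 := by
  ext i j
  fin_cases i <;> fin_cases j <;> simp [I31]

/-- `I31` and `-I31` are not congruent. -/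
theorem conjTranspose_mul_I31_mul_ne_neg (S : Matrix (Fin 4) (Fin 4) ℂ) :
    Sᴴ * I31 * S ≠ -I31 := by
  intro h
  have key (v : Fin 4 → ℂ) : star (S *ᵥ v) ⬝ᵥ (I31 *ᵥ (S *ᵥ v)) = -(star v ⬝ᵥ (I31 *ᵥ v)) := by
    rw [← dotProduct_neg, ← neg_mulVec, ← h, star_mulVec, ← dotProduct_mulVec, mulVec_mulVec,
      mulVec_mulVec, Matrix.mul_assoc]
  have hI (v : Fin 4 → ℂ) : (star v ⬝ᵥ (I31 *ᵥ v)).re =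
      Complex.normSq (v 0) + Complex.normSq (v 1) + Complex.normSq (v 2)
        - Complex.normSq (v 3) := by
    simp [I31, dotProduct, Fin.sum_univ_four, mulVec_diagonal, Complex.normSq_apply]
    ring
  -- Two linear conditions on the three-dimensional space v₃ = 0, (Sv)₃ = 0 seen in its first two
  -- coordinates, leave a nonzero v. The form is then positive at v and nonnegative at Sv, whereas
  -- the hypothesis makes these values opposite.
  obtain ⟨v, hv3, hv, hne⟩ : ∃ v : Fin 4 → ℂ, v 3 = 0 ∧ (S *ᵥ v) 3 = 0 ∧
      0 < Complex.normSq (v 0) + Complex.normSq (v 1) + Complex.normSq (v 2) := by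
    by_cases h0 : S 3 0 = 0
    · exact ⟨![1, 0, 0, 0], rfl, by simp [mulVec, dotProduct, Fin.sum_univ_four, h0], by simp⟩
    · refine ⟨![-S 3 1, S 3 0, 0, 0], rfl, by simp [mulVec, dotProduct, Fin.sum_univ_four]; ring,
        ?_⟩
      have := Complex.normSq_pos.mpr h0
      have := Complex.normSq_nonneg (S 3 1)
      simp
      linarith
  have h1 := congrArg Complex.re (key v)
  rw [Complex.neg_re, hI, hI, hv, hv3, Complex.normSq_zero] at h1
  have := Complex.normSq_nonneg ((S *ᵥ v) 0)
  have := Complex.normSq_nonneg ((S *ᵥ v) 1)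
  have := Complex.normSq_nonneg ((S *ᵥ v) 2)
  linarith

/-- The matrix T = I S⁻† I satisfies S† I T = I. Since the rotation of S is quaternionic,
`wedgeRot_mul_quatStr` forces S and T to have the same rotation, so T = ±S. T = S says that S is
pseudounitary, and T = -S would make I and -I congruent. -/
theorem mem_SU31_of_wedgeRot_eq_complexify {S : SpecialLinearGroup (Fin 4) ℂ}
    {A : Matrix (Fin 3) (Fin 3) ℍ[ℝ]} (h : wedgeRot S.1 = complexify A) : S ∈ SU31 := by
  set V : Matrix (Fin 4) (Fin 4) ℂ := (S⁻¹).1ᴴ with hV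
  have hSV : S.1ᴴ * V = 1 := by
    rw [hV, ← conjTranspose_mul, coe_inv_mul_coe, conjTranspose_one]
  have hT : S.1ᴴ * I31 * (I31 * V * I31) = I31 := by
    calc S.1ᴴ * I31 * (I31 * V * I31) = S.1ᴴ * (I31 * I31) * V * I31 := by
          simp only [Matrix.mul_assoc]
      _ = I31 := by rw [I31_mul_self, Matrix.mul_one, hSV, Matrix.one_mul]
  have hdetV : V.det = 1 := by
    rw [hV, det_conjTranspose, (S⁻¹).2, star_one]
  have hdet : (I31 * V * I31).det = 1 := by
    have h1 := congrArg det I31_mul_self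
    rw [det_mul, det_one] at h1
    rw [det_mul, det_mul, hdetV, mul_one, h1]
  have hQ := wedgeRot_mul_quatStr S.2 hT
  have hA := quatStr_mul_conj_complexify A
  rw [← h, ← hQ] at hA
  have hR : wedgeRot S.1 = wedgeRot (I31 * V * I31) := by
    have h2 := congrArg (· * quatStr) hA
    simpa only [Matrix.mul_assoc, quatStr_mul_self, Matrix.mul_one] using h2
  rcases eq_or_eq_neg_of_wedgeRot_eq (T := ⟨I31 * V * I31, hdet⟩) hR with h3 | h3
  · rw [mem_SU31]
    have h4 : I31 * V * I31 = S.1 := (congrArg Subtype.val h3).symm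
    rwa [h4] at hT
  · exfalso
    have h4 : I31 * V * I31 = -S.1 :=
      neg_eq_iff_eq_neg.mp (congrArg Subtype.val h3).symm
    rw [h4, Matrix.mul_neg] at hT
    exact conjTranspose_mul_I31_mul_ne_neg S.1 (neg_eq_iff_eq_neg.mp hT)

theorem covering_surjective : Function.Surjective covering := by
  intro A
  obtain ⟨hdet, hort⟩ := mem_SOStar_iff.mp A.2
  obtain ⟨S, -, -, -, hS⟩ := hasSpinLift_of_orthogonal hort hdet
  refine ⟨⟨S, mem_SU31_of_wedgeRot_eq_complexify hS⟩, ?_⟩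
  apply Subtype.ext
  apply Units.ext
  apply complexify_injective
  rw [complexify_covering, hS]

theorem ncard_fibre_covering (A : SOStar 3) : (covering ⁻¹' {A}).ncard = 2 := by
  obtain ⟨S, rfl⟩ := covering_surjective A
  have h : covering ⁻¹' {covering S} = {S, -S} := by
    ext T
    exact covering_eq_iff
  rw [h, Set.ncard_pair (SU31.neg_ne_self S).symm]

/-- The element `exp X` of `SU(3,1)`. -/
noncomputable def suExp (X : su31) : SU31 :=
  ⟨⟨NormedSpace.exp X.1, det_exp_of_trace_eq_zero X.2.1⟩, exp_mem_unitary X.2.2⟩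

theorem coe_suExp (X : su31) : (suExp X).1.1 = NormedSpace.exp X.1 := rfl

theorem covering_suExp (X : su31) :
    ((covering (suExp X) : (Matrix (Fin 3) (Fin 3) ℍ[ℝ])ˣ) : Matrix (Fin 3) (Fin 3) ℍ[ℝ]) =
      NormedSpace.exp (lieEquiv X : Matrix (Fin 3) (Fin 3) ℍ[ℝ]) := by
  have h : complexify (lieEquiv X : Matrix (Fin 3) (Fin 3) ℍ[ℝ]) * changeOfBasis =
      changeOfBasis * wedgeDer X := by
    rw [complexify_lieEquiv, Matrix.mul_assoc, changeOfBasis_conjTranspose_mul, Matrix.mul_one]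
  rw [coe_covering, coe_suExp, exp_eq_decomplexify, wedgeRot, wedgeSq_exp,
    ← exp_mul_of_intertwine h, Matrix.mul_assoc, changeOfBasis_mul_conjTranspose, Matrix.mul_one]

/-! ### Topology of the groups -/

theorem continuous_wedgeSq : Continuous wedgeSq := by
  refine continuous_matrix fun x y => ?_
  simp only [wedgeSq, of_apply]
  fun_prop

theorem continuous_wedgeRot : Continuous wedgeRot := by
  unfold wedgeRot
  have := continuous_wedgeSq
  fun_prop

theorem continuous_coe_SU31 : Continuous fun S : SU31 => S.1.1 :=
  continuous_subtype_val.comp continuous_subtype_val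

theorem continuous_covering : Continuous covering := by
  refine Continuous.subtype_mk (Units.continuous_iff.mpr ⟨?_, ?_⟩) _
  · exact continuous_decomplexify.comp (continuous_wedgeRot.comp continuous_coe_SU31)
  · exact continuous_decomplexify.comp (continuous_wedgeRot.comp
      (continuous_coe_SU31.comp continuous_inv))

theorem isClosedEmbedding_coe_SU31 : Topology.IsClosedEmbedding fun S : SU31 => S.1.1 := by
  refine ⟨Topology.IsEmbedding.subtypeVal.comp Topology.IsEmbedding.subtypeVal, ?_⟩
  have h : Set.range (fun S : SU31 => S.1.1) = {M | M.det = 1 ∧ Mᴴ * I31 * M = I31} := by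
    ext M
    exact ⟨by rintro ⟨S, rfl⟩; exact ⟨S.1.2, S.2⟩, fun h => ⟨⟨⟨M, h.1⟩, h.2⟩, rfl⟩⟩
  rw [h]
  exact (isClosed_eq (by fun_prop) (by fun_prop)).inter (isClosed_eq (by fun_prop) (by fun_prop))

instance : SigmaCompactSpace SU31 :=
  haveI : SigmaCompactSpace (Matrix (Fin 4) (Fin 4) ℂ) :=
    inferInstanceAs (SigmaCompactSpace (Fin 4 → Fin 4 → ℂ))
  isClosedEmbedding_coe_SU31.sigmaCompactSpace

theorem continuous_reversion : Continuous reversion :=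
  continuous_quatMk Quaternion.continuous_re Quaternion.continuous_imI
    Quaternion.continuous_imJ.neg Quaternion.continuous_imK

theorem continuous_revTranspose {n : ℕ} :
    Continuous (revTranspose : Matrix (Fin n) (Fin n) ℍ[ℝ] → _) :=
  continuous_id.matrix_transpose.matrix_map continuous_reversion

theorem continuous_complexify {n : ℕ} :
    Continuous (complexify : Matrix (Fin n) (Fin n) ℍ[ℝ] → _) := by
  have h1 := Quaternion.continuous_re
  have h2 := Quaternion.continuous_imI
  have h3 := Quaternion.continuous_imJ
  have h4 := Quaternion.continuous_imK
  refine continuous_matrix fun p q => ?_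
  have hA : Continuous fun A : Matrix (Fin n) (Fin n) ℍ[ℝ] => A p.1 q.1 :=
    continuous_id.matrix_elem _ _
  obtain ⟨i, a⟩ := p
  obtain ⟨j, b⟩ := q
  simp only [complexify, of_apply, quatToMat]
  fin_cases a <;> fin_cases b <;> simp <;> fun_prop

theorem mul_revTranspose_of_revTranspose_mul {A : Matrix (Fin 3) (Fin 3) ℍ[ℝ]}
    (h : revTranspose A * A = 1) : A * revTranspose A = 1 := by
  apply complexify_injective
  have h1 := congrArg complexify h
  rw [complexify_mul, complexify_one] at h1 ⊢
  exact mul_eq_one_comm.mp h1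

/-- The topology of the unit group also involves inverses; here the inverse is the
reversion-transpose, which is continuous in the matrix, so the matrix topology is the same. -/
theorem isClosedEmbedding_coe_SOStar :
    Topology.IsClosedEmbedding fun A : SOStar 3 => (A.1 : Matrix (Fin 3) (Fin 3) ℍ[ℝ]) := by
  have hcont : Continuous fun A : SOStar 3 => (A.1 : Matrix (Fin 3) (Fin 3) ℍ[ℝ]) :=
    Units.continuous_val.comp continuous_subtype_val
  set Y : Set (Matrix (Fin 3) (Fin 3) ℍ[ℝ]) :=
    {M | (complexify M).det = 1 ∧ revTranspose M * M = 1} with hY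
  have hc := continuous_revTranspose (n := 3)
  have hc' := continuous_complexify (n := 3)
  have hclosed : IsClosed Y :=
    (isClosed_eq (by fun_prop) (by fun_prop)).inter (isClosed_eq (by fun_prop) (by fun_prop))
  let e : SOStar 3 ≃ₜ Y :=
    { toFun A := ⟨A.1, A.2⟩
      invFun M := ⟨⟨M.1, revTranspose M.1, mul_revTranspose_of_revTranspose_mul M.2.2, M.2.2⟩, M.2⟩
      left_inv A := Subtype.ext (Units.ext rfl)
      right_inv M := rfl
      continuous_toFun := hcont.subtype_mk _
      continuous_invFun := Continuous.subtype_mk (Units.continuous_iff.mpr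
        ⟨continuous_subtype_val, hc.comp continuous_subtype_val⟩) _ }
  exact hclosed.isClosedEmbedding_subtypeVal.comp e.isClosedEmbedding

instance : LocallyCompactSpace (SOStar 3) :=
  haveI : ProperSpace ℍ[ℝ] := FiniteDimensional.proper ℝ ℍ[ℝ]
  haveI : LocallyCompactSpace (Matrix (Fin 3) (Fin 3) ℍ[ℝ]) :=
    inferInstanceAs (LocallyCompactSpace (Fin 3 → Fin 3 → ℍ[ℝ]))
  isClosedEmbedding_coe_SOStar.locallyCompactSpace

instance : T2Space (SOStar 3) :=
  haveI : T2Space (Matrix (Fin 3) (Fin 3) ℍ[ℝ]) :=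
    inferInstanceAs (T2Space (Fin 3 → Fin 3 → ℍ[ℝ]))
  isClosedEmbedding_coe_SOStar.isEmbedding.t2Space

/-- The open mapping theorem: a continuous surjective homomorphism from a σ-compact group onto a
locally compact Hausdorff group is open. -/
theorem isOpenMap_covering : IsOpenMap covering :=
  MonoidHom.isOpenMap_of_sigmaCompact covering covering_surjective continuous_covering

theorem isOpenQuotientMap_covering : IsOpenQuotientMap covering :=
  ⟨covering_surjective, continuous_covering, isOpenMap_covering⟩

/-- A quotient map of groups whose kernel is finite, hence discrete, is a covering. -/
theorem isCoveringMap_covering : IsCoveringMap covering := by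
  have hfin : (covering.ker : Set SU31).Finite := by
    have h : (covering.ker : Set SU31) = covering ⁻¹' {1} := rfl
    rw [h]
    exact Set.finite_of_ncard_ne_zero (by rw [ncard_fibre_covering]; norm_num)
  exact (Topology.IsQuotientMap.isQuotientCoveringMap_of_isDiscrete_ker_monoidHom
    isOpenQuotientMap_covering.isQuotientMap hfin.isDiscrete).isCoveringMap

theorem nonempty_quotient_ker_covering : Nonempty ((SU31 ⧸ covering.ker) ≃ₜ* SOStar 3) := by
  let e := QuotientGroup.quotientKerEquivOfSurjective covering covering_surjective
  have he : ∀ S : SU31, e (QuotientGroup.mk S) = covering S := fun _ => rfl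
  refine ⟨{ e with continuous_toFun := ?_, continuous_invFun := ?_ }⟩
  · exact (QuotientGroup.isQuotientMap_mk _).continuous_iff.mpr continuous_covering
  · refine isOpenQuotientMap_covering.isQuotientMap.continuous_iff.mpr ?_
    have h : e.symm ∘ covering = QuotientGroup.mk := by
      ext1 S
      exact e.symm_apply_eq.mpr (he S).symm
    change Continuous (e.symm ∘ covering)
    rw [h]
    exact QuotientGroup.continuous_mk

/-! ### The centers -/

/-- The element of `SU(3,1)` given by a pseudounitary matrix of determinant one. -/
def suMk (M : Matrix (Fin 4) (Fin 4) ℂ) (h : M.det = 1) (h' : Mᴴ * I31 * M = I31) : SU31 :=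
  ⟨⟨M, h⟩, h'⟩

/-- Commutation is required only with squares, because lifts of commuting elements of SO*(6) commute
only up to sign and their squares lose the sign. -/
theorem eq_smul_one_of_commute_sq {S : Matrix (Fin 4) (Fin 4) ℂ}
    (hS : ∀ T : SU31, S * (T.1.1 * T.1.1) = T.1.1 * T.1.1 * S) : S = S 0 0 • 1 := by
  have hI : Complex.I * Complex.I = -1 := Complex.I_mul_I
  have key (M : Matrix (Fin 4) (Fin 4) ℂ) (h : M.det = 1) (h' : Mᴴ * I31 * M = I31) :
      S * (M * M) = M * M * S := hS (suMk M h h')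
  -- The squares diag(1,1,-1,-1) and diag(1,-1,1,-1) have four distinct joint eigenvalues and force
  -- S to be diagonal. Two rational rotations (3, 4, 5) and a rational boost (5² - 4² = 3²) then
  -- equate neighbouring diagonal entries.
  have d1 := key (diagonal ![1, 1, Complex.I, -Complex.I])
    (by simp [det_diagonal, Fin.prod_univ_four])
    (by ext i j; fin_cases i <;> fin_cases j <;> simp [I31])
  have d2 := key (diagonal ![1, Complex.I, 1, -Complex.I])
    (by simp [det_diagonal, Fin.prod_univ_four])
    (by ext i j; fin_cases i <;> fin_cases j <;> simp [I31])
  have r1 := key !![3 / 5, -4 / 5, 0, 0; 4 / 5, 3 / 5, 0, 0; 0, 0, 1, 0; 0, 0, 0, 1]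
    (by rw [det_fin_four]; simp; norm_num)
    (by
      ext i j
      fin_cases i <;> fin_cases j <;>
        simp [I31, Matrix.mul_apply, Fin.sum_univ_four, map_ofNat] <;> norm_num)
  have r2 := key !![1, 0, 0, 0; 0, 3 / 5, -4 / 5, 0; 0, 4 / 5, 3 / 5, 0; 0, 0, 0, 1]
    (by rw [det_fin_four]; simp; norm_num)
    (by
      ext i j
      fin_cases i <;> fin_cases j <;>
        simp [I31, Matrix.mul_apply, Fin.sum_univ_four, map_ofNat] <;> norm_num)
  have r3 := key !![1, 0, 0, 0; 0, 1, 0, 0; 0, 0, 5 / 3, 4 / 3; 0, 0, 4 / 3, 5 / 3]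
    (by rw [det_fin_four]; simp; norm_num)
    (by
      ext i j
      fin_cases i <;> fin_cases j <;>
        simp [I31, Matrix.mul_apply, Fin.sum_univ_four, map_ofNat] <;> norm_num)
  rw [diagonal_mul_diagonal] at d1 d2
  have e1 (i j) := congrFun (congrFun d1 i) j
  have e2 (i j) := congrFun (congrFun d2 i) j
  simp only [mul_diagonal, diagonal_mul] at e1 e2
  have hoff : ∀ i j, i ≠ j → S i j = 0 := by
    intro i j hij
    have h1 := e1 i j
    have h2 := e2 i j
    fin_cases i <;> fin_cases j <;> simp at h1 h2 hij ⊢ <;> grind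
  have s1 := congrFun (congrFun r1 0) 1
  have s2 := congrFun (congrFun r2 1) 2
  have s3 := congrFun (congrFun r3 2) 3
  simp [Matrix.mul_apply, Fin.sum_univ_four, hoff] at s1 s2 s3
  -- The squared rotations have off-diagonal entries ±24/25, and the squared boost has 40/9.
  have h01 : S 1 1 = S 0 0 := by linear_combination (25 / 24) * s1
  have h12 : S 2 2 = S 1 1 := by linear_combination (25 / 24) * s2
  have h23 : S 3 3 = S 2 2 := by linear_combination -(9 / 40) * s3
  ext i j
  by_cases hij : i = j
  · subst hij
    fin_cases i <;> simp [h01, h12, h23]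
  · simp [hij, hoff]

theorem pow_four_of_det_smul_one {z : ℂ} (h : (z • (1 : Matrix (Fin 4) (Fin 4) ℂ)).det = 1) :
    z ^ 4 = 1 := by
  simpa using h

/-- The scalar matrix `z` in `SU(3,1)`, for a fourth root of unity `z`. -/
noncomputable def suScalar (z : ℂ) (hz : z ^ 4 = 1) : SU31 :=
  suMk (z • 1) (by simpa using hz) (by
    have h1 : star z * z = 1 := by
      have h := Complex.norm_eq_one_of_pow_eq_one hz (by norm_num)
      rw [Complex.star_def, Complex.conj_mul', h]
      norm_num
    rw [conjTranspose_smul, conjTranspose_one, Matrix.smul_mul, Matrix.smul_mul, Matrix.mul_smul,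
      Matrix.one_mul, Matrix.mul_one, smul_smul, h1, one_smul])

theorem SU31.ext {S T : SU31} (h : S.1.1 = T.1.1) : S = T := Subtype.ext (Subtype.ext h)

theorem SU31.coe_mul (S T : SU31) : (S * T).1.1 = S.1.1 * T.1.1 := rfl

theorem exists_scalar_of_commute_sq {S : SU31} (hS : ∀ T : SU31, S * (T * T) = T * T * S) :
    ∃ z : ℂ, z ^ 4 = 1 ∧ S.1.1 = z • 1 := by
  have h := eq_smul_one_of_commute_sq fun T => congrArg (fun R : SU31 => R.1.1) (hS T)
  have hdet := S.1.2
  rw [h] at hdet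
  exact ⟨_, pow_four_of_det_smul_one hdet, h⟩

theorem mem_center_SU31_iff (S : SU31) :
    S ∈ Subgroup.center SU31 ↔ ∃ z : ℂ, z ^ 4 = 1 ∧ S.1.1 = z • 1 := by
  rw [Subgroup.mem_center_iff]
  refine ⟨fun h => exists_scalar_of_commute_sq fun T => (h (T * T)).symm, ?_⟩
  rintro ⟨z, -, hz⟩ T
  apply SU31.ext
  rw [SU31.coe_mul, SU31.coe_mul, hz, Matrix.mul_smul, Matrix.smul_mul, Matrix.mul_one,
    Matrix.one_mul]

/-- The scalar matrices as a homomorphism from the fourth roots of unity to the center. -/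
noncomputable def centerHom : rootsOfUnity 4 ℂ →* Subgroup.center SU31 where
  toFun ζ := ⟨suScalar (ζ : ℂˣ) ((mem_rootsOfUnity' _ _).mp ζ.2),
    (mem_center_SU31_iff _).mpr ⟨_, (mem_rootsOfUnity' _ _).mp ζ.2, rfl⟩⟩
  map_one' := Subtype.ext (SU31.ext (one_smul _ _))
  map_mul' ζ ξ := Subtype.ext (SU31.ext (by
    change ((ζ : ℂˣ) * (ξ : ℂˣ) : ℂ) • (1 : Matrix (Fin 4) (Fin 4) ℂ) =
      ((ζ : ℂˣ) : ℂ) • 1 * ((ξ : ℂˣ) : ℂ) • 1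
    rw [Matrix.smul_mul, Matrix.one_mul, smul_smul]))

theorem centerHom_bijective : Function.Bijective centerHom := by
  refine ⟨fun ζ ξ h => ?_, fun S => ?_⟩
  · have h1 : ((ζ : ℂˣ) : ℂ) • (1 : Matrix (Fin 4) (Fin 4) ℂ) = ((ξ : ℂˣ) : ℂ) • 1 :=
      congrArg (fun R : Subgroup.center SU31 => R.1.1.1) h
    have h2 := congrFun (congrFun h1 0) 0
    simp only [Matrix.smul_apply, one_apply_eq, smul_eq_mul, mul_one] at h2
    exact Subtype.ext (Units.ext h2)
  · obtain ⟨z, hz, hS⟩ := (mem_center_SU31_iff _).mp S.2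
    exact ⟨rootsOfUnity.mkOfPowEq z hz, Subtype.ext (SU31.ext hS.symm)⟩

theorem nonempty_center_SU31_equiv :
    Nonempty (Subgroup.center SU31 ≃* Multiplicative (ZMod 4)) := by
  have hcard : Nat.card (rootsOfUnity 4 ℂ) = Nat.card (Multiplicative (ZMod 4)) := by
    rw [Complex.card_rootsOfUnity, Nat.card_congr Multiplicative.toAdd,
      Nat.card_zmod]
  exact ⟨(MulEquiv.ofBijective centerHom centerHom_bijective).symm.trans
    (mulEquivOfCyclicCardEq hcard)⟩

theorem complexify_covering_of_coe_eq {S : SU31} {z : ℂ} (hS : S.1.1 = z • 1) :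
    complexify ((covering S : (Matrix (Fin 3) (Fin 3) ℍ[ℝ])ˣ) : Matrix (Fin 3) (Fin 3) ℍ[ℝ]) =
      z ^ 2 • 1 := by
  rw [complexify_covering, hS, wedgeRot_smul, wedgeRot_one]

theorem complexify_neg_one {n : ℕ} :
    complexify (-1 : Matrix (Fin n) (Fin n) ℍ[ℝ]) = -1 := by
  have h := map_neg (complexifyHom n) 1
  rwa [map_one] at h

theorem mem_center_SOStar_iff (A : SOStar 3) : A ∈ Subgroup.center (SOStar 3) ↔
    (A.1 : Matrix (Fin 3) (Fin 3) ℍ[ℝ]) = 1 ∨ (A.1 : Matrix (Fin 3) (Fin 3) ℍ[ℝ]) = -1 := by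
  rw [Subgroup.mem_center_iff]
  constructor
  · intro hA
    obtain ⟨S, rfl⟩ := covering_surjective A
    -- Lifts satisfy TS = ±ST, so S commutes with T² in either case; S is then a scalar z with z⁴ =
    -- 1, and its image is z² = ±1.
    have hsq : ∀ T : SU31, S * (T * T) = T * T * S := by
      intro T
      have h := hA (covering T)
      rw [← map_mul, ← map_mul, covering_eq_iff] at h
      apply SU31.ext
      simp only [SU31.coe_mul]
      rcases h with h | h
      · have h1 : T.1.1 * S.1.1 = S.1.1 * T.1.1 := congrArg (fun R : SU31 => R.1.1) h
        rw [← Matrix.mul_assoc, ← h1, Matrix.mul_assoc, ← h1, Matrix.mul_assoc]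
      · have h1 : T.1.1 * S.1.1 = -(S.1.1 * T.1.1) := congrArg (fun R : SU31 => R.1.1) h
        have h2 : S.1.1 * T.1.1 = -(T.1.1 * S.1.1) := by rw [h1, neg_neg]
        rw [← Matrix.mul_assoc, h2, Matrix.neg_mul, Matrix.mul_assoc, h2, Matrix.mul_neg, neg_neg,
          Matrix.mul_assoc]
    obtain ⟨z, hz, hS⟩ := exists_scalar_of_commute_sq hsq
    have h1 := complexify_covering_of_coe_eq hS
    have h2 : (z ^ 2 - 1) * (z ^ 2 + 1) = 0 := by linear_combination hz
    rcases mul_eq_zero.mp h2 with h | h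
    · left
      apply complexify_injective
      rw [h1, sub_eq_zero.mp h, one_smul, complexify_one]
    · right
      apply complexify_injective
      rw [h1, eq_neg_of_add_eq_zero_left h, neg_one_smul, complexify_neg_one]
  · intro h B
    apply Subtype.ext
    apply Units.ext
    change (B.1 : Matrix (Fin 3) (Fin 3) ℍ[ℝ]) * (A.1 : Matrix (Fin 3) (Fin 3) ℍ[ℝ]) =
      (A.1 : Matrix (Fin 3) (Fin 3) ℍ[ℝ]) * (B.1 : Matrix (Fin 3) (Fin 3) ℍ[ℝ])
    rcases h with h | h
    · rw [h, mul_one, one_mul]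
    · rw [h, mul_neg, neg_mul, mul_one, one_mul]

theorem coe_covering_of_coe_eq_I {S : SU31} (hS : S.1.1 = Complex.I • 1) :
    ((covering S : (Matrix (Fin 3) (Fin 3) ℍ[ℝ])ˣ) : Matrix (Fin 3) (Fin 3) ℍ[ℝ]) = -1 := by
  apply complexify_injective
  rw [complexify_covering_of_coe_eq hS, Complex.I_sq, neg_one_smul, complexify_neg_one]

theorem nonempty_center_SOStar_equiv :
    Nonempty (Subgroup.center (SOStar 3) ≃* Multiplicative (ZMod 2)) := by
  set A : SOStar 3 := covering (suScalar Complex.I Complex.I_pow_four) with hA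
  have hA1 : (A.1 : Matrix (Fin 3) (Fin 3) ℍ[ℝ]) = -1 := coe_covering_of_coe_eq_I rfl
  have hcard : Nat.card (Subgroup.center (SOStar 3)) = 2 := by
    refine Nat.card_eq_two_iff.mpr ⟨1, ⟨A, (mem_center_SOStar_iff A).mpr (Or.inr hA1)⟩, ?_, ?_⟩
    · intro h
      have h1 : (1 : Matrix (Fin 3) (Fin 3) ℍ[ℝ]) = A.1 :=
        congrArg (fun B : Subgroup.center (SOStar 3) => (B.1.1 : Matrix (Fin 3) (Fin 3) ℍ[ℝ])) h
      rw [hA1] at h1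
      have h2 := congrArg QuaternionAlgebra.re (congrFun (congrFun h1 0) 0)
      change (1 : ℝ) = -1 at h2
      norm_num at h2
    · refine Set.eq_univ_of_forall fun B => ?_
      rcases (mem_center_SOStar_iff B.1).mp B.2 with h | h
      · exact Or.inl (Subtype.ext (Subtype.ext (Units.ext h)))
      · exact Or.inr (Subtype.ext (Subtype.ext (Units.ext (h.trans hA1.symm))))
  have : Fact (Nat.Prime 2) := ⟨Nat.prime_two⟩
  exact ⟨mulEquivOfPrimeCardEq hcard
    (by rw [Nat.card_congr Multiplicative.toAdd, Nat.card_zmod])⟩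

/-- The last entry -3πi/2 is written as πi/2 - 2πi to make its exponential visibly i. -/
theorem smul_suBasis_last : (Real.sqrt 6 * Real.pi) • (suBasis 14 : Matrix (Fin 4) (Fin 4) ℂ) =
    diagonal ![Real.pi / 2 * Complex.I, Real.pi / 2 * Complex.I, Real.pi / 2 * Complex.I,
      Real.pi / 2 * Complex.I - 2 * Real.pi * Complex.I] := by
  have h6 : (Real.sqrt 6 : ℂ) ≠ 0 := by simp
  rw [suBasis_apply, coe_suEquiv, suMatrix_eq]
  ext i j
  fin_cases i <;> fin_cases j <;> simp <;> field_simp <;> ring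

theorem exp_smul_suBasis_last :
    NormedSpace.exp ((Real.sqrt 6 * Real.pi) • (suBasis 14 : Matrix (Fin 4) (Fin 4) ℂ)) =
      Complex.I • 1 := by
  rw [smul_suBasis_last, Matrix.exp_diagonal, smul_one_eq_diagonal]
  congr 1
  ext i
  rw [Pi.coe_exp, ← Complex.exp_eq_exp_ℂ]
  fin_cases i <;> simp [Complex.exp_sub, Complex.exp_pi_div_two_mul_I]

/-- The covering carries exp X to exp σ(X) and the scalar i to -1, so no quaternionic exponential is
computed. -/
theorem exp_smul_soBasis_last :
    NormedSpace.exp ((Real.sqrt 6 * Real.pi) • (soBasis 14 : Matrix (Fin 3) (Fin 3) ℍ[ℝ])) =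
      -1 := by
  set X : su31 := (Real.sqrt 6 * Real.pi) • suBasis 14 with hX
  have h1 : (lieEquiv X : Matrix (Fin 3) (Fin 3) ℍ[ℝ]) =
      (Real.sqrt 6 * Real.pi) • (soBasis 14 : Matrix (Fin 3) (Fin 3) ℍ[ℝ]) := by
    rw [hX, map_smul, lieEquiv_suBasis]
    rfl
  rw [← h1, ← covering_suExp]
  exact coe_covering_of_coe_eq_I exp_smul_suBasis_last

/-! ### The isomorphism with `Spin*(6)` -/

theorem continuous_spinor : Continuous spinor :=
  IsModuleTopology.continuous_of_linearMap spinor.toLinearMap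

theorem continuous_spinorEquiv_symm : Continuous spinorEquiv.symm :=
  have : IsTopologicalAddGroup (CliffordAlgebra (stdQuad 3)) :=
    IsModuleTopology.topologicalAddGroup ℂ _
  have : ContinuousSMul ℂ (CliffordAlgebra (stdQuad 3)) := IsModuleTopology.toContinuousSMul ℂ _
  spinorEquiv.symm.toLinearMap.continuous_of_finiteDimensional

/-- The homomorphism `SU(3,1) → Spin*(6)`. -/
noncomputable def spinHom : SU31 →* SpinStar 3 where
  toFun S := ⟨⟨spinLift S.1, spinLift_mem_spinGroup S.1⟩, (covering S).1, (covering S).2,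
    fun v => by rw [complexify_covering, ← spinLift_conj]⟩
  map_one' := Subtype.ext (Subtype.ext (map_one spinLift))
  map_mul' S T := Subtype.ext (Subtype.ext (map_mul spinLift S.1 T.1))

theorem spinor_spinHom (S : SU31) :
    spinor (((spinHom S : SpinStar 3) : spinGroup (stdQuad 3)) : CliffordAlgebra (stdQuad 3)) =
      spinBlock S.1 := spinor_spinLift S.1

theorem spinHom_injective : Function.Injective spinHom := by
  intro S T h
  have h1 := congrArg (fun x : SpinStar 3 => spinor x.1.1) h
  exact Subtype.ext (spinBlock_injective (by rwa [← spinor_spinHom, ← spinor_spinHom]))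

/-- The rotation of x lifts to some S in SU(3,1), and x is the spin lift of S or of -S, both of
which lie in SU(3,1). -/
theorem spinHom_surjective : Function.Surjective spinHom := by
  rintro ⟨⟨x, hx⟩, A, hA, h⟩
  obtain ⟨S, hS⟩ := covering_surjective ⟨A, hA⟩
  have hSA : complexify (A : Matrix (Fin 3) (Fin 3) ℍ[ℝ]) = wedgeRot S.1.1 := by
    rw [← complexify_covering, hS]
  rw [hSA] at h
  rcases eq_spinLift_of_conj hx h with h1 | h1
  · exact ⟨S, Subtype.ext (Subtype.ext h1.symm)⟩
  · exact ⟨-S, Subtype.ext (Subtype.ext h1.symm)⟩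

theorem continuous_spinHom : Continuous spinHom := by
  refine Continuous.subtype_mk (Continuous.subtype_mk ?_ _) _
  refine continuous_spinorEquiv_symm.comp ?_
  have h1 := continuous_coe_SU31
  have h2 := continuous_coe_SU31.comp continuous_inv
  refine continuous_matrix ?_
  rintro (i | i) (j | j)
  · exact h1.matrix_elem i j
  · exact continuous_const
  · exact continuous_const
  · exact h2.matrix_elem j i

/-- The isomorphism of topological groups `SU(3,1) ≅ Spin*(6)`. -/
noncomputable def spinEquiv : SU31 ≃ₜ* SpinStar 3 :=
  let e := MulEquiv.ofBijective spinHom ⟨spinHom_injective, spinHom_surjective⟩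
  { e with
    continuous_toFun := continuous_spinHom
    continuous_invFun := by
      -- The inverse reads S off as the upper left block of the spinor matrix, which is continuous
      -- in x.
      refine isClosedEmbedding_coe_SU31.isInducing.continuous_iff.mpr ?_
      have h : (fun S : SU31 => S.1.1) ∘ e.symm =
          fun x : SpinStar 3 => (spinor x.1.1).toBlocks₁₁ := by
        ext1 x
        obtain ⟨S, rfl⟩ := e.surjective x
        rw [Function.comp_apply, e.symm_apply_apply]
        change S.1.1 = (spinor (spinHom S).1.1).toBlocks₁₁
        rw [spinor_spinHom, spinBlock_apply, toBlocks_fromBlocks₁₁]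
      change Continuous ((fun S : SU31 => S.1.1) ∘ e.symm)
      rw [h]
      have hc : Continuous fun x : SpinStar 3 => spinor x.1.1 :=
        continuous_spinor.comp (continuous_subtype_val.comp continuous_subtype_val)
      exact continuous_matrix fun i j => hc.matrix_elem _ _ }

/-! ### The theorem assembled. -/

theorem mainTheorem3 :
    ∃ (bs : Module.Basis (Fin 15) ℝ su31) (ba : Module.Basis (Fin 15) ℝ (soStar 3))
      (σ : su31 ≃ₗ⁅ℝ⁆ soStar 3)
      (f : Module.Basis (Fin 3 ⊕ Fin 3) ℂ (⋀[ℂ]^2 (Fin 4 → ℂ)))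
      (π : SU31 →* SOStar 3)
      (e : SU31 ≃ₜ* SpinStar 3),
      -- the Lie algebras: explicit bases with the same structure constants
      (∀ θ : Fin 15 → ℝ,
        ((∑ i, θ i • bs i : su31) : Matrix (Fin 4) (Fin 4) ℂ) = suMatrix θ) ∧
      (∀ θ : Fin 15 → ℝ,
        ((∑ i, θ i • ba i : soStar 3) : Matrix (Fin 3) (Fin 3) ℍ[ℝ]) = soMatrix θ) ∧
      changeOfBasisᴴ * changeOfBasis = 1 ∧
      (∀ i, changeOfBasisᴴ * complexify (ba i : Matrix (Fin 3) (Fin 3) ℍ[ℝ]) * changeOfBasis =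
        soComplexGen i) ∧
      (∀ i j k, bs.repr ⁅bs i, bs j⁆ k = ba.repr ⁅ba i, ba j⁆ k) ∧
      (∀ i, σ (bs i) = ba i) ∧
      -- the group homomorphism integrates the isomorphism of Lie algebras
      (∀ X : su31, ∃ S : SU31,
        ((S : SpecialLinearGroup (Fin 4) ℂ) : Matrix (Fin 4) (Fin 4) ℂ) =
          NormedSpace.exp (X : Matrix (Fin 4) (Fin 4) ℂ) ∧
        ((π S : (Matrix (Fin 3) (Fin 3) ℍ[ℝ])ˣ) : Matrix (Fin 3) (Fin 3) ℍ[ℝ]) =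
          NormedSpace.exp (σ X : Matrix (Fin 3) (Fin 3) ℍ[ℝ])) ∧
      -- it is the exterior square of the defining representation
      (∀ x, f x = wedgeVec x) ∧
      (∀ S : SU31,
        changeOfBasisᴴ *
            complexify ((π S : (Matrix (Fin 3) (Fin 3) ℍ[ℝ])ˣ) : Matrix (Fin 3) (Fin 3) ℍ[ℝ]) *
            changeOfBasis =
          LinearMap.toMatrix f f (exteriorPower.map 2
            (Matrix.toLin' ((S : SpecialLinearGroup (Fin 4) ℂ) : Matrix (Fin 4) (Fin 4) ℂ)))) ∧
      -- it is a double covering with kernel `{1, -1}`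
      Continuous π ∧ IsCoveringMap π ∧ Function.Surjective π ∧
      (∀ S : SU31, π S = 1 ↔
        ((S : SpecialLinearGroup (Fin 4) ℂ) : Matrix (Fin 4) (Fin 4) ℂ) = 1 ∨
        ((S : SpecialLinearGroup (Fin 4) ℂ) : Matrix (Fin 4) (Fin 4) ℂ) = -1) ∧
      (∀ A : SOStar 3, (π ⁻¹' {A}).ncard = 2) ∧
      Nonempty ((SU31 ⧸ π.ker) ≃ₜ* SOStar 3) ∧
      -- the centers
      (∀ S : SU31, S ∈ Subgroup.center SU31 ↔ ∃ z : ℂ, z ^ 4 = 1 ∧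
        ((S : SpecialLinearGroup (Fin 4) ℂ) : Matrix (Fin 4) (Fin 4) ℂ) = z • 1) ∧
      Nonempty (Subgroup.center SU31 ≃* Multiplicative (ZMod 4)) ∧
      NormedSpace.exp ((Real.sqrt 6 * Real.pi) • (bs 14 : Matrix (Fin 4) (Fin 4) ℂ)) =
        Complex.I • 1 ∧
      (∀ A : SOStar 3, A ∈ Subgroup.center (SOStar 3) ↔
        ((A : (Matrix (Fin 3) (Fin 3) ℍ[ℝ])ˣ) : Matrix (Fin 3) (Fin 3) ℍ[ℝ]) = 1 ∨
        ((A : (Matrix (Fin 3) (Fin 3) ℍ[ℝ])ˣ) : Matrix (Fin 3) (Fin 3) ℍ[ℝ]) = -1) ∧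
      Nonempty (Subgroup.center (SOStar 3) ≃* Multiplicative (ZMod 2)) ∧
      NormedSpace.exp ((Real.sqrt 6 * Real.pi) • (ba 14 : Matrix (Fin 3) (Fin 3) ℍ[ℝ])) = -1 ∧
      (∀ (S : SU31) (z : ℂ), S ∈ Subgroup.center SU31 →
        ((S : SpecialLinearGroup (Fin 4) ℂ) : Matrix (Fin 4) (Fin 4) ℂ) = z • 1 →
        complexify ((π S : (Matrix (Fin 3) (Fin 3) ℍ[ℝ])ˣ) : Matrix (Fin 3) (Fin 3) ℍ[ℝ]) =
          z ^ 2 • 1) ∧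
      -- `Spin*(6) = SU(3,1)`, compatibly with the projections to `SO*(6)`
      (∀ (S : SU31) (v : Fin 3 × Fin 2 → ℂ),
        (((e S : SpinStar 3) : spinGroup (stdQuad 3)) : CliffordAlgebra (stdQuad 3)) *
            CliffordAlgebra.ι (stdQuad 3) v *
            star (((e S : SpinStar 3) : spinGroup (stdQuad 3)) : CliffordAlgebra (stdQuad 3)) =
          CliffordAlgebra.ι (stdQuad 3)
            (complexify ((π S : (Matrix (Fin 3) (Fin 3) ℍ[ℝ])ˣ) :
              Matrix (Fin 3) (Fin 3) ℍ[ℝ]) *ᵥ v)) := by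
  refine ⟨suBasis, soBasis, lieEquiv, wedgeBasis, covering, spinEquiv, fun θ => ?_, fun θ => ?_,
    changeOfBasis_conjTranspose_mul, conj_complexify_soBasis, repr_lie_eq, lieEquiv_suBasis,
    fun X => ⟨suExp X, rfl, covering_suExp X⟩, wedgeBasis_apply, fun S => ?_,
    continuous_covering, isCoveringMap_covering, covering_surjective, covering_eq_one_iff,
    ncard_fibre_covering, nonempty_quotient_ker_covering, mem_center_SU31_iff,
    nonempty_center_SU31_equiv, exp_smul_suBasis_last, mem_center_SOStar_iff,
    nonempty_center_SOStar_equiv, exp_smul_soBasis_last,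
    fun S z _ hS => complexify_covering_of_coe_eq hS, fun S v => ?_⟩
  · rw [sum_smul_suBasis, coe_suEquiv]
  · rw [sum_smul_soBasis, coe_soEquiv]
  · rw [toMatrix_exteriorSquare, complexify_covering, wedgeRot, conjTranspose_changeOfBasis_conj]
  · rw [complexify_covering]
    exact spinLift_conj S.1 v
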